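/- \textbf{Conventions.} A directed graph $G$ is a set $V(G)$ with a set of edges $E(G)\subseteq V(G)\times V(G)$; a map $f\colon G\to H$ is a function $V(G)\to V(H)$ such that for every edge $(u,v)$ of $G$ either $f(u)=f(v)$ or $(f(u),f(v))\in E(H)$. A directed path is a tuple of vertices in which consecutive entries are equal or joined by a directed edge. The box product $G\,\square\, H$ and the strong product $G\boxtimes H$ have vertex set $V(G)\times V(H)$; in $G\,\square\, H$ there is an edge $(g_1,h_1)\to(g_2,h_2)$ if $g_1=g_2$ and $(h_1,h_2)\in E(H)$, or $(g_1,g_2)\in E(G)$ and $h_1=h_2$; in $G\boxtimes H$ there is moreover such an edge if $(g_1,g_2)\in E(G)$ and $(h_1,h_2)\in E(H)$. For a commutative ring $R$, the reachability complex $\mathrm{RC}_*(G;R)$ is in degree $k\ge 0$ the free $R$-module on the tuples $(v_0,\dots,v_k)$ of vertices with $v_{j-1}\neq v_j$ and with a directed path from $v_{j-1}$ to $v_j$ for all $1\le j\le k$; its differential is $\partial(v_0,\dots,v_k)=\sum_{j=0}^k(-1)^j(v_0,\dots,\widehat{v_j},\dots,v_k)$, where terms with two equal adjacent entries are omitted.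 A map $f$ of directed graphs acts entrywise on tuples, a tuple with two equal adjacent entries counting as $0$. The reachability homology is $\mathrm{RH}_k(G;R)=H_k(\mathrm{RC}_*(G;R))$. \textbf{Theorem (Künneth theorem for reachability homology).} Let $R$ be a PID. For each $k\ge 0$ there are short exact sequences \[0\to\bigoplus_{i+j=k}\mathrm{RH}_i(G;R)\otimes_R\mathrm{RH}_j(H;R)\to\mathrm{RH}_k(G\boxtimes H;R)\to\bigoplus_{i+j=k-1}\mathrm{Tor}_1^R(\mathrm{RH}_i(G;R),\mathrm{RH}_j(H;R))\to0\] and \[0\to\bigoplus_{i+j=k}\mathrm{RH}_i(G;R)\otimes_R\mathrm{RH}_j(H;R)\to\mathrm{RH}_k(G\,\square\, H;R)\to\bigoplus_{i+j=k-1}\mathrm{Tor}_1^R(\mathrm{RH}_i(G;R),\mathrm{RH}_j(H;R))\to0,\] for all directed graphs $G$ and $H$, natural in $G$ and $H$ with respect to maps of directed graphs. For every $G$ and $H$ both sequences split. The splittings are not natural: if $k\ge 3$ and some integer is neither zero nor a unit in $R$ (for example $R=\mathbb Z$), then for neither of the two sequences can splittings for all $G$ and $H$ be chosen so as to be natural in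 $G$ and $H$. -/

import Mathlib

open CategoryTheory Limits

universe u

noncomputable section

/-- A (bundled) directed graph: a set of vertices with a set of directed edges, i.e. a binary
relation on the vertices. Loops are allowed, multiple edges are not. -/
structure DirGraph : Type (u + 1) where
  /-- the vertices -/
  V : Type u
  /-- the directed edges -/
  graph : Digraph V

namespace DirGraph

/-- A map of directed graphs preserves each edge or contracts it. -/
@[ext]
structure Hom (G H : DirGraph.{u}) : Type u where
  /-- the function on vertices -/
  toFun : G.V → H.V
  map_edge : ∀ ⦃u v : G.V⦄, G.graph.Adj u v →
    toFun u = toFun v ∨ H.graph.Adj (toFun u) (toFun v)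

instance : Category DirGraph.{u} where
  Hom := Hom
  id G := ⟨fun v => v, fun _ _ h => Or.inr h⟩
  comp f g := ⟨fun v => g.toFun (f.toFun v), fun _ _ h => by
    rcases f.map_edge h with h | h
    · exact Or.inl (congrArg g.toFun h)
    · exact g.map_edge h⟩

variable (G : DirGraph.{u})

/-- A directed path `(v₀, …, vₖ)`: consecutive vertices are equal or joined by a directed edge. -/
def IsDirectedPath {k : ℕ} (v : Fin (k + 1) → G.V) : Prop :=
  ∀ i : Fin k, v i.castSucc = v i.succ ∨ G.graph.Adj (v i.castSucc) (v i.succ)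

/-- There is a directed path from `u` to `v`. -/
def Reachable (u v : G.V) : Prop :=
  ∃ (k : ℕ) (p : Fin (k + 1) → G.V), G.IsDirectedPath p ∧ p 0 = u ∧ p (Fin.last k) = v

/-- Reachability is the reflexive transitive closure of the edge relation. -/
theorem reachable_iff (u v : G.V) :
    G.Reachable u v ↔ Relation.ReflTransGen G.graph.Adj u v := by
  constructor
  · rintro ⟨k, p, hp, rfl, rfl⟩
    have key : ∀ i : Fin (k + 1), Relation.ReflTransGen G.graph.Adj (p 0) (p i) := by
      intro i
      induction i using Fin.induction with
      | zero => exact Relation.ReflTransGen.refl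
      | succ i ih =>
        rcases hp i with h | h
        · rwa [← h]
        · exact ih.tail h
    exact key _
  · intro h
    induction h with
    | refl => exact ⟨0, fun _ => u, fun i => i.elim0, rfl, rfl⟩
    | @tail b c _ hbc ih =>
      obtain ⟨k, p, hp, h0, hl⟩ := ih
      refine ⟨k + 1, Fin.snoc (α := fun _ => G.V) p c, ?_, ?_, ?_⟩
      · intro i
        induction i using Fin.lastCases with
        | last =>
          right
          rw [Fin.succ_last, Fin.snoc_last, Fin.snoc_castSucc, hl]
          exact hbc
        | cast i =>
          rw [Fin.succ_castSucc, Fin.snoc_castSucc, Fin.snoc_castSucc]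
          exact hp i
      · rw [← Fin.castSucc_zero, Fin.snoc_castSucc, h0]
      · exact Fin.snoc_last _ _

variable {G}

theorem Reachable.trans {u v w : G.V} (h : G.Reachable u v) (h' : G.Reachable v w) :
    G.Reachable u w := by
  rw [reachable_iff] at *
  exact h.trans h'

theorem Reachable.map {H : DirGraph.{u}} (f : G ⟶ H) {u v : G.V} (h : G.Reachable u v) :
    H.Reachable (f.toFun u) (f.toFun v) := by
  obtain ⟨k, p, hp, rfl, rfl⟩ := h
  refine ⟨k, fun i => f.toFun (p i), fun i => ?_, rfl, rfl⟩
  rcases hp i with h | h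
  · exact Or.inl (congrArg f.toFun h)
  · exact f.map_edge h

/-! ### The reachability complex -/

/-- Each entry of the tuple can reach the next one. -/
def IsChain {k : ℕ} (v : Fin (k + 1) → G.V) : Prop :=
  ∀ j : Fin k, G.Reachable (v j.castSucc) (v j.succ)

/-- Adjacent entries of the tuple are distinct. -/
def IsRegular {k : ℕ} (v : Fin (k + 1) → G.V) : Prop :=
  ∀ j : Fin k, v j.castSucc ≠ v j.succ

variable (G) in
/-- The generators of the reachability complex in degree `k`. -/
abbrev Gen (k : ℕ) : Type u :=
  {v : Fin (k + 1) → G.V // IsRegular v ∧ IsChain v}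

variable (R : Type u) [CommRing R]

open Classical in
/-- The basis element given by the tuple `v`, where tuples that are not generators count as `0`. -/
def basisElt {k : ℕ} (v : Fin (k + 1) → G.V) : G.Gen k →₀ R :=
  if h : IsRegular v ∧ IsChain v then Finsupp.single ⟨v, h⟩ 1 else 0

variable (G) in
/-- The differential: the alternating sum over the tuples with one entry omitted, where a tuple
in which adjacent entries coincide counts as `0`. -/
def boundary (k : ℕ) : (G.Gen (k + 1) →₀ R) →ₗ[R] (G.Gen k →₀ R) :=
  Finsupp.linearCombination R fun v : G.Gen (k + 1) =>
    ∑ j : Fin (k + 2), (-1 : R) ^ (j : ℕ) • basisElt R fun i : Fin (k + 1) => v.1 (j.succAbove i)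

/-- A map of directed graphs acts entrywise on tuples, where a tuple in which adjacent entries
coincide counts as `0`. -/
def chainMap {G H : DirGraph.{u}} (f : G ⟶ H) (k : ℕ) : (G.Gen k →₀ R) →ₗ[R] (H.Gen k →₀ R) :=
  Finsupp.linearCombination R fun v : G.Gen k => basisElt R fun i => f.toFun (v.1 i)

theorem basisElt_gen {k : ℕ} (v : G.Gen k) : basisElt R v.1 = Finsupp.single v 1 :=
  dif_pos v.2

theorem basisElt_of_eq {k : ℕ} {v : Fin (k + 1) → G.V} {j : Fin k}
    (h : v j.castSucc = v j.succ) : basisElt R v = 0 :=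
  dif_neg fun h' => h'.1 j h

theorem IsChain.reachable {k : ℕ} {v : Fin (k + 1) → G.V} (hv : IsChain v) {i j : Fin (k + 1)}
    (hij : i ≤ j) : G.Reachable (v i) (v j) := by
  induction j using Fin.induction with
  | zero =>
    obtain rfl : i = 0 := le_antisymm hij (Fin.zero_le _)
    exact (reachable_iff G _ _).2 .refl
  | succ j ih =>
    rcases hij.lt_or_eq with h | rfl
    · exact (ih (Fin.le_castSucc_iff.2 h)).trans (hv j)
    · exact (reachable_iff G _ _).2 .refl

theorem IsChain.face {k : ℕ} {v : Fin (k + 2) → G.V} (hv : IsChain v) (j : Fin (k + 2)) :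
    IsChain fun i : Fin (k + 1) => v (j.succAbove i) := fun _ =>
  hv.reachable ((Fin.strictMono_succAbove j).monotone (Fin.castSucc_lt_succ).le)

theorem boundary_basisElt {k : ℕ} {v : Fin (k + 2) → G.V} (hv : IsChain v) :
    boundary G R k (basisElt R v) =
      ∑ j : Fin (k + 2), (-1 : R) ^ (j : ℕ) • basisElt R fun i => v (j.succAbove i) := by
  by_cases hr : IsRegular v
  · rw [basisElt_gen R (⟨v, hr, hv⟩ : G.Gen (k + 1)), boundary,
      Finsupp.linearCombination_single, one_smul]
  · unfold IsRegular at hr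
    push Not at hr
    obtain ⟨i, hi⟩ := hr
    rw [basisElt_of_eq R hi, map_zero]
    symm
    have hne : i.castSucc ≠ i.succ := (Fin.castSucc_lt_succ).ne
    rw [Fintype.sum_eq_add i.castSucc i.succ hne]
    · have : (fun l => v (i.castSucc.succAbove l)) = fun l => v (i.succ.succAbove l) := by
        funext l
        rcases lt_trichotomy l i with h | rfl | h
        · rw [Fin.succAbove_of_castSucc_lt _ _ (Fin.castSucc_lt_castSucc_iff.2 h),
            Fin.succAbove_of_castSucc_lt _ _
              ((Fin.castSucc_lt_castSucc_iff.2 h).trans Fin.castSucc_lt_succ)]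
        · rw [Fin.succAbove_castSucc_self, Fin.succAbove_succ_self, hi]
        · rw [Fin.succAbove_of_le_castSucc _ _ (Fin.castSucc_le_castSucc_iff.2 h.le),
            Fin.succAbove_of_le_castSucc _ _ (Fin.succ_le_castSucc_iff.2 h)]
      rw [this, Fin.val_castSucc, Fin.val_succ, pow_succ]
      simp
    · rintro j ⟨h1, h2⟩
      obtain ⟨l, hl1, hl2⟩ : ∃ l : Fin k,
          j.succAbove l.castSucc = i.castSucc ∧ j.succAbove l.succ = i.succ := by
        have h1' : (j : ℕ) ≠ i := fun h => h1 (Fin.ext h)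
        have h2' : (j : ℕ) ≠ i + 1 := fun h => h2 (Fin.ext h)
        have hj := j.2
        have hi' := i.2
        rcases lt_or_gt_of_ne h1' with h | h
        · refine ⟨⟨i - 1, by omega⟩, ?_, ?_⟩ <;>
          · apply Fin.ext
            simp only [Fin.succAbove, Fin.lt_def, Fin.val_castSucc, Fin.val_succ]
            split_ifs <;> simp <;> omega
        · refine ⟨⟨i, by omega⟩, ?_, ?_⟩ <;>
          · apply Fin.ext
            simp only [Fin.succAbove, Fin.lt_def, Fin.val_castSucc, Fin.val_succ]
            split_ifs <;> simp <;> omega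
      rw [basisElt_of_eq R (j := l) (by simp only [hl1, hl2, hi]), smul_zero]

theorem boundary_comp_boundary (k : ℕ) : boundary G R k ∘ₗ boundary G R (k + 1) = 0 := by
  refine Finsupp.lhom_ext' fun v => LinearMap.ext_ring ?_
  simp only [LinearMap.comp_apply, Finsupp.lsingle_apply, LinearMap.zero_apply]
  rw [← basisElt_gen R v, boundary_basisElt R v.2.2, map_sum]
  simp only [map_smul, boundary_basisElt R (v.2.2.face _), Finset.smul_sum, smul_smul]
  rw [← Fintype.sum_prod_type']
  refine Finset.sum_involution
    (fun (x : Fin (k + 3) × Fin (k + 2)) _ => (x.1.succAbove x.2, x.2.predAbove x.1)) ?_ ?_ ?_ ?_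
  · rintro ⟨i, j⟩ -
    simp only [Fin.succAbove_succAbove_succAbove_predAbove]
    rw [← pow_add, ← pow_add, Fin.neg_one_pow_succAbove_add_predAbove, neg_smul, add_neg_cancel]
  · rintro ⟨i, j⟩ - - h
    exact Fin.succAbove_ne i j (congrArg Prod.fst h)
  · intros
    exact Finset.mem_univ _
  · rintro ⟨i, j⟩ -
    simp [Fin.succAbove_succAbove_predAbove, Fin.predAbove_predAbove_succAbove]

theorem IsChain.map {H : DirGraph.{u}} (f : G ⟶ H) {k : ℕ} {v : Fin (k + 1) → G.V}
    (hv : IsChain v) : IsChain (G := H) fun i => f.toFun (v i) := fun j => (hv j).map f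

theorem chainMap_basisElt {G H : DirGraph.{u}} (f : G ⟶ H) {k : ℕ} {v : Fin (k + 1) → G.V}
    (hv : IsChain v) : chainMap R f k (basisElt R v) = basisElt R fun i => f.toFun (v i) := by
  by_cases hr : IsRegular v
  · rw [basisElt_gen R (⟨v, hr, hv⟩ : G.Gen k), chainMap, Finsupp.linearCombination_single,
      one_smul]
  · unfold IsRegular at hr
    push Not at hr
    obtain ⟨i, hi⟩ := hr
    rw [basisElt_of_eq R hi, map_zero, basisElt_of_eq R (j := i) (congrArg f.toFun hi)]

theorem chainMap_comp_boundary {G H : DirGraph.{u}} (f : G ⟶ H) (k : ℕ) :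
    chainMap R f k ∘ₗ boundary G R k = boundary H R k ∘ₗ chainMap R f (k + 1) := by
  refine Finsupp.lhom_ext' fun v => LinearMap.ext_ring ?_
  simp only [LinearMap.comp_apply, Finsupp.lsingle_apply]
  rw [← basisElt_gen R v, boundary_basisElt R v.2.2, chainMap_basisElt R f v.2.2,
    boundary_basisElt R (v.2.2.map f), map_sum]
  simp only [map_smul, chainMap_basisElt R f (v.2.2.face _)]

theorem chainMap_id (k : ℕ) : chainMap R (𝟙 G) k = LinearMap.id := by
  refine Finsupp.lhom_ext' fun v => LinearMap.ext_ring ?_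
  simp only [LinearMap.comp_apply, Finsupp.lsingle_apply, LinearMap.id_apply]
  rw [← basisElt_gen R v, chainMap_basisElt R _ v.2.2]
  rfl

theorem chainMap_comp {G H K : DirGraph.{u}} (f : G ⟶ H) (g : H ⟶ K) (k : ℕ) :
    chainMap R (f ≫ g) k = chainMap R g k ∘ₗ chainMap R f k := by
  refine Finsupp.lhom_ext' fun v => LinearMap.ext_ring ?_
  simp only [LinearMap.comp_apply, Finsupp.lsingle_apply]
  rw [← basisElt_gen R v, chainMap_basisElt R _ v.2.2, chainMap_basisElt R _ v.2.2,
    chainMap_basisElt R _ (v.2.2.map f)]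
  rfl

/-- The reachability complex `RC_*(G; R)`, as a functor of `G`. -/
def reachabilityComplex : DirGraph.{u} ⥤ ChainComplex (ModuleCat.{u} R) ℕ where
  obj G := ChainComplex.of (fun k => ModuleCat.of R (G.Gen k →₀ R))
    (fun k => ModuleCat.ofHom (boundary G R k))
    (fun k => by rw [← ModuleCat.ofHom_comp, boundary_comp_boundary]; rfl)
  map f := ChainComplex.ofHom (fun k => ModuleCat.ofHom (chainMap R f k))
    (fun k => by
      simp only [ChainComplex.of_d]
      rw [← ModuleCat.ofHom_comp, ← ModuleCat.ofHom_comp, chainMap_comp_boundary])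
  map_id G := by
    ext k : 1
    exact congrArg ModuleCat.ofHom (chainMap_id R k)
  map_comp f g := by
    ext k : 1
    exact congrArg ModuleCat.ofHom (chainMap_comp R f g k)

/-- Reachability homology `RH_k(G; R)`, as a functor of `G`. -/
def reachabilityHomology (k : ℕ) : DirGraph.{u} ⥤ ModuleCat.{u} R :=
  reachabilityComplex R ⋙ HomologicalComplex.homologyFunctor _ _ k

/-! ### Products of directed graphs -/

/-- The box product of directed graphs, as a functor of two variables. -/
def boxProduct : DirGraph.{u} × DirGraph.{u} ⥤ DirGraph.{u} where
  obj P :=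
    { V := P.1.V × P.2.V
      graph :=
        { Adj := fun x y =>
            (x.1 = y.1 ∧ P.2.graph.Adj x.2 y.2) ∨ (P.1.graph.Adj x.1 y.1 ∧ x.2 = y.2) } }
  map f :=
    { toFun := fun x => (f.1.toFun x.1, f.2.toFun x.2)
      map_edge := by
        rintro ⟨a, b⟩ ⟨c, d⟩ (⟨h, h'⟩ | ⟨h, h'⟩)
        · obtain rfl : a = c := h
          rcases f.2.map_edge h' with h' | h'
          · exact Or.inl (Prod.ext rfl h')
          · exact Or.inr (Or.inl ⟨rfl, h'⟩)
        · obtain rfl : b = d := h'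
          rcases f.1.map_edge h with h | h
          · exact Or.inl (Prod.ext h rfl)
          · exact Or.inr (Or.inr ⟨h, rfl⟩) }

/-- The strong product of directed graphs, as a functor of two variables. -/
def strongProduct : DirGraph.{u} × DirGraph.{u} ⥤ DirGraph.{u} where
  obj P :=
    { V := P.1.V × P.2.V
      graph :=
        { Adj := fun x y =>
            (x.1 = y.1 ∧ P.2.graph.Adj x.2 y.2) ∨ (P.1.graph.Adj x.1 y.1 ∧ x.2 = y.2) ∨
              (P.1.graph.Adj x.1 y.1 ∧ P.2.graph.Adj x.2 y.2) } }
  map f :=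
    { toFun := fun x => (f.1.toFun x.1, f.2.toFun x.2)
      map_edge := by
        rintro ⟨a, b⟩ ⟨c, d⟩ (⟨h, h'⟩ | ⟨h, h'⟩ | ⟨h, h'⟩)
        · obtain rfl : a = c := h
          rcases f.2.map_edge h' with h' | h'
          · exact Or.inl (Prod.ext rfl h')
          · exact Or.inr (Or.inl ⟨rfl, h'⟩)
        · obtain rfl : b = d := h'
          rcases f.1.map_edge h with h | h
          · exact Or.inl (Prod.ext h rfl)
          · exact Or.inr (Or.inr (Or.inl ⟨h, rfl⟩))
        · rcases f.1.map_edge h with h | h <;> rcases f.2.map_edge h' with h' | h'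
          · exact Or.inl (Prod.ext h h')
          · exact Or.inr (Or.inl ⟨h, h'⟩)
          · exact Or.inr (Or.inr (Or.inl ⟨h, h'⟩))
          · exact Or.inr (Or.inr (Or.inr ⟨h, h'⟩)) }

/-! ### The outer terms of the Künneth sequences -/

/-- The pairs of degrees `(i, j)` with `i + j = k`. -/
abbrev TensorIndex (k : ℕ) : Type := {p : ℕ × ℕ // p.1 + p.2 = k}

/-- The pairs of degrees `(i, j)` with `i + j = k - 1` (none if `k = 0`). -/
abbrev TorIndex (k : ℕ) : Type := {p : ℕ × ℕ // p.1 + p.2 + 1 = k}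

instance (k : ℕ) : Finite (TensorIndex k) :=
  Set.Finite.subset (Set.finite_Iic (k, k)) fun p (hp : p.1 + p.2 = k) =>
    ⟨by dsimp only; omega, by dsimp only; omega⟩

instance (k : ℕ) : Finite (TorIndex k) :=
  Set.Finite.subset (Set.finite_Iic (k, k)) fun p (hp : p.1 + p.2 + 1 = k) =>
    ⟨by dsimp only; omega, by dsimp only; omega⟩

instance : HasFiniteBiproducts (DirGraph.{u} × DirGraph.{u} ⥤ ModuleCat.{u} R) :=
  HasFiniteBiproducts.of_hasFiniteProducts

/-- `(G, H) ↦ ⨁_{i + j = k} RH_i(G; R) ⊗ RH_j(H; R)`. -/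
def tensorTerm (k : ℕ) : DirGraph.{u} × DirGraph.{u} ⥤ ModuleCat.{u} R :=
  ⨁ fun p : TensorIndex k =>
    (reachabilityHomology R p.1.1).prod (reachabilityHomology R p.1.2) ⋙
      MonoidalCategory.tensor (ModuleCat.{u} R)

/-- `(G, H) ↦ ⨁_{i + j = k - 1} Tor₁(RH_i(G; R), RH_j(H; R))`. -/
def torTerm (k : ℕ) : DirGraph.{u} × DirGraph.{u} ⥤ ModuleCat.{u} R :=
  ⨁ fun p : TorIndex k =>
    (reachabilityHomology R p.1.1).prod (reachabilityHomology R p.1.2) ⋙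
      Functor.uncurry.obj (Tor (ModuleCat.{u} R) 1)

end DirGraph

end

/-!
The reachability complex `RC(G)` is the normalised chain complex of the simplicial set of chains of
the reachability preorder of `G`. It is free, and the box product and the strong product both have
the product preorder (`strong_reachable_iff`, `box_reachable_iff`), so the result combines an
Eilenberg–Zilber theorem with the algebraic Künneth theorem.

*Eilenberg–Zilber.* The Alexander–Whitney map `aw : RC(G ⊠ H) ⟶ RC(G) ⊗ RC(H)` is natural and a
quasi-isomorphism (`quasiIso_aw`). Its mapping cone has a basis, and each basis element lies in the
subcomplex spanned by the vertices reachable from its initial vertices `(x, y)`. On such a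
subcomplex prepending `x` or `y` is a contraction, so the cone is acyclic by
`exists_preimage_of_acyclic_carriers`.

*Künneth.* Let `K` and `L` be complexes of free modules over a principal ideal domain. Submodules of
free modules are free (`Submodule.free_of_isPrincipalIdealRing`), so the boundaries `B_j` and the
cycles `Z_j` of `L` form a free resolution `B_j → Z_j` of `H_j(L)`, and `Tor₁(M, H_j(L))` is the
kernel of `M ⊗ B_j → M ⊗ Z_j` (`torι`). A cycle of `K ⊗ L` has a component in `K_i ⊗ L_{j+1}`;
applying the differential of `L` gives an element of `Z_i ⊗ B_j`, whose image in `H_i(K) ⊗ B_j` lies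
in that kernel. This is the map to the torsion term (`torMap`, `torLift`), and the other map is the
cross product (`cross`). Exactness is `exists_cross_of_torMap_eq_zero` and `exists_torMap_eq`. Since
the cycles are direct summands, the projections to homology classes extend to all chains (`extCls`),
which gives a left inverse of the cross product (`crossRetraction`), hence a splitting for each
pair.

*Splittings are not natural.* A natural splitting would force two maps that agree on homology to
agree on homology also after taking the product with any `H` (`functor_map_eq_of_splitting`). For
an integer `n` which is neither zero nor a unit in `R`, a poset model of the Moore space with first
homology `R / n` has two maps to a poset model of the two-sphere that agree on homology: the
constant map, and a map of degree one on the two-cell (`Moore.map_toSphere_eq`). After taking the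
product with the Moore space they differ in degree `3` (`separated_three`), as a functional with
values in `R / n` shows, built from the winding number on the Moore space and the fundamental
cochain of the sphere. Further factors of the Moore space raise the degree (`Separated.succ`).
-/

noncomputable section

/-! ### Submodules of free modules over a principal ideal domain -/

section PID

variable {R : Type*} [CommRing R] [IsDomain R] [IsPrincipalIdealRing R]

/-- Order the basis by a well-order. For each index `i`, the leading coefficients of the elements of
`N` supported on indices `≤ i` form a principal ideal `(a i)`; elements `w i` realising the nonzero
generators `a i` form a basis of `N`. -/
theorem Submodule.free_of_finsupp {ι : Type*} (N : Submodule R (ι →₀ R)) : Module.Free R N := by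
  classical
  obtain ⟨_, _⟩ := exists_wellFoundedLT ι
  -- elements supported on indices `≤ i`
  let F : ι → Submodule R (ι →₀ R) := fun i => N ⊓ Finsupp.supported R R (Set.Iic i)
  let I : ι → Ideal R := fun i => (F i).map (Finsupp.lapply i)
  let a : ι → R := fun i => Submodule.IsPrincipal.generator (I i)
  have ha : ∀ i, ∃ w ∈ F i, w i = a i := fun i => by
    obtain ⟨w, hw, h⟩ := Submodule.IsPrincipal.generator_mem (I i)
    exact ⟨w, hw, h⟩
  choose w hwF hwa using ha
  have hlt : ∀ {i j}, i < j → w i j = 0 := fun {i j} hij => by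
    by_contra h
    have := (Finsupp.mem_supported R _).1 (hwF i).2 (Finsupp.mem_support_iff.2 h)
    exact absurd hij (not_lt.2 this)
  let S := {i // a i ≠ 0}
  let b : S → N := fun i => ⟨w i.1, (hwF i.1).1⟩
  have hli : LinearIndependent R b := by
    refine LinearIndependent.of_comp N.subtype (linearIndependent_iff.2 fun c hc => ?_)
    by_contra hne
    have hs : c.support.Nonempty := Finsupp.support_nonempty_iff.2 hne
    obtain ⟨i, hi, hmax⟩ := c.support.exists_max_image (fun i => i.1) hs
    have h1 := DFunLike.congr_fun hc i.1
    rw [Finsupp.linearCombination_apply, Finsupp.sum,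
      Finsupp.finsetSum_apply, Finset.sum_eq_single_of_mem i hi] at h1
    · have h2 : c i * w i.1 i.1 = 0 := h1
      rw [hwa] at h2
      exact (mul_ne_zero (Finsupp.mem_support_iff.1 hi) i.2) h2
    · intro j hj hji
      have : j.1 < i.1 := lt_of_le_of_ne (hmax j hj) fun h => hji (Subtype.ext h)
      change c j * w j.1 i.1 = 0
      rw [hlt this, mul_zero]
  have key : ∀ i, ∀ x (hx : x ∈ F i), (⟨x, hx.1⟩ : N) ∈ Submodule.span R (Set.range b) := by
    intro i
    induction i using WellFoundedLT.induction with
    | ind i ih =>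
      -- an element supported strictly below `i` is handled by induction
      have low : ∀ x (hx : x ∈ F i), x i = 0 →
          (⟨x, hx.1⟩ : N) ∈ Submodule.span R (Set.range b) := by
        intro x hx hxi
        by_cases h0 : x = 0
        · subst h0; exact Submodule.zero_mem _
        obtain ⟨j, hj, hmax⟩ := x.support.exists_max_image id (Finsupp.support_nonempty_iff.2 h0)
        have hji : j < i := lt_of_le_of_ne ((Finsupp.mem_supported R _).1 hx.2 hj)
          fun h => Finsupp.mem_support_iff.1 hj (h ▸ hxi)
        exact ih j hji x ⟨hx.1, (Finsupp.mem_supported R _).2 fun l hl => hmax l hl⟩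
      intro x hx
      obtain ⟨r, hr⟩ := (Submodule.IsPrincipal.mem_iff_eq_smul_generator (I i)).1
        (Submodule.mem_map_of_mem hx : Finsupp.lapply i x ∈ I i)
      have hr : x i = r * a i := hr
      by_cases hai : a i = 0
      · exact low x hx (by rw [hr, hai, mul_zero])
      · have hy : x - r • w i ∈ F i := sub_mem hx (Submodule.smul_mem _ _ (hwF i))
        have h1 := low _ hy (by
          rw [Finsupp.sub_apply, Finsupp.smul_apply, hwa, hr, smul_eq_mul, sub_self])
        have h2 : (⟨x, hx.1⟩ : N) = ⟨x - r • w i, hy.1⟩ + r • b ⟨i, hai⟩ := by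
          apply Subtype.ext
          simp [b]
        rw [h2]
        exact add_mem h1 (Submodule.smul_mem _ _ (Submodule.subset_span ⟨_, rfl⟩))
  refine Module.Free.of_basis (Module.Basis.mk hli ?_)
  rintro ⟨x, hx⟩ -
  by_cases h0 : x = 0
  · subst h0; exact Submodule.zero_mem _
  obtain ⟨j, hj, hmax⟩ := x.support.exists_max_image id (Finsupp.support_nonempty_iff.2 h0)
  exact key j x ⟨hx, (Finsupp.mem_supported R _).2 fun l hl => hmax l hl⟩

/-- A submodule of a free module over a principal ideal domain is free, in any rank. -/
theorem Submodule.free_of_isPrincipalIdealRing {M : Type*} [AddCommGroup M] [Module R M]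
    [Module.Free R M] (N : Submodule R M) : Module.Free R N := by
  let e := Module.Free.chooseBasis R M |>.repr
  have := Submodule.free_of_finsupp (N.map e.toLinearMap)
  exact Module.Free.of_equiv (e.submoduleMap N).symm

end PID

/-! ### Homology classes in complexes of modules -/

namespace ChainComplex

variable {R : Type u} [CommRing R] (K : ChainComplex (ModuleCat.{u} R) ℕ)

/-- The differential `K_{k+1} → K_k` as a linear map. -/
abbrev bd (k : ℕ) : K.X (k + 1) →ₗ[R] K.X k := (K.d (k + 1) k).hom

/-- The cycles in degree `k`. The differential out of degree `0` is `K.d 0 0`, which is zero. -/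
def cyc (k : ℕ) : Submodule R (K.X k) := LinearMap.ker (K.d k (k - 1)).hom

variable {K}

theorem bd_bd (k : ℕ) (x : K.X (k + 2)) : K.bd k (K.bd (k + 1) x) = 0 :=
  congrArg (fun f => f.hom x) (K.d_comp_d (k + 2) (k + 1) k)

theorem mem_cyc_succ {k : ℕ} {x : K.X (k + 1)} : x ∈ K.cyc (k + 1) ↔ K.bd k x = 0 := Iff.rfl

theorem mem_cyc_zero (x : K.X 0) : x ∈ K.cyc 0 := by
  change (K.d 0 0).hom x = 0
  rw [K.shape _ _ (by simp)]
  rfl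

theorem bd_mem_cyc (k : ℕ) (x : K.X (k + 1)) : K.bd k x ∈ K.cyc k := by
  cases k with
  | zero => exact mem_cyc_zero _
  | succ k => exact bd_bd _ _

theorem map_bd {L : ChainComplex (ModuleCat.{u} R) ℕ} (f : K ⟶ L) (k : ℕ) (x : K.X (k + 1)) :
    (f.f k).hom (K.bd k x) = L.bd k ((f.f (k + 1)).hom x) :=
  (congrArg (fun f => f.hom x) (f.comm (k + 1) k)).symm

theorem map_mem_cyc {L : ChainComplex (ModuleCat.{u} R) ℕ} (f : K ⟶ L) {k : ℕ} {x : K.X k}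
    (hx : x ∈ K.cyc k) : (f.f k).hom x ∈ L.cyc k := by
  cases k with
  | zero => exact mem_cyc_zero _
  | succ k =>
    rw [mem_cyc_succ] at *
    rw [← map_bd, hx, map_zero]

/-- The map induced on cycles. -/
def cycMap {L : ChainComplex (ModuleCat.{u} R) ℕ} (f : K ⟶ L) (k : ℕ) :
    K.cyc k →ₗ[R] L.cyc k :=
  (f.f k).hom.restrict fun _ => map_mem_cyc f

variable (K)

/-- The homology class of a cycle. -/
def cls (k : ℕ) : K.cyc k →ₗ[R] K.homology k :=
  (K.liftCycles (ModuleCat.ofHom (K.cyc k).subtype) (k - 1) (by cases k <;> simp)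
    (by ext x; exact x.2) ≫ K.homologyπ k).hom

theorem liftCycles_bijective (k : ℕ) : Function.Bijective
    (K.liftCycles (ModuleCat.ofHom (K.cyc k).subtype) (k - 1) (by cases k <;> simp)
      (by ext x; exact x.2)).hom := by
  have hi : ∀ x, (K.iCycles k).hom ((K.liftCycles (ModuleCat.ofHom (K.cyc k).subtype) (k - 1)
      (by cases k <;> simp) (by ext x; exact x.2)).hom x) = x.1 := fun x => by
    rw [← ModuleCat.comp_apply, K.liftCycles_i]; rfl
  have hinj : Function.Injective (K.iCycles k).hom :=
    (ModuleCat.mono_iff_injective _).1 inferInstance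
  constructor
  · intro x y h
    apply Subtype.ext
    rw [← hi x, ← hi y, h]
  · intro y
    refine ⟨⟨(K.iCycles k).hom y, ?_⟩, hinj (hi _)⟩
    exact congrArg (fun f => f.hom y) (K.iCycles_d k (k - 1))

theorem cls_surjective (k : ℕ) : Function.Surjective (K.cls k) :=
  ((ModuleCat.epi_iff_surjective (K.homologyπ k)).1 inferInstance).comp
    (K.liftCycles_bijective k).2

variable {K}

theorem cls_eq_zero {k : ℕ} {z : K.cyc k} : K.cls k z = 0 ↔ ∃ w, K.bd k w = z.1 := by
  have hexact : (ShortComplex.mk (K.toCycles (k + 1) k) (K.homologyπ k)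
      (K.toCycles_comp_homologyπ _ _)).Exact :=
    ShortComplex.exact_of_g_is_cokernel _ (K.homologyIsCokernel (k + 1) k (by simp))
  have hinj : Function.Injective (K.iCycles k).hom :=
    (ModuleCat.mono_iff_injective _).1 inferInstance
  rw [ShortComplex.moduleCat_exact_iff] at hexact
  set l := K.liftCycles (ModuleCat.ofHom (K.cyc k).subtype) (k - 1) (by cases k <;> simp)
      (by ext x; exact x.2) with hl
  have hi : (K.iCycles k).hom (l.hom z) = z.1 := by
    rw [← ModuleCat.comp_apply, K.liftCycles_i]; rfl
  have ht : ∀ w, (K.iCycles k).hom ((K.toCycles (k + 1) k).hom w) = K.bd k w := fun w => by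
    rw [← ModuleCat.comp_apply, K.toCycles_i]
  constructor
  · intro h
    obtain ⟨w, hw⟩ := hexact (l.hom z) h
    exact ⟨w, by rw [← ht, ← hi]; exact congrArg _ hw⟩
  · rintro ⟨w, hw⟩
    have : l.hom z = (K.toCycles (k + 1) k).hom w := hinj (by rw [hi, ht, hw])
    change (K.homologyπ k).hom (l.hom z) = 0
    rw [this, ← ModuleCat.comp_apply, K.toCycles_comp_homologyπ]
    rfl

theorem cls_eq_cls {k : ℕ} {z z' : K.cyc k} :
    K.cls k z = K.cls k z' ↔ ∃ w, K.bd k w = z.1 - z'.1 := by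
  rw [← sub_eq_zero, ← map_sub, cls_eq_zero]; rfl

theorem homologyMap_cls {L : ChainComplex (ModuleCat.{u} R) ℕ} (f : K ⟶ L) (k : ℕ)
    (z : K.cyc k) :
    (HomologicalComplex.homologyMap f k).hom (K.cls k z) = L.cls k (cycMap f k z) := by
  have hinj : Function.Injective (L.iCycles k).hom :=
    (ModuleCat.mono_iff_injective _).1 inferInstance
  simp only [cls, ModuleCat.hom_comp, LinearMap.comp_apply]
  rw [← ModuleCat.comp_apply, HomologicalComplex.homologyπ_naturality, ModuleCat.comp_apply]
  congr 1
  rw [← ModuleCat.comp_apply, HomologicalComplex.liftCycles_comp_cyclesMap]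
  apply hinj
  rw [← ModuleCat.comp_apply, HomologicalComplex.liftCycles_i, ← ModuleCat.comp_apply,
    HomologicalComplex.liftCycles_i]
  rfl

/-- A linear map on cycles that vanishes on boundaries descends to homology. -/
def clsLift {k : ℕ} {N : Type*} [AddCommGroup N] [Module R N] (φ : K.cyc k →ₗ[R] N)
    (h : ∀ w, φ ⟨K.bd k w, bd_mem_cyc k w⟩ = 0) : K.homology k →ₗ[R] N :=
  (LinearMap.ker (K.cls k)).liftQ φ (fun z hz => by
    obtain ⟨w, hw⟩ := cls_eq_zero.1 hz
    have : z = ⟨K.bd k w, bd_mem_cyc k w⟩ := Subtype.ext hw.symm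
    rw [LinearMap.mem_ker, this, h]) ∘ₗ
  ((K.cls k).quotKerEquivOfSurjective (K.cls_surjective k)).symm.toLinearMap

@[simp]
theorem clsLift_cls {k : ℕ} {N : Type*} [AddCommGroup N] [Module R N] (φ : K.cyc k →ₗ[R] N)
    (h : ∀ w, φ ⟨K.bd k w, bd_mem_cyc k w⟩ = 0) (z : K.cyc k) :
    clsLift φ h (K.cls k z) = φ z := by
  have : ((K.cls k).quotKerEquivOfSurjective (K.cls_surjective k)).symm (K.cls k z) =
      (LinearMap.ker (K.cls k)).mkQ z := by
    rw [LinearEquiv.symm_apply_eq]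
    rfl
  rw [clsLift, LinearMap.comp_apply, LinearEquiv.coe_coe, this]
  exact Submodule.liftQ_apply _ _ _

end ChainComplex

/-! ### The tensor product of two complexes -/

namespace ChainComplex

open TensorProduct DirGraph

variable {R : Type u} [CommRing R]

instance (k : ℕ) : Fintype (TensorIndex k) := Fintype.ofFinite _

instance (k : ℕ) : Fintype (TorIndex k) := Fintype.ofFinite _

variable (K L : ChainComplex (ModuleCat.{u} R) ℕ)

/-- The degree `k` part of the tensor product of two complexes: families of elements of
`K_i ⊗ L_j` indexed by the pairs `(i, j)` with `i + j = k`. -/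
abbrev TensorX (k : ℕ) : Type u := ∀ p : TensorIndex k, K.X p.1.1 ⊗[R] L.X p.1.2

/-- The differential of the tensor product. Its component at `(i, j)` is
`(d ⊗ 1) t_{i+1,j} + (-1)^i (1 ⊗ d) t_{i,j+1}`. -/
def tensorD (k : ℕ) : TensorX K L (k + 1) →ₗ[R] TensorX K L k :=
  LinearMap.pi fun p =>
    (K.bd p.1.1).rTensor (L.X p.1.2) ∘ₗ
        LinearMap.proj (⟨(p.1.1 + 1, p.1.2), by have := p.2; omega⟩ : TensorIndex (k + 1)) +
      (-1 : R) ^ p.1.1 • (L.bd p.1.2).lTensor (K.X p.1.1) ∘ₗ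
        LinearMap.proj (⟨(p.1.1, p.1.2 + 1), by have := p.2; omega⟩ : TensorIndex (k + 1))

variable {K L}

theorem tensorD_apply {k : ℕ} (t : TensorX K L (k + 1)) (i j : ℕ) (h : i + j = k) :
    tensorD K L k t ⟨(i, j), h⟩ =
      (K.bd i).rTensor (L.X j) (t ⟨(i + 1, j), by omega⟩) +
        (-1 : R) ^ i • (L.bd j).lTensor (K.X i) (t ⟨(i, j + 1), by omega⟩) := rfl

theorem bd_comp_bd (k : ℕ) : K.bd k ∘ₗ K.bd (k + 1) = 0 := LinearMap.ext fun x => bd_bd k x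

theorem tensorD_tensorD (k : ℕ) (t : TensorX K L (k + 2)) :
    tensorD K L k (tensorD K L (k + 1) t) = 0 := by
  funext ⟨⟨i, j⟩, h⟩
  rw [tensorD_apply, tensorD_apply, tensorD_apply]
  simp only [map_add, map_smul, smul_add, smul_smul]
  rw [← LinearMap.rTensor_comp_apply, ← LinearMap.lTensor_comp_apply, bd_comp_bd, bd_comp_bd,
    LinearMap.rTensor_zero, LinearMap.lTensor_zero, LinearMap.zero_apply, LinearMap.zero_apply,
    zero_add, smul_zero, add_zero, pow_succ, mul_neg_one, neg_smul]
  rw [← LinearMap.comp_apply, LinearMap.rTensor_comp_lTensor, ← LinearMap.comp_apply (f := _),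
    LinearMap.lTensor_comp_rTensor, neg_add_cancel]
  rfl

variable (K L) in
/-- The tensor product of two complexes of modules. -/
def tensor : ChainComplex (ModuleCat.{u} R) ℕ :=
  ChainComplex.of (fun k => ModuleCat.of R (TensorX K L k))
    (fun k => ModuleCat.ofHom (tensorD K L k))
    (fun k => by
      rw [← ModuleCat.ofHom_comp]
      exact congrArg ModuleCat.ofHom (LinearMap.ext fun t => tensorD_tensorD k t))

theorem tensor_bd (k : ℕ) : (tensor K L).bd k = tensorD K L k :=
  congrArg ModuleCat.Hom.hom (ChainComplex.of_d (fun k => ModuleCat.of R (TensorX K L k))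
    (fun k => ModuleCat.ofHom (tensorD K L k)) k)

/-- The component of an element of the tensor product at a pair of degrees. -/
def coord {k : ℕ} (p : TensorIndex k) : (tensor K L).X k →ₗ[R] K.X p.1.1 ⊗[R] L.X p.1.2 :=
  LinearMap.proj (R := R) (φ := fun p : TensorIndex k => K.X p.1.1 ⊗[R] L.X p.1.2) p

/-- The inclusion of one summand of the tensor product. -/
def incl {k : ℕ} (p : TensorIndex k) : K.X p.1.1 ⊗[R] L.X p.1.2 →ₗ[R] (tensor K L).X k :=
  LinearMap.single R (fun p : TensorIndex k => K.X p.1.1 ⊗[R] L.X p.1.2) p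

/-- The element of the tensor product with given components. -/
def ofCoord {k : ℕ} (t : ∀ p : TensorIndex k, K.X p.1.1 ⊗[R] L.X p.1.2) : (tensor K L).X k := t

@[simp]
theorem coord_ofCoord {k : ℕ} (t : ∀ p : TensorIndex k, K.X p.1.1 ⊗[R] L.X p.1.2)
    (p : TensorIndex k) : coord p (ofCoord t) = t p := rfl

theorem tensor_ext {k : ℕ} {s t : (tensor K L).X k} (h : ∀ p, coord p s = coord p t) : s = t :=
  funext h

theorem coord_incl_same {k : ℕ} (p : TensorIndex k) (t : K.X p.1.1 ⊗[R] L.X p.1.2) :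
    coord p (incl p t) = t := Pi.single_eq_same _ _

theorem coord_incl_ne {k : ℕ} {p q : TensorIndex k} (h : q ≠ p) (t : K.X p.1.1 ⊗[R] L.X p.1.2) :
    coord q (incl p t) = 0 := Pi.single_eq_of_ne h _

theorem sum_incl_coord {k : ℕ} (t : (tensor K L).X k) : ∑ p, incl p (coord p t) = t := by
  refine tensor_ext fun q => ?_
  rw [map_sum, Finset.sum_eq_single q (fun p _ h => coord_incl_ne h.symm _)
    (fun h => absurd (Finset.mem_univ q) h), coord_incl_same]

theorem coord_bd {k : ℕ} (t : (tensor K L).X (k + 1)) (i j : ℕ) (h : i + j = k) :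
    coord ⟨(i, j), h⟩ ((tensor K L).bd k t) =
      (K.bd i).rTensor (L.X j) (coord ⟨(i + 1, j), by omega⟩ t) +
        (-1 : R) ^ i • (L.bd j).lTensor (K.X i) (coord ⟨(i, j + 1), by omega⟩ t) := by
  rw [tensor_bd]
  rfl

variable {K' L' : ChainComplex (ModuleCat.{u} R) ℕ}

theorem map_comp_bd (f : K ⟶ K') (k : ℕ) :
    (f.f k).hom ∘ₗ K.bd k = K'.bd k ∘ₗ (f.f (k + 1)).hom := LinearMap.ext fun x => map_bd f k x

theorem map_rTensor_bd (f : K ⟶ K') (g : L ⟶ L') (i j : ℕ) (t : K.X (i + 1) ⊗[R] L.X j) :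
    TensorProduct.map (f.f i).hom (g.f j).hom ((K.bd i).rTensor _ t) =
      (K'.bd i).rTensor _ (TensorProduct.map (f.f (i + 1)).hom (g.f j).hom t) := by
  rw [LinearMap.rTensor, LinearMap.rTensor, ← LinearMap.comp_apply, ← LinearMap.comp_apply,
    ← TensorProduct.map_comp, ← TensorProduct.map_comp, map_comp_bd, LinearMap.comp_id,
    LinearMap.id_comp]

theorem map_lTensor_bd (f : K ⟶ K') (g : L ⟶ L') (i j : ℕ) (t : K.X i ⊗[R] L.X (j + 1)) :
    TensorProduct.map (f.f i).hom (g.f j).hom ((L.bd j).lTensor _ t) =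
      (L'.bd j).lTensor _ (TensorProduct.map (f.f i).hom (g.f (j + 1)).hom t) := by
  rw [LinearMap.lTensor, LinearMap.lTensor, ← LinearMap.comp_apply, ← LinearMap.comp_apply,
    ← TensorProduct.map_comp, ← TensorProduct.map_comp, map_comp_bd, LinearMap.comp_id,
    LinearMap.id_comp]

/-- The map of tensor products induced by two chain maps. -/
def tensorMap (f : K ⟶ K') (g : L ⟶ L') : tensor K L ⟶ tensor K' L' :=
  ChainComplex.ofHom
    (fun k => ModuleCat.ofHom (LinearMap.pi fun p : TensorIndex k =>
      TensorProduct.map (f.f p.1.1).hom (g.f p.1.2).hom ∘ₗ coord p))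
    (fun k => by
      ext t
      refine tensor_ext fun ⟨⟨i, j⟩, h⟩ => ?_
      refine (coord_bd _ i j h).trans ?_
      change _ = TensorProduct.map _ _ (coord ⟨(i, j), h⟩ ((tensor K L).bd k t))
      rw [coord_bd, map_add, map_smul, map_rTensor_bd, map_lTensor_bd]
      rfl)

theorem coord_tensorMap (f : K ⟶ K') (g : L ⟶ L') {k : ℕ} (t : (tensor K L).X k)
    (p : TensorIndex k) : coord p (((tensorMap f g).f k).hom t) =
      TensorProduct.map (f.f p.1.1).hom (g.f p.1.2).hom (coord p t) := rfl

theorem tensorMap_incl (f : K ⟶ K') (g : L ⟶ L') {k : ℕ} (p : TensorIndex k)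
    (t : K.X p.1.1 ⊗[R] L.X p.1.2) : ((tensorMap f g).f k).hom (incl p t) =
      incl p (TensorProduct.map (f.f p.1.1).hom (g.f p.1.2).hom t) := by
  refine tensor_ext fun q => ?_
  rw [coord_tensorMap]
  by_cases h : q = p
  · subst h
    rw [coord_incl_same, coord_incl_same]
  · rw [coord_incl_ne h, coord_incl_ne h, map_zero]

/-! ### The cross product -/

theorem bd_incl_left {i j k : ℕ} (h : i + j = k) (x : K.X (i + 1)) {w : L.X j}
    (hw : w ∈ L.cyc j) :
    (tensor K L).bd k (incl ⟨(i + 1, j), by omega⟩ (x ⊗ₜ[R] w)) =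
      incl ⟨(i, j), h⟩ (K.bd i x ⊗ₜ[R] w) := by
  refine tensor_ext fun ⟨⟨a, b⟩, hab⟩ => ?_
  rw [coord_bd]
  by_cases h1 : a = i
  · subst h1
    obtain rfl : b = j := by omega
    rw [coord_incl_same, coord_incl_same, coord_incl_ne (by simp), map_zero, smul_zero, add_zero]
    rfl
  · rw [coord_incl_ne (q := ⟨(a, b), hab⟩) (by simp [h1]),
      coord_incl_ne (q := ⟨(a + 1, b), _⟩) (by simp [h1]), map_zero, zero_add]
    by_cases h2 : a = i + 1
    · subst h2
      obtain rfl : j = b + 1 := by omega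
      rw [coord_incl_same]
      change (-1 : R) ^ (i + 1) • (x ⊗ₜ[R] L.bd b w) = 0
      rw [mem_cyc_succ.1 hw, tmul_zero, smul_zero]
    · rw [coord_incl_ne (by simp [h2]), map_zero, smul_zero]

theorem bd_incl_right {i j k : ℕ} (h : i + j = k) {z : K.X i} (hz : z ∈ K.cyc i)
    (y : L.X (j + 1)) :
    (tensor K L).bd k (incl ⟨(i, j + 1), by omega⟩ (z ⊗ₜ[R] y)) =
      (-1 : R) ^ i • incl ⟨(i, j), h⟩ (z ⊗ₜ[R] L.bd j y) := by
  refine tensor_ext fun ⟨⟨a, b⟩, hab⟩ => ?_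
  rw [coord_bd, map_smul]
  by_cases h1 : a = i
  · subst h1
    obtain rfl : b = j := by omega
    rw [coord_incl_same, coord_incl_same, coord_incl_ne (by simp), map_zero, zero_add]
    rfl
  · rw [coord_incl_ne (q := ⟨(a, b), hab⟩) (by simp [h1]),
      coord_incl_ne (q := ⟨(a, b + 1), _⟩) (by simp [h1]), map_zero, smul_zero, smul_zero,
      add_zero]
    by_cases h2 : i = a + 1
    · subst h2
      obtain rfl : b = j + 1 := by omega
      rw [coord_incl_same]
      change K.bd a z ⊗ₜ[R] y = 0
      rw [mem_cyc_succ.1 hz, zero_tmul]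
    · rw [coord_incl_ne (by simp; omega), map_zero]

theorem incl_mem_cyc {k : ℕ} (p : TensorIndex k) {z : K.X p.1.1} (hz : z ∈ K.cyc p.1.1)
    {w : L.X p.1.2} (hw : w ∈ L.cyc p.1.2) : incl p (z ⊗ₜ[R] w) ∈ (tensor K L).cyc k := by
  obtain ⟨⟨i, j⟩, h⟩ := p
  cases k with
  | zero => exact mem_cyc_zero _
  | succ k =>
    rw [mem_cyc_succ]
    cases i with
    | zero =>
      obtain rfl : j = k + 1 := by dsimp only at h; omega
      refine (bd_incl_right (zero_add k) hz w).trans ?_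
      rw [mem_cyc_succ.1 hw, tmul_zero, map_zero, smul_zero]
    | succ i =>
      have h' : i + j = k := by dsimp only at h; omega
      refine (bd_incl_left h' z hw).trans ?_
      rw [mem_cyc_succ.1 hz, zero_tmul, map_zero]

/-- The tensor product of two cycles is a cycle of the tensor product. -/
def cycTensor {k : ℕ} (p : TensorIndex k) :
    K.cyc p.1.1 ⊗[R] L.cyc p.1.2 →ₗ[R] (tensor K L).cyc k :=
  (incl p ∘ₗ TensorProduct.map (K.cyc p.1.1).subtype (L.cyc p.1.2).subtype).codRestrict _
    fun t => by
      induction t with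
      | zero => rw [map_zero]; exact zero_mem _
      | add a b ha hb => rw [map_add]; exact add_mem ha hb
      | tmul z w => exact incl_mem_cyc p z.2 w.2

theorem cls_cycTensor_left {k : ℕ} (p : TensorIndex k) (x : K.X (p.1.1 + 1)) (w : L.cyc p.1.2) :
    (tensor K L).cls k (cycTensor p (⟨K.bd _ x, bd_mem_cyc _ x⟩ ⊗ₜ w)) = 0 :=
  cls_eq_zero.2 ⟨_, bd_incl_left p.2 x w.2⟩

theorem cls_cycTensor_right {k : ℕ} (p : TensorIndex k) (z : K.cyc p.1.1) (y : L.X (p.1.2 + 1)) :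
    (tensor K L).cls k (cycTensor p (z ⊗ₜ ⟨L.bd _ y, bd_mem_cyc _ y⟩)) = 0 := by
  refine cls_eq_zero.2 ⟨(-1 : R) ^ p.1.1 • incl ⟨(p.1.1, p.1.2 + 1), by have := p.2; omega⟩
    (z.1 ⊗ₜ[R] y), ?_⟩
  rw [map_smul, bd_incl_right p.2 z.2 y, smul_smul, ← mul_pow]
  simp [cycTensor]

/-- The cross product with a fixed cycle of the first complex. -/
def crossLeft {k : ℕ} (p : TensorIndex k) (z : K.cyc p.1.1) :
    L.homology p.1.2 →ₗ[R] (tensor K L).homology k :=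
  clsLift ((tensor K L).cls k ∘ₗ cycTensor p ∘ₗ TensorProduct.mk R _ _ z)
    (fun y => cls_cycTensor_right p z y)

theorem crossLeft_cls {k : ℕ} (p : TensorIndex k) (z : K.cyc p.1.1) (w : L.cyc p.1.2) :
    crossLeft p z (L.cls _ w) = (tensor K L).cls k (cycTensor p (z ⊗ₜ w)) := clsLift_cls _ _ _

theorem homology_hom_ext {k : ℕ} {N : Type*} [AddCommGroup N] [Module R N]
    {f g : K.homology k →ₗ[R] N} (h : ∀ z, f (K.cls k z) = g (K.cls k z)) : f = g :=
  LinearMap.ext fun y => by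
    obtain ⟨w, rfl⟩ := cls_surjective _ _ y
    exact h w

/-- The cross product `H_i(K) ⊗ H_j(L) → H_k(K ⊗ L)`. -/
def cross {k : ℕ} (p : TensorIndex k) :
    K.homology p.1.1 ⊗[R] L.homology p.1.2 →ₗ[R] (tensor K L).homology k :=
  TensorProduct.lift (clsLift
    { toFun := crossLeft p
      map_add' := fun z z' => homology_hom_ext fun w => by
        rw [LinearMap.add_apply, crossLeft_cls, crossLeft_cls, crossLeft_cls, add_tmul, map_add,
          map_add]
      map_smul' := fun r z => homology_hom_ext fun w => by
        rw [LinearMap.smul_apply, crossLeft_cls, crossLeft_cls, ← smul_tmul', map_smul, map_smul,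
          RingHom.id_apply] }
    (fun x => homology_hom_ext fun w =>
      (crossLeft_cls _ _ _).trans (cls_cycTensor_left p x w)))

theorem cross_cls {k : ℕ} (p : TensorIndex k) (t : K.cyc p.1.1 ⊗[R] L.cyc p.1.2) :
    cross p (TensorProduct.map (K.cls p.1.1) (L.cls p.1.2) t) =
      (tensor K L).cls k (cycTensor p t) := by
  induction t with
  | zero => rw [map_zero, map_zero, map_zero, map_zero]
  | add a b ha hb => simp only [map_add, ha, hb]
  | tmul z w =>
    rw [cross, TensorProduct.map_tmul, TensorProduct.lift.tmul, clsLift_cls]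
    exact crossLeft_cls p z w

theorem map_cls_surjective (i j : ℕ) :
    Function.Surjective (TensorProduct.map (K.cls i) (L.cls j)) :=
  TensorProduct.map_surjective (K.cls_surjective i) (L.cls_surjective j)

theorem cross_naturality (f : K ⟶ K') (g : L ⟶ L') {k : ℕ} (p : TensorIndex k)
    (t : K.homology p.1.1 ⊗[R] L.homology p.1.2) :
    (HomologicalComplex.homologyMap (tensorMap f g) k).hom (cross p t) =
      cross p (TensorProduct.map (HomologicalComplex.homologyMap f p.1.1).hom
        (HomologicalComplex.homologyMap g p.1.2).hom t) := by
  obtain ⟨t, rfl⟩ := map_cls_surjective _ _ t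
  induction t with
  | zero => simp
  | add a b ha hb => simp only [map_add, ha, hb]
  | tmul z w =>
    have h1 : TensorProduct.map (HomologicalComplex.homologyMap f p.1.1).hom
        (HomologicalComplex.homologyMap g p.1.2).hom
        (TensorProduct.map (K.cls p.1.1) (L.cls p.1.2) (z ⊗ₜ w)) =
        TensorProduct.map (K'.cls p.1.1) (L'.cls p.1.2)
          (cycMap f _ z ⊗ₜ cycMap g _ w) := by
      simp only [TensorProduct.map_tmul, homologyMap_cls]
    rw [h1, cross_cls, cross_cls, homologyMap_cls]
    congr 1
    exact Subtype.ext (tensorMap_incl f g p _)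

end ChainComplex

namespace ChainComplex

open TensorProduct DirGraph

variable {R : Type u} [CommRing R]
variable {K L K' L' : ChainComplex (ModuleCat.{u} R) ℕ}

/-! ### The map to the torsion term -/

/-- The boundaries in degree `k`. -/
abbrev bdr (K : ChainComplex (ModuleCat.{u} R) ℕ) (k : ℕ) : Submodule R (K.X k) :=
  LinearMap.range (K.bd k)

theorem bdr_le_cyc (k : ℕ) : K.bdr k ≤ K.cyc k := by
  rintro _ ⟨x, rfl⟩
  exact bd_mem_cyc k x

/-- The inclusion of boundaries into cycles. -/
abbrev bdrToCyc (K : ChainComplex (ModuleCat.{u} R) ℕ) (k : ℕ) : K.bdr k →ₗ[R] K.cyc k :=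
  Submodule.inclusion (bdr_le_cyc k)

/-- The differential with values in the boundaries. -/
abbrev toBdr (K : ChainComplex (ModuleCat.{u} R) ℕ) (k : ℕ) : K.X (k + 1) →ₗ[R] K.bdr k :=
  (K.bd k).rangeRestrict

/-- The map induced on boundaries. -/
def bdrMap (f : K ⟶ K') (k : ℕ) : K.bdr k →ₗ[R] K'.bdr k :=
  (f.f k).hom.restrict fun _ hx => by
    obtain ⟨y, rfl⟩ := hx
    exact ⟨(f.f (k + 1)).hom y, (map_bd f k y).symm⟩

/-- The differential with values in the cycles. -/
abbrev toCyc (K : ChainComplex (ModuleCat.{u} R) ℕ) (k : ℕ) : K.X (k + 1) →ₗ[R] K.cyc k :=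
  (K.bd k).codRestrict _ (bd_mem_cyc k)

theorem toCyc_cls_exact (k : ℕ) : Function.Exact (K.toCyc k) (K.cls k) := fun z => by
  rw [cls_eq_zero]
  exact ⟨fun ⟨w, hw⟩ => ⟨w, Subtype.ext hw⟩, fun ⟨w, hw⟩ => ⟨w, congrArg Subtype.val hw⟩⟩

theorem cyc_exact (k : ℕ) :
    Function.Exact (K.cyc k).subtype (K.d k (k - 1)).hom :=
  LinearMap.exact_subtype_ker_map _

/-- The kernel of a linear map with projective range is a direct summand. -/
theorem exists_ker_retraction {M N : Type*} [AddCommGroup M] [Module R M] [AddCommGroup N]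
    [Module R N] (f : M →ₗ[R] N) [Module.Projective R (LinearMap.range f)] :
    ∃ r : M →ₗ[R] LinearMap.ker f, ∀ x, r x.1 = x := by
  obtain ⟨s, hs⟩ := Module.projective_lifting_property f.rangeRestrict LinearMap.id
    f.surjective_rangeRestrict
  have hs' : ∀ y, f (s y) = y := fun y => congrArg Subtype.val (LinearMap.congr_fun hs y)
  have hr : ∀ x : M, (LinearMap.id (R := R) (M := M) - s ∘ₗ f.rangeRestrict) x ∈
      LinearMap.ker f := fun x => by
    rw [LinearMap.mem_ker]
    simp [hs']
  refine ⟨(LinearMap.id - s ∘ₗ f.rangeRestrict).codRestrict _ hr, fun x => Subtype.ext ?_⟩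
  have : f.rangeRestrict x.1 = 0 := Subtype.ext x.2
  simp [this]

theorem toBdr_comp_bd (k : ℕ) : K.toBdr k ∘ₗ K.bd (k + 1) = 0 :=
  LinearMap.ext fun x => Subtype.ext (bd_bd k x)

/-- The components of a cycle of the tensor product: `(d ⊗ 1) z_{i+1,j}` is, up to sign, `(1 ⊗ d)
z_{i,j+1}`. -/
theorem coord_cyc_left {k i j : ℕ} (h : i + j = k) {z : (tensor K L).X (k + 1)}
    (hz : z ∈ (tensor K L).cyc (k + 1)) :
    (K.bd i).rTensor _ (coord ⟨(i + 1, j), by omega⟩ z) =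
      -(-1 : R) ^ i • (L.bd j).lTensor _ (coord ⟨(i, j + 1), by omega⟩ z) := by
  have := coord_bd z i j h
  rw [mem_cyc_succ.1 hz, map_zero] at this
  rw [neg_smul]
  exact eq_neg_of_add_eq_zero_left this.symm

section PID

variable [IsDomain R] [IsPrincipalIdealRing R]

/-- The index `(i, j + 1)` of the component that determines the torsion class at `(i, j)`. -/
abbrev TorIndex.up {k : ℕ} (p : TorIndex k) : TensorIndex k :=
  ⟨(p.1.1, p.1.2 + 1), by have := p.2; omega⟩

theorem bdr_flat [∀ i, Module.Free R (L.X i)] (k : ℕ) : Module.Flat R (L.bdr k) :=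
  have := Submodule.free_of_isPrincipalIdealRing (L.bdr k)
  inferInstance

theorem cyc_flat [∀ i, Module.Free R (L.X i)] (k : ℕ) : Module.Flat R (L.cyc k) :=
  have := Submodule.free_of_isPrincipalIdealRing (L.cyc k)
  inferInstance

/-- For a cycle `z` of the tensor product, `(1 ⊗ d) z` comes from cycles tensor boundaries. -/
theorem exists_lift_cyc [∀ i, Module.Free R (L.X i)] {k : ℕ} (p : TorIndex k)
    (z : (tensor K L).cyc k) :
    ∃ s : K.cyc p.1.1 ⊗[R] L.bdr p.1.2, (K.cyc p.1.1).subtype.rTensor _ s =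
      (L.toBdr p.1.2).lTensor _ (coord (TorIndex.up p) z.1) := by
  have := bdr_flat (L := L) p.1.2
  obtain ⟨⟨i, j⟩, h⟩ := p
  refine (Module.Flat.rTensor_exact (L.bdr j) (cyc_exact (K := K) i) _).1 ?_
  cases i with
  | zero =>
    change (K.d 0 0).hom.rTensor _ _ = 0
    rw [K.shape _ _ (by simp)]
    exact LinearMap.congr_fun (LinearMap.rTensor_zero _) _
  | succ i =>
    obtain ⟨k, rfl⟩ : ∃ l, k = l + 1 := ⟨k - 1, by dsimp only at h; omega⟩
    change (K.bd i).rTensor _ _ = 0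
    rw [← LinearMap.comp_apply, LinearMap.rTensor_comp_lTensor, ← LinearMap.lTensor_comp_rTensor,
      LinearMap.comp_apply]
    have := coord_cyc_left (i := i) (j := j + 1) (by dsimp only at h; omega) z.2
    dsimp only
    rw [this, map_smul, ← LinearMap.comp_apply, ← LinearMap.lTensor_comp, toBdr_comp_bd,
      LinearMap.lTensor_zero, LinearMap.zero_apply, smul_zero]

variable [∀ i, Module.Free R (K.X i)]

variable (K) in
theorem exists_extend_cls (k : ℕ) :
    ∃ ρ : K.X k →ₗ[R] K.homology k, ∀ z : K.cyc k, ρ z.1 = K.cls k z := by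
  have := Submodule.free_of_isPrincipalIdealRing (LinearMap.range (K.d k (k - 1)).hom)
  obtain ⟨r, hr⟩ := exists_ker_retraction (K.d k (k - 1)).hom
  exact ⟨K.cls k ∘ₗ r, fun z => congrArg (K.cls k) (hr z)⟩

variable (K) in
/-- An extension of `cls` to all chains. It exists because the cycles are a direct summand, and is
a chain map to the homology with zero differential. It is not natural. -/
def extCls (k : ℕ) : K.X k →ₗ[R] K.homology k := (exists_extend_cls K k).choose

theorem extCls_coe {k : ℕ} (z : K.cyc k) : K.extCls k z.1 = K.cls k z :=
  (exists_extend_cls K k).choose_spec z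

theorem extCls_bd (k : ℕ) (x : K.X (k + 1)) : K.extCls k (K.bd k x) = 0 :=
  (extCls_coe ⟨_, bd_mem_cyc k x⟩).trans (cls_eq_zero.2 ⟨x, rfl⟩)

theorem extCls_comp_bd (k : ℕ) : K.extCls k ∘ₗ K.bd k = 0 := LinearMap.ext (extCls_bd k)

theorem extCls_comp_subtype (k : ℕ) : K.extCls k ∘ₗ (K.cyc k).subtype = K.cls k :=
  LinearMap.ext extCls_coe

/-- The map `H_k(K ⊗ L) → H_i(K) ⊗ B_j(L)` for `i + j + 1 = k`, induced by the differential of the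
second complex. -/
def torMap {k : ℕ} (p : TorIndex k) :
    (tensor K L).homology k →ₗ[R] K.homology p.1.1 ⊗[R] L.bdr p.1.2 :=
  clsLift (TensorProduct.map (K.extCls p.1.1) (L.toBdr p.1.2) ∘ₗ coord (TorIndex.up p) ∘ₗ
      ((tensor K L).cyc k).subtype) fun w => by
    change TensorProduct.map (K.extCls p.1.1) (L.toBdr p.1.2)
      (coord (TorIndex.up p) ((tensor K L).bd k w)) = 0
    rw [coord_bd, map_add, map_smul, LinearMap.rTensor, LinearMap.lTensor,
      TensorProduct.map_map, TensorProduct.map_map, extCls_comp_bd, toBdr_comp_bd,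
      TensorProduct.map_zero_left, TensorProduct.map_zero_right]
    simp

theorem torMap_cls {k : ℕ} (p : TorIndex k) (z : (tensor K L).cyc k) :
    torMap p ((tensor K L).cls k z) =
      TensorProduct.map (K.extCls p.1.1) (L.toBdr p.1.2) (coord (TorIndex.up p) z.1) :=
  clsLift_cls _ _ _

/-- `torMap` computed without the choices in `extCls`, by applying `cls` to a lift of `(1 ⊗ d) z`
to cycles tensor boundaries. This is why `torMap` is natural although `extCls` is not. -/
theorem torMap_cls_of_lift {k : ℕ} (p : TorIndex k) (z : (tensor K L).cyc k)
    (s : K.cyc p.1.1 ⊗[R] L.bdr p.1.2) (hs : (K.cyc p.1.1).subtype.rTensor _ s =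
      (L.toBdr p.1.2).lTensor _ (coord (TorIndex.up p) z.1)) :
    torMap p ((tensor K L).cls k z) = (K.cls p.1.1).rTensor _ s := by
  rw [torMap_cls, ← LinearMap.rTensor_comp_lTensor, LinearMap.comp_apply, ← hs,
    ← LinearMap.comp_apply, ← LinearMap.rTensor_comp, extCls_comp_subtype]

theorem torMap_naturality [∀ i, Module.Free R (L.X i)] [∀ i, Module.Free R (K'.X i)]
    [∀ i, Module.Free R (L'.X i)] (f : K ⟶ K') (g : L ⟶ L') {k : ℕ} (p : TorIndex k)
    (h : (tensor K L).homology k) :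
    torMap p ((HomologicalComplex.homologyMap (tensorMap f g) k).hom h) =
      TensorProduct.map (HomologicalComplex.homologyMap f p.1.1).hom (bdrMap g p.1.2)
        (torMap p h) := by
  obtain ⟨z, rfl⟩ := cls_surjective _ _ h
  obtain ⟨s, hs⟩ := exists_lift_cyc p z
  rw [homologyMap_cls, torMap_cls_of_lift p z s hs,
    torMap_cls_of_lift p _ (TensorProduct.map (cycMap f _) (bdrMap g _) s)]
  · rw [LinearMap.rTensor, LinearMap.rTensor, TensorProduct.map_map, TensorProduct.map_map]
    congr 2
    exact LinearMap.ext fun z => (homologyMap_cls f _ z).symm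
  · change _ = (L'.toBdr p.1.2).lTensor _ (coord (TorIndex.up p)
      (((tensorMap f g).f k).hom z.1))
    have h1 : L'.toBdr p.1.2 ∘ₗ (g.f (p.1.2 + 1)).hom = bdrMap g p.1.2 ∘ₗ L.toBdr p.1.2 :=
      LinearMap.ext fun x => Subtype.ext (map_bd g _ x).symm
    have h2 : (L'.toBdr p.1.2).lTensor _ (TensorProduct.map (f.f p.1.1).hom (g.f (p.1.2 + 1)).hom
        (coord (TorIndex.up p) z.1)) = TensorProduct.map (f.f p.1.1).hom (bdrMap g p.1.2)
          ((L.toBdr p.1.2).lTensor _ (coord (TorIndex.up p) z.1)) := by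
      rw [LinearMap.lTensor, LinearMap.lTensor, TensorProduct.map_map, TensorProduct.map_map, h1]
      rfl
    rw [coord_tensorMap, h2, ← hs, LinearMap.rTensor, LinearMap.rTensor, TensorProduct.map_map,
      TensorProduct.map_map]
    rfl

/-! ### Exactness and splitting -/

/-- An element killed by both differentials is a sum of tensor products of cycles. -/
theorem exists_map_cyc_subtype_eq [∀ i, Module.Free R (L.X i)] {i j : ℕ}
    (t : K.X i ⊗[R] L.X j)
    (h1 : (K.d i (i - 1)).hom.rTensor _ t = 0) (h2 : (L.d j (j - 1)).hom.lTensor _ t = 0) :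
    ∃ s, TensorProduct.map (K.cyc i).subtype (L.cyc j).subtype s = t := by
  have hf := cyc_flat (L := L) j
  obtain ⟨t', rfl⟩ := (Module.Flat.lTensor_exact (K.X i) (cyc_exact (K := L) j) t).1 h2
  have h3 : (K.d i (i - 1)).hom.rTensor _ t' = 0 := by
    apply Module.Flat.lTensor_preserves_injective_linearMap (M := K.X (i - 1)) (L.cyc j).subtype
      (Submodule.injective_subtype _)
    rw [map_zero, ← LinearMap.comp_apply, LinearMap.lTensor_comp_rTensor,
      ← LinearMap.rTensor_comp_lTensor, LinearMap.comp_apply, h1]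
  obtain ⟨s, rfl⟩ := (Module.Flat.rTensor_exact (L.cyc j) (cyc_exact (K := K) i) t').1 h3
  exact ⟨s, by rw [← LinearMap.comp_apply, LinearMap.lTensor_comp_rTensor]⟩

theorem torMap_cross {k : ℕ} (p : TorIndex k) (q : TensorIndex k)
    (x : K.homology q.1.1 ⊗[R] L.homology q.1.2) : torMap p (cross q x) = 0 := by
  obtain ⟨t, rfl⟩ := map_cls_surjective _ _ x
  rw [cross_cls, torMap_cls]
  change TensorProduct.map (K.extCls p.1.1) (L.toBdr p.1.2) (coord (TorIndex.up p) (incl q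
    (TensorProduct.map (K.cyc q.1.1).subtype (L.cyc q.1.2).subtype t))) = 0
  by_cases h : TorIndex.up p = q
  · subst h
    have : L.toBdr p.1.2 ∘ₗ (L.cyc (p.1.2 + 1)).subtype = 0 :=
      LinearMap.ext fun w => Subtype.ext (mem_cyc_succ.1 w.2)
    rw [coord_incl_same, TensorProduct.map_map, this, TensorProduct.map_zero_right,
      LinearMap.zero_apply]
  · rw [coord_incl_ne h, map_zero]

/-- Modify a cycle on which all the maps `torMap` vanish by a boundary, so that it becomes a sum of
tensor products of cycles. -/
theorem exists_cross_of_torMap_eq_zero [∀ i, Module.Free R (L.X i)] {k : ℕ}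
    (y : (tensor K L).homology k)
    (hy : ∀ p : TorIndex k, torMap p y = 0) :
    ∃ x : ∀ q : TensorIndex k, K.homology q.1.1 ⊗[R] L.homology q.1.2,
      ∑ q, cross q (x q) = y := by
  obtain ⟨z, rfl⟩ := cls_surjective _ _ y
  have key : ∀ p : TorIndex k, ∃ v : K.X (p.1.1 + 1) ⊗[R] L.X (p.1.2 + 1),
      (L.toBdr p.1.2).lTensor _ ((K.bd p.1.1).rTensor _ v) =
        (L.toBdr p.1.2).lTensor _ (coord (TorIndex.up p) z.1) := fun p => by
    obtain ⟨s, hs⟩ := exists_lift_cyc p z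
    have h0 : (K.cls p.1.1).rTensor _ s = 0 := (torMap_cls_of_lift p z s hs).symm.trans (hy p)
    obtain ⟨u, rfl⟩ := (rTensor_exact (L.bdr p.1.2) (toCyc_cls_exact p.1.1)
      (K.cls_surjective _) s).1 h0
    obtain ⟨v, rfl⟩ := LinearMap.lTensor_surjective (K.X (p.1.1 + 1))
      (L.bd p.1.2).surjective_rangeRestrict u
    refine ⟨v, ?_⟩
    rw [← hs]
    simp only [LinearMap.rTensor, LinearMap.lTensor, TensorProduct.map_map]
    rfl
  choose v hv using key
  -- assemble the elements `v` into a chain of degree `k + 1`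
  let u : (tensor K L).X (k + 1) := ofCoord fun q => match q with
    | ⟨(0, _), _⟩ => 0
    | ⟨(_ + 1, 0), _⟩ => 0
    | ⟨(i + 1, j + 1), h⟩ => v ⟨(i, j), by dsimp only at h ⊢; omega⟩
  have hcyc := sub_mem z.2 (bd_mem_cyc k u)
  set z' := z.1 - (tensor K L).bd k u with hz'
  have hR : ∀ (j i : ℕ) (h : i + j = k), (L.d j (j - 1)).hom.lTensor _
      (coord ⟨(i, j), h⟩ z') = 0 := by
    intro j i h
    cases j with
    | zero =>
      rw [L.shape _ _ (by simp)]
      exact LinearMap.congr_fun (LinearMap.lTensor_zero _) _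
    | succ j =>
      have hB : (L.toBdr j).lTensor _ (coord ⟨(i, j + 1), h⟩ z') = 0 := by
        have h3 : coord ⟨(i + 1, j + 1), by omega⟩ u = v ⟨(i, j), h⟩ := rfl
        rw [hz', map_sub, coord_bd, map_sub, map_add, map_smul, h3, hv ⟨(i, j), h⟩,
          ← LinearMap.comp_apply (LinearMap.lTensor _ _) (LinearMap.lTensor _ _),
          ← LinearMap.lTensor_comp, toBdr_comp_bd, LinearMap.lTensor_zero]
        simp
      have h4 : (L.d (j + 1) (j + 1 - 1)).hom = (L.bdr j).subtype ∘ₗ L.toBdr j := rfl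
      rw [h4, LinearMap.lTensor_comp, LinearMap.comp_apply, hB, map_zero]
  have hL : ∀ (i j : ℕ) (h : i + j = k), (K.d i (i - 1)).hom.rTensor _
      (coord ⟨(i, j), h⟩ z') = 0 := by
    intro i j h
    cases i with
    | zero =>
      rw [K.shape _ _ (by simp)]
      exact LinearMap.congr_fun (LinearMap.rTensor_zero _) _
    | succ i =>
      obtain ⟨k, rfl⟩ : ∃ l, k = l + 1 := ⟨k - 1, by omega⟩
      refine (coord_cyc_left (by omega) hcyc).trans ?_
      have := hR (j + 1) i (by omega)
      rw [Nat.add_sub_cancel] at this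
      rw [this, smul_zero]
  choose s hs using fun q : TensorIndex k =>
    exists_map_cyc_subtype_eq (coord q z') (hL _ _ q.2) (hR _ _ q.2)
  refine ⟨fun q => TensorProduct.map (K.cls q.1.1) (L.cls q.1.2) (s q), ?_⟩
  simp only [cross_cls]
  rw [← map_sum, eq_comm, cls_eq_cls]
  refine ⟨u, ?_⟩
  have : ((∑ q, cycTensor q (s q) : (tensor K L).cyc k) : (tensor K L).X k) = z' := by
    rw [AddSubmonoidClass.coe_finsetSum, ← sum_incl_coord z']
    exact Finset.sum_congr rfl fun q _ => congrArg (incl q) (hs q)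
  rw [this, hz', sub_sub_cancel]

/-- A family of elements of the kernels of `H_i(K) ⊗ B_j(L) → H_i(K) ⊗ Z_j(L)` comes from the
homology of the tensor product. -/
theorem exists_torMap_eq {k : ℕ} (y : ∀ p : TorIndex k, K.homology p.1.1 ⊗[R] L.bdr p.1.2)
    (hy : ∀ p, (L.bdrToCyc p.1.2).lTensor _ (y p) = 0) :
    ∃ h : (tensor K L).homology k, ∀ p, torMap p h = y p := by
  classical
  suffices key : ∀ p, ∃ h : (tensor K L).homology k, torMap p h = y p ∧
      ∀ q ≠ p, torMap q h = 0 by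
    choose h h1 h2 using key
    refine ⟨∑ p, h p, fun q => ?_⟩
    rw [map_sum, Finset.sum_eq_single q (fun p _ hpq => h2 p q hpq.symm)
      (fun hq => absurd (Finset.mem_univ q) hq), h1]
  rintro ⟨⟨i, j⟩, hij⟩
  obtain ⟨k, rfl⟩ : ∃ l, k = l + 1 := ⟨k - 1, by dsimp only at hij; omega⟩
  have hij' : i + j = k := by dsimp only at hij; omega
  obtain ⟨t, ht⟩ := LinearMap.rTensor_surjective (L.bdr j) (K.cls_surjective i) (y ⟨(i, j), hij⟩)
  have h0 : (K.cls i).rTensor _ ((L.bdrToCyc j).lTensor _ t) = 0 := by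
    rw [← LinearMap.comp_apply, LinearMap.rTensor_comp_lTensor, ← LinearMap.lTensor_comp_rTensor,
      LinearMap.comp_apply, ht]
    exact hy ⟨(i, j), hij⟩
  obtain ⟨v, hv⟩ := (rTensor_exact (L.cyc j) (toCyc_cls_exact i) (K.cls_surjective _) _).1 h0
  obtain ⟨w, hw⟩ := LinearMap.lTensor_surjective (K.cyc i)
    (L.bd j).surjective_rangeRestrict t
  let w' : K.X i ⊗[R] L.X (j + 1) := (K.cyc i).subtype.rTensor _ w
  let v' : K.X (i + 1) ⊗[R] L.X j := (L.cyc j).subtype.lTensor _ v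
  have hbw : ∀ w : K.cyc i ⊗[R] L.X (j + 1), (tensor K L).bd k
      (incl ⟨(i, j + 1), by omega⟩ ((K.cyc i).subtype.rTensor _ w)) =
      (-1 : R) ^ i • incl ⟨(i, j), hij'⟩
        (TensorProduct.map (K.cyc i).subtype (L.bdr j).subtype ((L.toBdr j).lTensor _ w)) :=
    fun w => by
      induction w with
      | zero => simp only [map_zero, smul_zero]
      | add a b ha hb => simp only [map_add, smul_add, ha, hb]
      | tmul z x => exact bd_incl_right hij' z.2 x
  have hbv : ∀ v : K.X (i + 1) ⊗[R] L.cyc j, (tensor K L).bd k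
      (incl ⟨(i + 1, j), by omega⟩ ((L.cyc j).subtype.lTensor _ v)) =
      incl ⟨(i, j), hij'⟩ (TensorProduct.map (K.cyc i).subtype (L.cyc j).subtype
        ((K.toCyc i).rTensor _ v)) :=
    fun v => by
      induction v with
      | zero => simp only [map_zero]
      | add a b ha hb => simp only [map_add, ha, hb]
      | tmul x z => exact bd_incl_left hij' x z.2
  have hcyc : incl ⟨(i, j + 1), by omega⟩ w' - (-1 : R) ^ i • incl ⟨(i + 1, j), by omega⟩ v' ∈
      (tensor K L).cyc (k + 1) := by
    rw [mem_cyc_succ, map_sub, map_smul, hbw, hbv, hv, hw, ← smul_sub, ← map_sub,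
      LinearMap.lTensor, TensorProduct.map_map]
    exact (congrArg _ ((congrArg _ (sub_self _)).trans (map_zero _))).trans (smul_zero _)
  have hv0 : ∀ q : TorIndex (k + 1), TensorProduct.map (K.extCls q.1.1) (L.toBdr q.1.2)
      (coord (TorIndex.up q) (incl ⟨(i + 1, j), by omega⟩ v' : (tensor K L).X (k + 1))) = 0 := by
    intro q
    by_cases hq : TorIndex.up q = ⟨(i + 1, j), by omega⟩
    · obtain ⟨⟨a, b⟩, hab⟩ := q
      obtain ⟨rfl, rfl⟩ : a = i + 1 ∧ j = b + 1 := by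
        have := congrArg (fun x => x.1) hq
        simp only [Prod.mk.injEq] at this
        exact ⟨this.1, this.2.symm⟩
      have : L.toBdr b ∘ₗ (L.cyc (b + 1)).subtype = 0 :=
        LinearMap.ext fun w => Subtype.ext (mem_cyc_succ.1 w.2)
      rw [coord_incl_same]
      change TensorProduct.map (K.extCls (i + 1)) (L.toBdr b)
        ((L.cyc (b + 1)).subtype.lTensor _ v) = 0
      rw [LinearMap.lTensor, TensorProduct.map_map, this, TensorProduct.map_zero_right,
        LinearMap.zero_apply]
    · rw [coord_incl_ne hq, map_zero]
  refine ⟨(tensor K L).cls (k + 1) ⟨_, hcyc⟩, ?_, fun q hq => ?_⟩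
  · rw [torMap_cls, map_sub, map_sub, map_smul, map_smul, hv0, smul_zero, sub_zero,
      coord_incl_same, ← ht, ← hw]
    change TensorProduct.map (K.extCls i) (L.toBdr j) ((K.cyc i).subtype.rTensor _ w) = _
    rw [LinearMap.rTensor, TensorProduct.map_map, extCls_comp_subtype,
      ← LinearMap.comp_apply (LinearMap.rTensor _ _) (LinearMap.lTensor _ _),
      LinearMap.rTensor_comp_lTensor, LinearMap.comp_id]
  · rw [torMap_cls, map_sub, map_sub, map_smul, map_smul, hv0, smul_zero, sub_zero,
      coord_incl_ne, map_zero]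
    intro h
    apply hq
    have := congrArg (fun x => x.1) h
    simp only [Prod.mk.injEq, add_left_inj] at this
    exact Subtype.ext (Prod.ext this.1 this.2)

variable [∀ i, Module.Free R (L.X i)]

/-- A left inverse of the cross product, induced by the maps `extCls`. It is not natural. -/
def crossRetraction {k : ℕ} (q : TensorIndex k) :
    (tensor K L).homology k →ₗ[R] K.homology q.1.1 ⊗[R] L.homology q.1.2 :=
  clsLift (TensorProduct.map (K.extCls q.1.1) (L.extCls q.1.2) ∘ₗ coord q ∘ₗ
      ((tensor K L).cyc k).subtype) fun w => by
    change TensorProduct.map (K.extCls q.1.1) (L.extCls q.1.2)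
      (coord q ((tensor K L).bd k w)) = 0
    rw [coord_bd w q.1.1 q.1.2 q.2, map_add, map_smul, LinearMap.rTensor, LinearMap.lTensor,
      TensorProduct.map_map, TensorProduct.map_map, extCls_comp_bd, extCls_comp_bd,
      TensorProduct.map_zero_left, TensorProduct.map_zero_right]
    simp

theorem crossRetraction_cls {k : ℕ} (q : TensorIndex k) (z : (tensor K L).cyc k) :
    crossRetraction q ((tensor K L).cls k z) =
      TensorProduct.map (K.extCls q.1.1) (L.extCls q.1.2) (coord q z.1) := clsLift_cls _ _ _

theorem crossRetraction_cross_same {k : ℕ} (q : TensorIndex k)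
    (x : K.homology q.1.1 ⊗[R] L.homology q.1.2) : crossRetraction q (cross q x) = x := by
  obtain ⟨t, rfl⟩ := map_cls_surjective _ _ x
  rw [cross_cls, crossRetraction_cls]
  change TensorProduct.map _ _ (coord q (incl q (TensorProduct.map _ _ t))) = _
  rw [coord_incl_same, TensorProduct.map_map, extCls_comp_subtype, extCls_comp_subtype]

theorem crossRetraction_cross_ne {k : ℕ} {p q : TensorIndex k} (h : q ≠ p)
    (x : K.homology p.1.1 ⊗[R] L.homology p.1.2) : crossRetraction q (cross p x) = 0 := by
  obtain ⟨t, rfl⟩ := map_cls_surjective _ _ x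
  rw [cross_cls, crossRetraction_cls]
  change TensorProduct.map _ _ (coord q (incl p (TensorProduct.map _ _ t))) = _
  rw [coord_incl_ne h, map_zero]

end PID
end ChainComplex

namespace ChainComplex

open TensorProduct DirGraph

variable {R : Type u} [CommRing R]
variable {K L K' L' : ChainComplex (ModuleCat.{u} R) ℕ}

/-! ### The first torsion module -/

/-- A criterion for a quasi-isomorphism in terms of cycles and boundaries. -/
theorem quasiIsoAt_of_cycles (f : K ⟶ L) (k : ℕ)
    (hinj : ∀ z ∈ K.cyc k, (∃ w, L.bd k w = (f.f k).hom z) → ∃ w, K.bd k w = z)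
    (hsurj : ∀ z ∈ L.cyc k, ∃ x ∈ K.cyc k, ∃ w, L.bd k w = z - (f.f k).hom x) :
    QuasiIsoAt f k := by
  rw [quasiIsoAt_iff_isIso_homologyMap, ConcreteCategory.isIso_iff_bijective]
  constructor
  · refine (injective_iff_map_eq_zero (HomologicalComplex.homologyMap f k).hom).2 fun a ha => ?_
    obtain ⟨z, rfl⟩ := cls_surjective _ _ a
    rw [homologyMap_cls, cls_eq_zero] at ha
    exact cls_eq_zero.2 (hinj z.1 z.2 ha)
  · intro b
    obtain ⟨z, rfl⟩ := cls_surjective _ _ b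
    obtain ⟨x, hx, hw⟩ := hsurj z.1 z.2
    exact ⟨K.cls k ⟨x, hx⟩, (homologyMap_cls f k _).trans (cls_eq_cls.2 hw).symm⟩

section

variable (L) (j : ℕ)

/-- The terms of the two-term complex `B_j → Z_j`. -/
def resX : ℕ → ModuleCat.{u} R
  | 0 => ModuleCat.of R (L.cyc j)
  | 1 => ModuleCat.of R (L.bdr j)
  | _ + 2 => ModuleCat.of R PUnit

/-- The differentials of the two-term complex `B_j → Z_j`. -/
def resD : ∀ n, resX L j (n + 1) ⟶ resX L j n
  | 0 => ModuleCat.ofHom (L.bdrToCyc j)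
  | _ + 1 => 0

/-- The two-term complex `B_j → Z_j`. -/
def resComplex : ChainComplex (ModuleCat.{u} R) ℕ :=
  ChainComplex.of (resX L j) (resD L j) fun _ => zero_comp

theorem resComplex_d_zero : (resComplex L j).d 1 0 = ModuleCat.ofHom (L.bdrToCyc j) :=
  ChainComplex.of_d (resX L j) (resD L j) 0

theorem resComplex_d_succ (n : ℕ) : (resComplex L j).d (n + 2) (n + 1) = 0 :=
  ChainComplex.of_d (resX L j) (resD L j) (n + 1)

/-- The augmentation of the two-term complex `B_j → Z_j` to the homology. -/
def resAug : resComplex L j ⟶ (ChainComplex.single₀ (ModuleCat.{u} R)).obj (L.homology j) :=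
  (ChainComplex.toSingle₀Equiv _ _).symm ⟨ModuleCat.ofHom (L.cls j), by
    rw [resComplex_d_zero]
    ext x
    obtain ⟨w, hw⟩ := x.2
    exact cls_eq_zero.2 ⟨w, hw⟩⟩

theorem resAug_f_zero : (resAug L j).f 0 = ModuleCat.ofHom (L.cls j) :=
  ChainComplex.toSingle₀Equiv_symm_apply_f_zero _ _

theorem resAug_quasiIso : QuasiIso (resAug L j) := by
  rw [quasiIso_iff]
  intro n
  match n with
  | 0 =>
    refine quasiIsoAt_of_cycles _ _ (fun z _ hw => ?_) (fun z _ => ?_)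
    · obtain ⟨w, hw⟩ := hw
      have hw : (((single₀ (ModuleCat R)).obj (L.homology j)).d 1 0).hom w =
        ((resAug L j).f 0).hom z := hw
      rw [resAug_f_zero, HomologicalComplex.single_obj_d] at hw
      obtain ⟨y, hy⟩ := cls_eq_zero.1 (show L.cls j z = 0 from hw.symm)
      refine ⟨(⟨_, y, hy⟩ : L.bdr j), ?_⟩
      rw [bd, resComplex_d_zero]
      rfl
    · obtain ⟨x, hx⟩ := L.cls_surjective j z
      refine ⟨x, mem_cyc_zero _, 0, ?_⟩
      rw [map_zero, resAug_f_zero, eq_comm, sub_eq_zero]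
      exact hx.symm
  | n + 1 =>
    refine quasiIsoAt_of_cycles _ _ (fun z hz _ => ?_) (fun z _ => ?_)
    · refine ⟨0, (map_zero _).trans ?_⟩
      cases n with
      | zero =>
        rw [mem_cyc_succ, bd, resComplex_d_zero] at hz
        exact (Subtype.ext (congrArg (fun x : L.cyc j => x.1) hz) : z = (0 : L.bdr j)).symm
      | succ n => rfl
    · have : IsZero (((single₀ (ModuleCat R)).obj (L.homology j)).X (n + 1)) :=
        HomologicalComplex.isZero_single_obj_X _ _ _ _ (by simp)
      have := ModuleCat.subsingleton_of_isZero this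
      exact ⟨0, zero_mem _, 0, Subsingleton.elim _ _⟩

variable [IsDomain R] [IsPrincipalIdealRing R] [∀ i, Module.Free R (L.X i)]

/-- The projective resolution `B_j → Z_j` of `H_j`. -/
def res : ProjectiveResolution (L.homology j) where
  complex := resComplex L j
  projective n := by
    match n with
    | 0 =>
      have := Submodule.free_of_isPrincipalIdealRing (L.cyc j)
      exact (IsProjective.iff_projective (L.cyc j)).1 inferInstance
    | 1 =>
      have := Submodule.free_of_isPrincipalIdealRing (L.bdr j)
      exact (IsProjective.iff_projective (L.bdr j)).1 inferInstance
    | n + 2 => exact (IsProjective.iff_projective (R := R) PUnit.{u + 1}).1 inferInstance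
  π := resAug L j
  quasiIso := resAug_quasiIso L j

end

/-- The components of the map of two-term complexes induced by a chain map. -/
def resMapX (g : L ⟶ L') (j : ℕ) : ∀ n, resX L j n ⟶ resX L' j n
  | 0 => ModuleCat.ofHom (cycMap g j)
  | 1 => ModuleCat.ofHom (bdrMap g j)
  | _ + 2 => 0

theorem resMapX_comm (g : L ⟶ L') (j : ℕ) : ∀ n,
    resMapX g j (n + 1) ≫ resD L' j n = resD L j n ≫ resMapX g j n
  | 0 => rfl
  | _ + 1 => comp_zero.trans zero_comp.symm

/-- The map of two-term complexes induced by a chain map. -/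
def resMap (g : L ⟶ L') (j : ℕ) : resComplex L j ⟶ resComplex L' j :=
  ChainComplex.ofHom (resMapX g j) fun n =>
    (congrArg (resMapX g j (n + 1) ≫ ·) (ChainComplex.of_d (resX L' j) (resD L' j) n)).trans
      ((resMapX_comm g j n).trans
        (congrArg (· ≫ resMapX g j n) (ChainComplex.of_d (resX L j) (resD L j) n)).symm)

theorem resMap_comm (g : L ⟶ L') (j : ℕ) : (resMap g j).f 0 ≫ (resAug L' j).f 0 =
    (resAug L j).f 0 ≫ HomologicalComplex.homologyMap g j := by
  rw [resAug_f_zero, resAug_f_zero]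
  ext z
  exact (homologyMap_cls g j z).symm

/-- For a complex with no differential out of degree `2`, the first homology embeds into the degree
`1` part. -/
def homologyOneι (P : ChainComplex (ModuleCat.{u} R) ℕ) (h : P.d 2 1 = 0) : P.homology 1 ⟶ P.X 1 :=
  P.homologyι 1 ≫ P.descOpcycles (𝟙 _) 2 (by simp) (by rw [h, zero_comp])

theorem homologyOneι_cls (h : K.d 2 1 = 0) (z : K.cyc 1) :
    (homologyOneι K h).hom (K.cls 1 z) = z.1 := by
  rw [cls, homologyOneι, ← ModuleCat.comp_apply, Category.assoc,
    HomologicalComplex.homology_π_ι_assoc, HomologicalComplex.p_descOpcycles, Category.comp_id,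
    HomologicalComplex.liftCycles_i]
  rfl

theorem homologyOneι_injective (h : K.d 2 1 = 0) :
    Function.Injective (homologyOneι K h).hom := by
  intro x y hxy
  obtain ⟨z, rfl⟩ := cls_surjective _ _ x
  obtain ⟨w, rfl⟩ := cls_surjective _ _ y
  rw [homologyOneι_cls, homologyOneι_cls] at hxy
  rw [Subtype.ext hxy]

theorem mem_range_homologyOneι (h : K.d 2 1 = 0) (x : K.X 1) :
    (∃ y, (homologyOneι K h).hom y = x) ↔ K.bd 0 x = 0 := by
  constructor
  · rintro ⟨y, rfl⟩
    obtain ⟨z, rfl⟩ := cls_surjective _ _ y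
    rw [homologyOneι_cls]
    exact z.2
  · intro hx
    exact ⟨K.cls 1 ⟨x, hx⟩, homologyOneι_cls h _⟩

theorem homologyOneι_naturality (f : K ⟶ L) (h : K.d 2 1 = 0) (h' : L.d 2 1 = 0) :
    HomologicalComplex.homologyMap f 1 ≫ homologyOneι L h' = homologyOneι K h ≫ f.f 1 := by
  ext x
  obtain ⟨z, rfl⟩ := cls_surjective _ _ x
  rw [ModuleCat.comp_apply, ModuleCat.comp_apply]
  refine (congrArg _ (homologyMap_cls f 1 z)).trans ?_
  refine (homologyOneι_cls h' _).trans ?_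
  exact (congrArg _ (homologyOneι_cls h z)).symm

theorem map_d_eq_zero {P : ChainComplex (ModuleCat.{u} R) ℕ} (h : P.d 2 1 = 0)
    (F : ModuleCat.{u} R ⥤ ModuleCat.{u} R) [F.Additive] :
    ((F.mapHomologicalComplex _).obj P).d 2 1 = 0 :=
  (congrArg F.map h).trans (F.map_zero _ _)

/-- The first derived functor, computed by a resolution of length one, embeds into the degree `1`
part. -/
def leftDerivedι {N : ModuleCat.{u} R} (P : ProjectiveResolution N) (h : P.complex.d 2 1 = 0)
    (F : ModuleCat.{u} R ⥤ ModuleCat.{u} R) [F.Additive] :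
    (F.leftDerived 1).obj N ⟶ ((F.mapHomologicalComplex _).obj P.complex).X 1 :=
  (P.isoLeftDerivedObj F 1).hom ≫
    homologyOneι ((F.mapHomologicalComplex _).obj P.complex) (map_d_eq_zero h F)

/-- The embedding is natural in the module, along a lift of the map to resolutions, and in the
functor. For `Tor₁` this is naturality in both variables. -/
theorem leftDerivedι_naturality {N N' : ModuleCat.{u} R} (f : N ⟶ N')
    (P : ProjectiveResolution N) (h : P.complex.d 2 1 = 0) (Q : ProjectiveResolution N')
    (h' : Q.complex.d 2 1 = 0) (φ : P.complex ⟶ Q.complex)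
    (comm : φ.f 0 ≫ Q.π.f 0 = P.π.f 0 ≫ f)
    {F G : ModuleCat.{u} R ⥤ ModuleCat.{u} R} [F.Additive] [G.Additive] (α : F ⟶ G) :
    (NatTrans.leftDerived α 1).app N ≫ (G.leftDerived 1).map f ≫ leftDerivedι Q h' G =
      leftDerivedι P h F ≫ ((NatTrans.mapHomologicalComplex α _).app P.complex).f 1 ≫
        ((G.mapHomologicalComplex _).map φ).f 1 := by
  have h1 := P.leftDerived_app_eq α 1
  have h2 := ProjectiveResolution.isoLeftDerivedObj_hom_naturality f P Q φ comm G 1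
  have h3 := homologyOneι_naturality ((NatTrans.mapHomologicalComplex α _).app P.complex)
    (map_d_eq_zero h F) (map_d_eq_zero h G)
  have h4 := homologyOneι_naturality ((G.mapHomologicalComplex _).map φ)
    (map_d_eq_zero h G) (map_d_eq_zero h' G)
  ext x
  set y := (P.isoLeftDerivedObj F 1).hom.hom x
  set w := (HomologicalComplex.homologyMap
    ((NatTrans.mapHomologicalComplex α _).app P.complex) 1).hom y
  have e1 : ((NatTrans.leftDerived α 1).app N).hom x = (P.isoLeftDerivedObj G 1).inv.hom w :=
    congrArg (fun m => m.hom x) h1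
  have e2 : (P.isoLeftDerivedObj G 1).hom.hom ((P.isoLeftDerivedObj G 1).inv.hom w) = w :=
    congrArg (fun m => m.hom w) (P.isoLeftDerivedObj G 1).inv_hom_id
  have e3 : (Q.isoLeftDerivedObj G 1).hom.hom (((G.leftDerived 1).map f).hom
      ((P.isoLeftDerivedObj G 1).inv.hom w)) = (HomologicalComplex.homologyMap
        ((G.mapHomologicalComplex _).map φ) 1).hom w :=
    (congrArg (fun m => m.hom ((P.isoLeftDerivedObj G 1).inv.hom w)) h2).trans
      (congrArg (HomologicalComplex.homologyMap ((G.mapHomologicalComplex _).map φ) 1).hom e2)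
  refine (congrArg (fun v => (leftDerivedι Q h' G).hom (((G.leftDerived 1).map f).hom v)) e1).trans
    ?_
  refine (congrArg (homologyOneι _ (map_d_eq_zero h' G)).hom e3).trans ?_
  refine (congrArg (fun m => m.hom w) h4).trans ?_
  exact congrArg (((G.mapHomologicalComplex _).map φ).f 1).hom (congrArg (fun m => m.hom y) h3)

theorem leftDerivedι_injective {N : ModuleCat.{u} R} (P : ProjectiveResolution N)
    (h : P.complex.d 2 1 = 0) (F : ModuleCat.{u} R ⥤ ModuleCat.{u} R) [F.Additive] :
    Function.Injective (leftDerivedι P h F).hom :=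
  (homologyOneι_injective (map_d_eq_zero h F)).comp
    ((ConcreteCategory.isIso_iff_bijective (P.isoLeftDerivedObj F 1).hom).1 inferInstance).1

theorem mem_range_leftDerivedι {N : ModuleCat.{u} R} (P : ProjectiveResolution N)
    (h : P.complex.d 2 1 = 0) (F : ModuleCat.{u} R ⥤ ModuleCat.{u} R) [F.Additive]
    (x : F.obj (P.complex.X 1)) :
    (∃ y, (leftDerivedι P h F).hom y = x) ↔ (F.map (P.complex.d 1 0)).hom x = 0 := by
  refine Iff.trans ?_ (mem_range_homologyOneι (map_d_eq_zero h F) x)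
  constructor
  · rintro ⟨y, rfl⟩
    exact ⟨_, rfl⟩
  · rintro ⟨y, rfl⟩
    obtain ⟨w, rfl⟩ := ((ConcreteCategory.isIso_iff_bijective
      (P.isoLeftDerivedObj F 1).hom).1 inferInstance).2 y
    exact ⟨w, rfl⟩

section Tor

open MonoidalCategory

variable [IsDomain R] [IsPrincipalIdealRing R] [∀ i, Module.Free R (L.X i)]

variable (L) in
/-- `Tor₁(M, H_j)` embeds into `M ⊗ B_j`, as the kernel of `M ⊗ B_j → M ⊗ Z_j`. -/
def torι (M : ModuleCat.{u} R) (j : ℕ) :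
    ((Tor (ModuleCat.{u} R) 1).obj M).obj (L.homology j) ⟶ ModuleCat.of R (M ⊗[R] L.bdr j) :=
  leftDerivedι (res L j) (resComplex_d_succ L j 0) ((tensoringLeft _).obj M)

theorem torι_injective (M : ModuleCat.{u} R) (j : ℕ) : Function.Injective (torι L M j).hom :=
  leftDerivedι_injective _ _ _

theorem mem_range_torι (M : ModuleCat.{u} R) (j : ℕ) (x : M ⊗[R] L.bdr j) :
    (∃ y, (torι L M j).hom y = x) ↔ (L.bdrToCyc j).lTensor M x = 0 := by
  refine (mem_range_leftDerivedι (res L j) (resComplex_d_succ L j 0)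
    ((tensoringLeft _).obj M) x).trans ?_
  have : (res L j).complex.d 1 0 = ModuleCat.ofHom (L.bdrToCyc j) := resComplex_d_zero L j
  rw [this]
  rfl

theorem torι_naturality [∀ i, Module.Free R (L'.X i)] {M M' : ModuleCat.{u} R} (f : M ⟶ M')
    (g : L ⟶ L') (j : ℕ) :
    ((Tor (ModuleCat.{u} R) 1).map f).app (L.homology j) ≫
      ((Tor (ModuleCat.{u} R) 1).obj M').map (HomologicalComplex.homologyMap g j) ≫
        torι L' M' j =
      torι L M j ≫ ModuleCat.ofHom (TensorProduct.map f.hom (bdrMap g j)) := by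
  refine (leftDerivedι_naturality (HomologicalComplex.homologyMap g j) (res L j)
    (resComplex_d_succ L j 0) (res L' j) (resComplex_d_succ L' j 0) (resMap g j) (resMap_comm g j)
    ((tensoringLeft (ModuleCat.{u} R)).map f)).trans (congrArg (torι L M j ≫ ·) ?_)
  exact ModuleCat.hom_ext (TensorProduct.ext' fun m b => rfl)

end Tor

end ChainComplex

/-! ### Complexes with acyclic carriers -/

/-- A complex with a basis is acyclic if every basis element lies in an acyclic subcomplex, its
carrier, such that each carrier is spanned by basis elements with smaller carriers. The contraction
is built one degree at a time, keeping the image of each basis element in its carrier. -/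
theorem exists_preimage_of_acyclic_carriers {R : Type*} [CommRing R] {S : Type*} (M : ℕ → Type*)
    [∀ k, AddCommGroup (M k)] [∀ k, Module R (M k)] (d : ∀ k, M (k + 1) →ₗ[R] M k)
    (dd : ∀ k x, d k (d (k + 1) x) = 0)
    {ι : ℕ → Type*} (B : ∀ k, Module.Basis (ι k) R (M k)) (s : ∀ k, ι k → S)
    (N : S → ∀ k, Submodule R (M k))
    (hB : ∀ k i, B k i ∈ N (s k i) k)
    (hspan : ∀ σ k, N σ k ≤ Submodule.span R (B k '' {i | ∀ l, N (s k i) l ≤ N σ l}))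
    (hd : ∀ σ k, ∀ x ∈ N σ (k + 1), d k x ∈ N σ k)
    (hex₀ : ∀ σ, ∀ z ∈ N σ 0, ∃ y ∈ N σ 1, d 0 y = z)
    (hex : ∀ σ k, ∀ z ∈ N σ (k + 1), d k z = 0 → ∃ y ∈ N σ (k + 2), d (k + 1) y = z) :
    (∀ z, ∃ y, d 0 y = z) ∧ ∀ k z, d k z = 0 → ∃ y, d (k + 1) y = z := by
  have carried : ∀ {k} (T : M k →ₗ[R] M (k + 1)), (∀ i, T (B k i) ∈ N (s k i) (k + 1)) →
      ∀ σ, ∀ x ∈ N σ k, T x ∈ N σ (k + 1) := by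
    intro k T hT σ x hx
    refine (Submodule.span_le (p := (N σ (k + 1)).comap T)).2 ?_ (hspan σ k hx)
    rintro _ ⟨i, hi, rfl⟩
    exact hi _ (hT i)
  have h0 : ∃ T : M 0 →ₗ[R] M 1, (∀ i, T (B 0 i) ∈ N (s 0 i) 1) ∧ ∀ z, d 0 (T z) = z := by
    choose y hy hdy using fun i => hex₀ _ _ (hB 0 i)
    refine ⟨(B 0).constr R y, fun i => ?_, fun z => ?_⟩
    · rw [Module.Basis.constr_basis]
      exact hy i
    · refine LinearMap.congr_fun ((B 0).ext (f₁ := d 0 ∘ₗ (B 0).constr R y)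
        (f₂ := LinearMap.id) fun i => ?_) z
      rw [LinearMap.comp_apply, Module.Basis.constr_basis, hdy, LinearMap.id_apply]
  have hstep : ∀ k (T : M k →ₗ[R] M (k + 1)), (∀ i, T (B k i) ∈ N (s k i) (k + 1)) →
      (∀ x, d k (T (d k x)) = d k x) →
      ∃ T' : M (k + 1) →ₗ[R] M (k + 2), (∀ i, T' (B (k + 1) i) ∈ N (s (k + 1) i) (k + 2)) ∧
        ∀ z, d (k + 1) (T' z) = z - T (d k z) := by
    intro k T hT hTd
    choose y hy hdy using fun i => hex _ k (B (k + 1) i - T (d k (B (k + 1) i)))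
      (sub_mem (hB (k + 1) i) (carried T hT _ _ (hd _ _ _ (hB (k + 1) i))))
      (by rw [map_sub, hTd, sub_self])
    refine ⟨(B (k + 1)).constr R y, fun i => ?_, fun z => ?_⟩
    · rw [Module.Basis.constr_basis]
      exact hy i
    · refine LinearMap.congr_fun ((B (k + 1)).ext (f₁ := d (k + 1) ∘ₗ (B (k + 1)).constr R y)
        (f₂ := LinearMap.id - T ∘ₗ d k) fun i => ?_) z
      rw [LinearMap.comp_apply, Module.Basis.constr_basis, hdy]
      rfl
  have hall : ∀ k, ∃ T : M (k + 1) →ₗ[R] M (k + 2),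
      (∀ i, T (B (k + 1) i) ∈ N (s (k + 1) i) (k + 2)) ∧
        ∀ z, d k z = 0 → d (k + 1) (T z) = z := by
    intro k
    induction k with
    | zero =>
      obtain ⟨T, hT, hTd⟩ := h0
      obtain ⟨T', hT', h⟩ := hstep 0 T hT fun x => hTd _
      exact ⟨T', hT', fun z hz => by rw [h, hz, map_zero, sub_zero]⟩
    | succ k ih =>
      obtain ⟨T, hT, hTd⟩ := ih
      obtain ⟨T', hT', h⟩ := hstep (k + 1) T hT fun x => hTd _ (dd k x)
      exact ⟨T', hT', fun z hz => by rw [h, hz, map_zero, sub_zero]⟩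
  refine ⟨fun z => ?_, fun k z hz => ?_⟩
  · obtain ⟨T, -, h⟩ := h0
    exact ⟨T z, h z⟩
  · obtain ⟨T, -, h⟩ := hall k
    exact ⟨T z, h z hz⟩

namespace DirGraph

open ChainComplex TensorProduct

/-! ### Chains in the reachability complex -/

variable (R : Type u) [CommRing R] {G H : DirGraph.{u}}

/-- The reachability complex of a directed graph. -/
abbrev RC (G : DirGraph.{u}) : ChainComplex (ModuleCat.{u} R) ℕ := (reachabilityComplex R).obj G

/-- The chain given by a tuple, which is zero unless the tuple is a generator. -/
def gen {k : ℕ} (v : Fin (k + 1) → G.V) : (RC R G).X k := basisElt R v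

variable {R}

instance (k : ℕ) : Module.Free R ((RC R G).X k) :=
  inferInstanceAs (Module.Free R (G.Gen k →₀ R))

theorem RC_bd (k : ℕ) : (RC R G).bd k = boundary G R k :=
  congrArg ModuleCat.Hom.hom (ChainComplex.of_d (fun k => ModuleCat.of R (G.Gen k →₀ R))
    (fun k => ModuleCat.ofHom (boundary G R k)) k)

theorem bd_gen {k : ℕ} {v : Fin (k + 2) → G.V} (hv : IsChain v) :
    (RC R G).bd k (gen R v) =
      ∑ j : Fin (k + 2), (-1 : R) ^ (j : ℕ) • gen R fun i => v (j.succAbove i) := by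
  rw [RC_bd]
  exact boundary_basisElt R hv

theorem map_gen (f : G ⟶ H) {k : ℕ} {v : Fin (k + 1) → G.V} (hv : IsChain v) :
    (((reachabilityComplex R).map f).f k).hom (gen R v) = gen R fun i => f.toFun (v i) :=
  chainMap_basisElt R f hv

theorem gen_of_not_isRegular {k : ℕ} {v : Fin (k + 1) → G.V} (h : ¬ IsRegular v) :
    gen R v = 0 := dif_neg fun h' => h h'.1

theorem gen_of_eq {k : ℕ} {v : Fin (k + 1) → G.V} {j : Fin k} (h : v j.castSucc = v j.succ) :
    gen R v = 0 := gen_of_not_isRegular fun h' => h' j h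

variable (R G) in
/-- The basis of the reachability complex given by its generators. -/
def genBasis (k : ℕ) : Module.Basis (G.Gen k) R ((RC R G).X k) :=
  (Finsupp.basisSingleOne : Module.Basis (G.Gen k) R (G.Gen k →₀ R))

theorem genBasis_apply {k : ℕ} (v : G.Gen k) : genBasis R G k v = gen R v.1 :=
  (congrFun Finsupp.coe_basisSingleOne v).trans (basisElt_gen R v).symm

theorem RC_hom_ext {k : ℕ} {N : Type*} [AddCommGroup N] [Module R N]
    {f g : (RC R G).X k →ₗ[R] N} (h : ∀ v, IsRegular v → IsChain v → f (gen R v) = g (gen R v)) :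
    f = g :=
  (genBasis R G k).ext fun v => by
    rw [genBasis_apply]
    exact h v.1 v.2.1 v.2.2

/-- The linear map on chains given by a function on tuples. -/
def cochain {k : ℕ} {N : Type*} [AddCommGroup N] [Module R N] (F : (Fin (k + 1) → G.V) → N) :
    (RC R G).X k →ₗ[R] N :=
  (genBasis R G k).constr R fun v => F v.1

theorem cochain_gen {k : ℕ} {N : Type*} [AddCommGroup N] [Module R N]
    {F : (Fin (k + 1) → G.V) → N} (hF : ∀ v, ¬ IsRegular v → F v = 0)
    {v : Fin (k + 1) → G.V} (hv : IsChain v) : cochain F (gen R v) = F v := by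
  by_cases hr : IsRegular v
  · rw [cochain, ← genBasis_apply ⟨v, hr, hv⟩, Module.Basis.constr_basis]
  · rw [gen_of_not_isRegular hr, hF v hr, map_zero]

/-! ### The cone on the vertices reachable from a vertex -/

/-- The tuple `(x, v₀, …, vₖ)`. -/
abbrev consTuple {k : ℕ} (x : G.V) (v : Fin (k + 1) → G.V) : Fin (k + 2) → G.V :=
  Fin.cons (α := fun _ => G.V) x v

theorem IsChain.cons {k : ℕ} {x : G.V} {v : Fin (k + 1) → G.V} (hv : IsChain v)
    (h : G.Reachable x (v 0)) : IsChain (consTuple x v) := by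
  intro j
  induction j using Fin.cases with
  | zero => exact h
  | succ j => exact hv j

theorem isRegular_of_cons {k : ℕ} {x : G.V} {v : Fin (k + 1) → G.V}
    (h : IsRegular (consTuple x v)) : IsRegular v := fun j => h j.succ

theorem Reachable.refl (x : G.V) : G.Reachable x x := (reachable_iff G _ _).2 .refl

variable (R) in
/-- The operator that prepends a vertex. -/
def prepend (x : G.V) (k : ℕ) : (RC R G).X k →ₗ[R] (RC R G).X (k + 1) :=
  cochain fun v => gen R (consTuple x v)

theorem prepend_gen (x : G.V) {k : ℕ} {v : Fin (k + 1) → G.V} (hv : IsChain v) :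
    prepend R x k (gen R v) = gen R (consTuple x v) :=
  cochain_gen (fun _ h => gen_of_not_isRegular fun h' => h (isRegular_of_cons h')) hv

variable (R) in
/-- The chains on the vertices that can be reached from `x`. -/
def upset (x : G.V) (k : ℕ) : Submodule R ((RC R G).X k) :=
  Submodule.span R {c | ∃ v, IsChain v ∧ G.Reachable x (v 0) ∧ gen R v = c}

theorem gen_mem_upset {x : G.V} {k : ℕ} {v : Fin (k + 1) → G.V} (hv : IsChain v)
    (h : G.Reachable x (v 0)) : gen R v ∈ upset R x k := Submodule.subset_span ⟨v, hv, h, rfl⟩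

theorem map_upset_le {x : G.V} {k : ℕ} {N : Type*} [AddCommGroup N] [Module R N]
    {f : (RC R G).X k →ₗ[R] N} {P : Submodule R N}
    (h : ∀ v, IsChain v → G.Reachable x (v 0) → f (gen R v) ∈ P) {c : (RC R G).X k}
    (hc : c ∈ upset R x k) : f c ∈ P := by
  refine (Submodule.span_le (p := P.comap f)).2 ?_ hc
  rintro _ ⟨v, hv, h', rfl⟩
  exact h v hv h'

theorem eqOn_upset {x : G.V} {k : ℕ} {N : Type*} [AddCommGroup N] [Module R N]
    {f g : (RC R G).X k →ₗ[R] N}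
    (h : ∀ v, IsChain v → G.Reachable x (v 0) → f (gen R v) = g (gen R v)) {c : (RC R G).X k}
    (hc : c ∈ upset R x k) : f c = g c := by
  refine LinearMap.eqOn_span ?_ hc
  rintro _ ⟨v, hv, h', rfl⟩
  exact h v hv h'

theorem bd_mem_upset {x : G.V} {k : ℕ} {c : (RC R G).X (k + 1)} (hc : c ∈ upset R x (k + 1)) :
    (RC R G).bd k c ∈ upset R x k := by
  refine map_upset_le (fun v hv h => ?_) hc
  rw [bd_gen hv]
  refine Submodule.sum_mem _ fun j _ => Submodule.smul_mem _ _ (gen_mem_upset (hv.face j) ?_)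
  exact h.trans (hv.reachable (Fin.zero_le _))

theorem prepend_mem_upset {x : G.V} {k : ℕ} {c : (RC R G).X k} (hc : c ∈ upset R x k) :
    prepend R x k c ∈ upset R x (k + 1) := by
  refine map_upset_le (fun v hv h => ?_) hc
  rw [prepend_gen x hv]
  exact gen_mem_upset (hv.cons h) (Reachable.refl x)

variable (R G) in
/-- The augmentation, the sum of the coefficients of a chain in degree `0`. -/
def augmentation : (RC R G).X 0 →ₗ[R] R := cochain fun _ => 1

theorem augmentation_gen (v : Fin 1 → G.V) : augmentation R G (gen R v) = 1 :=
  cochain_gen (fun _ h => absurd (fun j => j.elim0) h) fun j => j.elim0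

theorem augmentation_bd (c : (RC R G).X 1) : augmentation R G ((RC R G).bd 0 c) = 0 := by
  refine LinearMap.congr_fun (f := augmentation R G ∘ₗ (RC R G).bd 0) (g := 0)
    (RC_hom_ext fun v _ hv => ?_) c
  rw [LinearMap.comp_apply, bd_gen hv, map_sum, Fin.sum_univ_two, map_smul, map_smul,
    augmentation_gen, augmentation_gen]
  simp

/-- In degree `0` the boundary of the cone on `c` is `c` minus a multiple of the apex. -/
theorem bd_prepend_zero {x : G.V} {c : (RC R G).X 0} (hc : c ∈ upset R x 0) :
    (RC R G).bd 0 (prepend R x 0 c) = c - augmentation R G c • gen R fun _ => x := by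
  refine eqOn_upset (f := (RC R G).bd 0 ∘ₗ prepend R x 0)
    (g := LinearMap.id - (augmentation R G).smulRight (gen R fun _ => x)) (fun v hv h => ?_) hc
  rw [LinearMap.comp_apply, prepend_gen x hv, bd_gen (hv.cons h), Fin.sum_univ_two,
    LinearMap.sub_apply, LinearMap.smulRight_apply, augmentation_gen, one_smul,
    LinearMap.id_apply, Fin.val_zero, pow_zero, one_smul, Fin.val_one, pow_one, neg_one_smul,
    sub_eq_add_neg]
  congr 3
  funext i
  obtain rfl : i = 0 := Fin.fin_one_eq_zero i
  rfl

/-- In positive degrees prepending `x` contracts the chains on the vertices reachable from `x`. -/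
theorem bd_prepend_succ {x : G.V} {k : ℕ} {c : (RC R G).X (k + 1)}
    (hc : c ∈ upset R x (k + 1)) :
    (RC R G).bd (k + 1) (prepend R x (k + 1) c) = c - prepend R x k ((RC R G).bd k c) := by
  refine eqOn_upset (f := (RC R G).bd (k + 1) ∘ₗ prepend R x (k + 1))
    (g := LinearMap.id - prepend R x k ∘ₗ (RC R G).bd k) (fun v hv h => ?_) hc
  rw [LinearMap.comp_apply, prepend_gen x hv, bd_gen (hv.cons h), Fin.sum_univ_succ,
    LinearMap.sub_apply, LinearMap.comp_apply, bd_gen hv, map_sum, LinearMap.id_apply,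
    Fin.val_zero, pow_zero, one_smul, sub_eq_add_neg, ← Finset.sum_neg_distrib]
  congr 1
  refine Finset.sum_congr rfl fun j _ => ?_
  rw [map_smul, prepend_gen x (hv.face j), Fin.val_succ, pow_succ, mul_neg_one, neg_smul]
  congr 3
  funext i
  induction i using Fin.cases with
  | zero => rw [Fin.succ_succAbove_zero]; rfl
  | succ i => rw [Fin.succ_succAbove_succ]; rfl

end DirGraph

namespace DirGraph

open ChainComplex TensorProduct

variable (R : Type u) [CommRing R] {G H : DirGraph.{u}}

/-! ### Reachability in products -/

theorem Reachable.of_adj {u v : G.V} (h : G.graph.Adj u v) : G.Reachable u v :=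
  (reachable_iff G _ _).2 (.single h)

/-- The first projection of the strong product. -/
def strongFst (G H : DirGraph.{u}) : strongProduct.obj (G, H) ⟶ G where
  toFun := Prod.fst
  map_edge := by
    rintro u v (⟨h, _⟩ | ⟨h, _⟩ | ⟨h, _⟩)
    exacts [Or.inl h, Or.inr h, Or.inr h]

/-- The second projection of the strong product. -/
def strongSnd (G H : DirGraph.{u}) : strongProduct.obj (G, H) ⟶ H where
  toFun := Prod.snd
  map_edge := by
    rintro u v (⟨_, h⟩ | ⟨_, h⟩ | ⟨_, h⟩)
    exacts [Or.inr h, Or.inl h, Or.inr h]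

/-- The box product is a subgraph of the strong product. -/
def boxToStrong : boxProduct.{u} ⟶ strongProduct where
  app P :=
    { toFun := fun x => x
      map_edge := by
        rintro u v (h | h)
        exacts [Or.inr (Or.inl h), Or.inr (Or.inr (Or.inl h))] }

/-- Move along the first coordinate, then along the second one. -/
theorem box_reachable_of {G H : DirGraph.{u}} {x y : G.V × H.V} (h₁ : G.Reachable x.1 y.1)
    (h₂ : H.Reachable x.2 y.2) : (boxProduct.obj (G, H)).Reachable x y := by
  obtain ⟨a, b⟩ := x
  obtain ⟨c, d⟩ := y
  rw [reachable_iff] at h₁ h₂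
  have h₃ : (boxProduct.obj (G, H)).Reachable (a, b) (c, b) := by
    refine (reachable_iff (boxProduct.obj (G, H)) _ _).2 ?_
    exact h₁.lift (fun z => (z, b)) fun _ _ h => Or.inr ⟨h, rfl⟩
  have h₄ : (boxProduct.obj (G, H)).Reachable (c, b) (c, d) := by
    refine (reachable_iff (boxProduct.obj (G, H)) _ _).2 ?_
    exact h₂.lift (fun z => (c, z)) fun _ _ h => Or.inl ⟨rfl, h⟩
  exact h₃.trans h₄

theorem strong_reachable_iff {G H : DirGraph.{u}} {x y : G.V × H.V} :
    (strongProduct.obj (G, H)).Reachable x y ↔ G.Reachable x.1 y.1 ∧ H.Reachable x.2 y.2 :=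
  ⟨fun h => ⟨h.map (strongFst G H), h.map (strongSnd G H)⟩,
    fun h => (box_reachable_of h.1 h.2).map (boxToStrong.app (G, H))⟩

theorem box_reachable_iff {G H : DirGraph.{u}} {x y : G.V × H.V} :
    (boxProduct.obj (G, H)).Reachable x y ↔ (strongProduct.obj (G, H)).Reachable x y :=
  ⟨fun h => h.map (boxToStrong.app (G, H)),
    fun h => box_reachable_of (strong_reachable_iff.1 h).1 (strong_reachable_iff.1 h).2⟩

/-! ### The Alexander–Whitney map -/

/-- The strong product of two directed graphs. -/
abbrev strong (G H : DirGraph.{u}) : DirGraph.{u} := strongProduct.obj (G, H)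

variable {R}

/-- The front part `(v₀, …, vᵢ)` of a tuple. -/
def front {α : Type*} {i j k : ℕ} (h : i + j = k) (v : Fin (k + 1) → α) : Fin (i + 1) → α :=
  fun t => v ⟨t, by omega⟩

/-- The back part `(vᵢ, …, vₖ)` of a tuple. -/
def back {α : Type*} {i j k : ℕ} (h : i + j = k) (v : Fin (k + 1) → α) : Fin (j + 1) → α :=
  fun t => v ⟨i + t, by omega⟩

/-- The tensor product of the front part of the first coordinate and the back part of the second
coordinate. -/
def awTerm {k : ℕ} (v : Fin (k + 1) → (strong G H).V) (p : TensorIndex k) :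
    (RC R G).X p.1.1 ⊗[R] (RC R H).X p.1.2 :=
  gen R (front p.2 fun i => (v i).1) ⊗ₜ gen R (back p.2 fun i => (v i).2)

theorem awTerm_of_not_isRegular {k : ℕ} {v : Fin (k + 1) → (strong G H).V} (h : ¬ IsRegular v)
    (p : TensorIndex k) : (awTerm v p : (RC R G).X p.1.1 ⊗[R] (RC R H).X p.1.2) = 0 := by
  unfold IsRegular at h
  push Not at h
  obtain ⟨l, hl⟩ := h
  obtain ⟨⟨i, j⟩, hp⟩ := p
  dsimp only at hp
  by_cases hli : (l : ℕ) < i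
  · have : gen R (front hp fun i => (v i).1) = 0 :=
      gen_of_eq (j := ⟨l, hli⟩) (congrArg Prod.fst hl)
    rw [awTerm, this, zero_tmul]
  · have : gen R (back hp fun i => (v i).2) = 0 := by
      refine gen_of_eq (j := ⟨l - i, by omega⟩) ?_
      have h1 : (⟨i + (l - i), by omega⟩ : Fin (k + 1)) = l.castSucc := Fin.ext (by simp; omega)
      have h2 : (⟨i + (l - i + 1), by omega⟩ : Fin (k + 1)) = l.succ := Fin.ext (by simp; omega)
      change (v ⟨i + (l - i), _⟩).2 = (v ⟨i + (l - i + 1), _⟩).2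
      rw [h1, h2, hl]
    rw [awTerm, this, tmul_zero]

variable (R G H) in
/-- The Alexander–Whitney map in degree `k`. -/
def awX (k : ℕ) : (RC R (strong G H)).X k →ₗ[R] (tensor (RC R G) (RC R H)).X k :=
  cochain fun v => ofCoord fun p => awTerm v p

theorem coord_awX {k : ℕ} {v : Fin (k + 1) → (strong G H).V} (hv : IsChain v)
    (p : TensorIndex k) : coord p (awX R G H k (gen R v)) = awTerm v p := by
  rw [awX, cochain_gen (fun v hv => tensor_ext fun p => ?_) hv, coord_ofCoord]
  rw [coord_ofCoord, awTerm_of_not_isRegular hv, map_zero]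

theorem isChain_fst {k : ℕ} {v : Fin (k + 1) → (strong G H).V} (hv : IsChain v) :
    IsChain (G := G) fun i => (v i).1 := hv.map (strongFst G H)

theorem isChain_snd {k : ℕ} {v : Fin (k + 1) → (strong G H).V} (hv : IsChain v) :
    IsChain (G := H) fun i => (v i).2 := hv.map (strongSnd G H)

theorem isChain_front {i j k : ℕ} (h : i + j = k) {v : Fin (k + 1) → G.V} (hv : IsChain v) :
    IsChain (front h v) := fun l => hv ⟨l, by omega⟩

theorem isChain_back {i j k : ℕ} (h : i + j = k) {v : Fin (k + 1) → G.V} (hv : IsChain v) :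
    IsChain (back h v) := fun l => hv ⟨i + l, by omega⟩

/-- The Alexander–Whitney map commutes with the differentials. Faces omitting an entry up to the
splitting position give the boundary of the front part, the others that of the back part. -/
theorem awX_bd (k : ℕ) (c : (RC R (strong G H)).X (k + 1)) :
    awX R G H k ((RC R (strong G H)).bd k c) =
      (tensor (RC R G) (RC R H)).bd k (awX R G H (k + 1) c) := by
  refine LinearMap.congr_fun (f := awX R G H k ∘ₗ (RC R (strong G H)).bd k)
    (g := (tensor (RC R G) (RC R H)).bd k ∘ₗ awX R G H (k + 1))
    (RC_hom_ext fun v _ hv => tensor_ext fun ⟨⟨i, j⟩, h⟩ => ?_) c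
  dsimp only at h
  rw [LinearMap.comp_apply, LinearMap.comp_apply, bd_gen hv, coord_bd, coord_awX hv, coord_awX hv,
    map_sum, map_sum]
  simp only [map_smul, coord_awX (hv.face _)]
  set x : Fin (k + 2) → G.V := fun i => (v i).1
  set y : Fin (k + 2) → H.V := fun i => (v i).2
  have hl : (RC R G).bd i (gen R (front (i := i + 1) (j := j) (by omega) x)) = _ :=
    bd_gen (isChain_front _ (isChain_fst hv))
  have hr : (RC R H).bd j (gen R (back (i := i) (j := j + 1) (by omega) y)) = _ :=
    bd_gen (isChain_back _ (isChain_snd hv))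
  change _ = (RC R G).bd i (gen R (front (i := i + 1) (j := j) (by omega) x)) ⊗ₜ[R]
      gen R (back (i := i + 1) (j := j) (by omega) y) + (-1 : R) ^ i •
      gen R (front (i := i) (j := j + 1) (by omega) x) ⊗ₜ[R]
        (RC R H).bd j (gen R (back (i := i) (j := j + 1) (by omega) y))
  rw [hl, hr, sum_tmul, tmul_sum, Fin.sum_univ_castSucc (n := i + 1),
    Fin.sum_univ_succ (n := j + 1)]
  let e : Fin (i + 1) ⊕ Fin (j + 1) ≃ Fin (k + 2) :=
    finSumFinEquiv.trans (finCongr (by omega))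
  rw [← e.sum_comp, Fintype.sum_sum_type]
  have front_face : ∀ l : Fin (i + 1), awTerm (R := R) (G := G) (H := H)
      (fun t => v ((e (.inl l)).succAbove t)) ⟨(i, j), h⟩ =
      gen R (fun t => front (i := i + 1) (j := j) (by omega) x (l.castSucc.succAbove t)) ⊗ₜ
        gen R (back (i := i + 1) (j := j) (by omega) y) := by
    intro l
    have hl := l.2
    refine congrArg₂ (fun a b => gen R a ⊗ₜ gen R b) (funext fun t => congrArg x (Fin.ext ?_))
      (funext fun t => congrArg y (Fin.ext ?_)) <;>
    · simp only [e, Fin.succAbove, Fin.lt_def]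
      split_ifs <;> simp_all <;> omega
  have back_face : ∀ m : Fin (j + 1), awTerm (R := R) (G := G) (H := H)
      (fun t => v ((e (.inr m)).succAbove t)) ⟨(i, j), h⟩ =
      gen R (front (i := i) (j := j + 1) (by omega) x) ⊗ₜ
        gen R (fun t => back (i := i) (j := j + 1) (by omega) y (m.succ.succAbove t)) := by
    intro m
    have hm := m.2
    refine congrArg₂ (fun a b => gen R a ⊗ₜ gen R b) (funext fun t => congrArg x (Fin.ext ?_))
      (funext fun t => congrArg y (Fin.ext ?_)) <;>
    · simp only [e, Fin.succAbove, Fin.lt_def]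
      split_ifs <;> simp_all <;> omega
  -- The last face of the front part and the first face of the back part cancel.
  have last_face : (fun t => front (i := i + 1) (j := j) (by omega) x
      ((Fin.last (i + 1)).succAbove t)) = front (i := i) (j := j + 1) (by omega) x :=
    funext fun t => congrArg x (Fin.ext (by simp))
  have first_face : (fun t => back (i := i) (j := j + 1) (by omega) y
      ((0 : Fin (j + 2)).succAbove t)) = back (i := i + 1) (j := j) (by omega) y :=
    funext fun t => congrArg y (Fin.ext (by simp; omega))
  simp only [front_face, back_face, last_face, first_face]
  have he₁ : ∀ l, (e (.inl l) : ℕ) = l := fun l => rfl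
  have he₂ : ∀ m, (e (.inr m) : ℕ) = i + 1 + m := fun m => rfl
  simp only [he₁, he₂, Fin.val_castSucc, Fin.val_succ, Fin.val_last, Fin.val_zero, pow_zero,
    one_smul, smul_add, Finset.smul_sum, ← smul_tmul', tmul_smul, smul_smul, pow_succ, pow_add,
    mul_neg, mul_one, neg_mul]
  module

variable (R G H) in
/-- The Alexander–Whitney map. -/
def aw : RC R (strong G H) ⟶ tensor (RC R G) (RC R H) :=
  ChainComplex.ofHom (fun k => ModuleCat.ofHom (awX R G H k)) fun k => by
    ext c
    exact (awX_bd k c).symm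

theorem coord_aw {k : ℕ} {v : Fin (k + 1) → (strong G H).V} (hv : IsChain v)
    (p : TensorIndex k) : coord p (((aw R G H).f k).hom (gen R v)) = awTerm v p := coord_awX hv p

theorem aw_naturality {G' H' : DirGraph.{u}} (f : G ⟶ G') (g : H ⟶ H') :
    (reachabilityComplex R).map (strongProduct.map (X := (G, H)) (Y := (G', H')) (f, g)) ≫
        aw R G' H' =
      aw R G H ≫ tensorMap ((reachabilityComplex R).map f) ((reachabilityComplex R).map g) := by
  ext k : 1
  refine ModuleCat.hom_ext (RC_hom_ext fun v _ hv => tensor_ext fun p => ?_)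
  refine (congrArg (fun c => coord p (((aw R G' H').f k).hom c)) (map_gen _ hv)).trans ?_
  refine (coord_aw (hv.map (strongProduct.map (X := (G, H)) (Y := (G', H')) (f, g))) p).trans ?_
  refine Eq.trans ?_ (coord_tensorMap _ _ (((aw R G H).f k).hom (gen R v)) p).symm
  rw [coord_aw hv]
  exact congrArg₂ (· ⊗ₜ[R] ·) (map_gen f (isChain_front p.2 (isChain_fst hv))).symm
    (map_gen g (isChain_back p.2 (isChain_snd hv))).symm

end DirGraph

namespace ChainComplex

/-! ### Mapping cones -/

section Cone

variable {R : Type u} [CommRing R] {K L : ChainComplex (ModuleCat.{u} R) ℕ}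

variable (K L) in
/-- The modules of the mapping cone of a chain map `K ⟶ L`. -/
def ConeX : ℕ → Type u
  | 0 => L.X 0
  | k + 1 => K.X k × L.X (k + 1)

instance : ∀ k, AddCommGroup (ConeX K L k)
  | 0 => inferInstanceAs (AddCommGroup (L.X 0))
  | k + 1 => inferInstanceAs (AddCommGroup (K.X k × L.X (k + 1)))

instance : ∀ k, Module R (ConeX K L k)
  | 0 => inferInstanceAs (Module R (L.X 0))
  | k + 1 => inferInstanceAs (Module R (K.X k × L.X (k + 1)))

/-- The differential of the mapping cone: `(c, t) ↦ (-∂c, f c + ∂t)`. -/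
def coneD (f : K ⟶ L) : ∀ k, ConeX K L (k + 1) →ₗ[R] ConeX K L k
  | 0 => (f.f 0).hom.coprod (L.bd 0)
  | k + 1 => (-(K.bd k) ∘ₗ LinearMap.fst R _ _).prod ((f.f (k + 1)).hom.coprod (L.bd (k + 1)))

theorem coneD_zero (f : K ⟶ L) (c : K.X 0) (t : L.X 1) :
    coneD f 0 ((c, t) : K.X 0 × L.X 1) = (f.f 0).hom c + L.bd 0 t := rfl

theorem coneD_succ (f : K ⟶ L) (k : ℕ) (c : K.X (k + 1)) (t : L.X (k + 2)) :
    coneD f (k + 1) ((c, t) : K.X (k + 1) × L.X (k + 2)) =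
      ((-K.bd k c, (f.f (k + 1)).hom c + L.bd (k + 1) t) : K.X k × L.X (k + 1)) := rfl

theorem coneD_coneD (f : K ⟶ L) (k : ℕ) (x : ConeX K L (k + 2)) :
    coneD f k (coneD f (k + 1) x) = 0 := by
  obtain ⟨c, t⟩ := x
  rw [coneD_succ]
  cases k with
  | zero =>
    rw [coneD_zero, map_neg, map_bd, map_add, bd_bd, add_zero]
    exact neg_add_cancel _
  | succ k =>
    rw [coneD_succ, map_neg, map_neg, bd_bd, map_bd, map_add, bd_bd, add_zero, neg_zero, neg_zero,
      neg_add_cancel]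
    rfl

/-- A chain map with acyclic mapping cone is a quasi-isomorphism. -/
theorem quasiIsoAt_of_cone (f : K ⟶ L) (h₀ : ∀ z, ∃ y, coneD f 0 y = z)
    (h : ∀ k z, coneD f k z = 0 → ∃ y, coneD f (k + 1) y = z) (k : ℕ) : QuasiIsoAt f k := by
  refine quasiIsoAt_of_cycles f k ?_ ?_
  · rintro z hz ⟨w, hw⟩
    have key : coneD f k ((z, -w) : K.X k × L.X (k + 1)) = 0 := by
      cases k with
      | zero => rw [coneD_zero, map_neg, hw]; exact add_neg_cancel _
      | succ k => rw [coneD_succ, map_neg, hw, mem_cyc_succ.1 hz, neg_zero, add_neg_cancel]; rfl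
    obtain ⟨⟨c, t⟩, hy⟩ := h k _ key
    rw [coneD_succ] at hy
    refine ⟨-c, ?_⟩
    rw [map_neg]
    exact congrArg Prod.fst hy
  · intro z hz
    cases k with
    | zero =>
      obtain ⟨⟨c, t⟩, hy⟩ := h₀ z
      refine ⟨c, mem_cyc_zero c, t, ?_⟩
      rw [← hy, coneD_zero, add_sub_cancel_left]
    | succ k =>
      have key : coneD f k ((0, z) : K.X k × L.X (k + 1)) = 0 := by
        cases k with
        | zero => rw [coneD_zero, mem_cyc_succ.1 hz, map_zero, add_zero]; rfl
        | succ k =>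
          rw [coneD_succ, mem_cyc_succ.1 hz, map_zero, map_zero, add_zero, neg_zero]; rfl
      obtain ⟨⟨c, t⟩, hy⟩ := h k _ key
      rw [coneD_succ] at hy
      refine ⟨c, mem_cyc_succ.2 (neg_eq_zero.1 (congrArg Prod.fst hy)), t, ?_⟩
      rw [← show _ = z from congrArg Prod.snd hy, add_sub_cancel_left]

end Cone

end ChainComplex

namespace DirGraph

open ChainComplex TensorProduct

variable {R : Type u} [CommRing R] {G H : DirGraph.{u}}

/-! ### The Alexander–Whitney map is a quasi-isomorphism -/

theorem upset_le {x x' : G.V} (h : G.Reachable x x') (k : ℕ) : upset R x' k ≤ upset R x k :=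
  fun _ hc => map_upset_le (f := LinearMap.id)
    (fun _ hv h' => gen_mem_upset hv (h.trans h')) hc

variable (R) in
/-- The part of `RC_i(G) ⊗ RC_j(H)` spanned by the tuples of vertices reachable from `x`, resp.
`y`. -/
def upsetTensor (x : G.V) (y : H.V) (i j : ℕ) : Submodule R ((RC R G).X i ⊗[R] (RC R H).X j) :=
  Submodule.map₂ (TensorProduct.mk R _ _) (upset R x i) (upset R y j)

theorem tmul_mem_upsetTensor {x : G.V} {y : H.V} {i j : ℕ} {a : (RC R G).X i} {b : (RC R H).X j}
    (ha : a ∈ upset R x i) (hb : b ∈ upset R y j) : a ⊗ₜ b ∈ upsetTensor R x y i j :=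
  Submodule.apply_mem_map₂ _ ha hb

theorem map_upsetTensor_le {x : G.V} {y : H.V} {i j : ℕ} {N : Type*} [AddCommGroup N] [Module R N]
    {f : (RC R G).X i ⊗[R] (RC R H).X j →ₗ[R] N} {P : Submodule R N}
    (h : ∀ a ∈ upset R x i, ∀ b ∈ upset R y j, f (a ⊗ₜ b) ∈ P)
    {t : (RC R G).X i ⊗[R] (RC R H).X j} (ht : t ∈ upsetTensor R x y i j) : f t ∈ P :=
  (Submodule.map₂_le (r := P.comap f)).2 h ht

theorem eqOn_upsetTensor {x : G.V} {y : H.V} {i j : ℕ} {N : Type*} [AddCommGroup N] [Module R N]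
    {f g : (RC R G).X i ⊗[R] (RC R H).X j →ₗ[R] N}
    (h : ∀ a ∈ upset R x i, ∀ b ∈ upset R y j, f (a ⊗ₜ b) = g (a ⊗ₜ b))
    {t : (RC R G).X i ⊗[R] (RC R H).X j} (ht : t ∈ upsetTensor R x y i j) : f t = g t :=
  sub_eq_zero.1 <| (Submodule.mem_bot R).1 <| map_upsetTensor_le (f := f - g) (P := ⊥)
    (fun a ha b hb => (Submodule.mem_bot R).2 (sub_eq_zero.2 (h a ha b hb))) ht

variable (R) in
/-- The subcomplex of the tensor product spanned by the vertices reachable from `x`, resp. `y`. -/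
def tensorUpset (x : G.V) (y : H.V) (k : ℕ) : Submodule R ((tensor (RC R G) (RC R H)).X k) where
  carrier := {t | ∀ p, coord p t ∈ upsetTensor R x y p.1.1 p.1.2}
  add_mem' h h' p := by rw [map_add]; exact add_mem (h p) (h' p)
  zero_mem' p := by rw [map_zero]; exact zero_mem _
  smul_mem' r t h p := by rw [map_smul]; exact Submodule.smul_mem _ r (h p)

theorem tensorUpset_le {x x' : G.V} {y y' : H.V} (hx : G.Reachable x x') (hy : H.Reachable y y')
    (k : ℕ) : tensorUpset R x' y' k ≤ tensorUpset R x y k := by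
  intro t ht p
  exact Submodule.map₂_le_map₂ (upset_le hx _) (upset_le hy _) (ht p)

theorem bd_mem_tensorUpset {x : G.V} {y : H.V} {k : ℕ}
    {t : (tensor (RC R G) (RC R H)).X (k + 1)} (ht : t ∈ tensorUpset R x y (k + 1)) :
    (tensor (RC R G) (RC R H)).bd k t ∈ tensorUpset R x y k := by
  rintro ⟨⟨i, j⟩, h⟩
  dsimp only at h
  rw [coord_bd]
  refine add_mem (map_upsetTensor_le (P := upsetTensor R x y i j) (fun a ha b hb => ?_)
      (ht ⟨(i + 1, j), by omega⟩))
    (Submodule.smul_mem _ _ (map_upsetTensor_le (P := upsetTensor R x y i j)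
      (fun a ha b hb => ?_) (ht ⟨(i, j + 1), by omega⟩)))
  · exact tmul_mem_upsetTensor (bd_mem_upset ha) hb
  · exact tmul_mem_upsetTensor ha (bd_mem_upset hb)

theorem aw_mem_tensorUpset {x : G.V} {y : H.V} {k : ℕ} {c : (RC R (strong G H)).X k}
    (hc : c ∈ upset R (G := strong G H) (x, y) k) :
    ((aw R G H).f k).hom c ∈ tensorUpset R x y k := by
  refine map_upset_le (f := ((aw R G H).f k).hom) (fun v hv h => fun p => ?_) hc
  rw [coord_aw hv]
  have h' := strong_reachable_iff.1 h
  exact tmul_mem_upsetTensor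
    (gen_mem_upset (isChain_front p.2 (isChain_fst hv)) h'.1)
    (gen_mem_upset (isChain_back p.2 (isChain_snd hv))
      (h'.2.trans ((isChain_snd hv).reachable (Fin.zero_le _))))

/-- The projection of the chains in degree `0` onto the span of a vertex `x` given by the
augmentation. -/
def toVertex (x : G.V) : (RC R G).X 0 →ₗ[R] (RC R G).X 0 :=
  (augmentation R G).smulRight (gen R fun _ => x)

theorem toVertex_bd (x : G.V) (c : (RC R G).X 1) :
    toVertex x ((RC R G).bd 0 c) = (0 : (RC R G).X 0) := by
  rw [toVertex, LinearMap.smulRight_apply, augmentation_bd, zero_smul]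

theorem toVertex_mem_upset (x : G.V) (c : (RC R G).X 0) : toVertex x c ∈ upset R x 0 := by
  rw [toVertex, LinearMap.smulRight_apply]
  exact Submodule.smul_mem _ _ (gen_mem_upset (fun j => j.elim0) (Reachable.refl x))

/-- The contraction of `tensorUpset R x y`: the contraction `P ⊗ 1 + xε ⊗ P` of a tensor product,
where `P` prepends a vertex and `xε` is the projection onto the vertex `x`. -/
def tensorContraction (x : G.V) (y : H.V) {k : ℕ} (t : (tensor (RC R G) (RC R H)).X k) :
    (tensor (RC R G) (RC R H)).X (k + 1) :=
  ofCoord fun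
    | ⟨(0, 0), _⟩ => 0
    | ⟨(0, j + 1), h⟩ =>
      TensorProduct.map (toVertex x) (prepend R y j) (coord ⟨(0, j), by dsimp only at h; omega⟩ t)
    | ⟨(i + 1, j), h⟩ =>
      (prepend R x i).rTensor _ (coord ⟨(i, j), by dsimp only at h; omega⟩ t)

theorem coord_tensorContraction_succ (x : G.V) (y : H.V) {k : ℕ}
    (t : (tensor (RC R G) (RC R H)).X k) (i j : ℕ) (h : i + j = k) :
    coord ⟨(i + 1, j), by omega⟩ (tensorContraction x y t) =
      (prepend R x i).rTensor _ (coord ⟨(i, j), h⟩ t) := rfl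

theorem coord_tensorContraction_zero (x : G.V) (y : H.V) {k : ℕ}
    (t : (tensor (RC R G) (RC R H)).X k) (j : ℕ) (h : 0 + j = k) :
    coord ⟨(0, j + 1), by omega⟩ (tensorContraction x y t) =
      TensorProduct.map (toVertex x) (prepend R y j) (coord ⟨(0, j), h⟩ t) := rfl

theorem tensorContraction_mem {x : G.V} {y : H.V} {k : ℕ} {t : (tensor (RC R G) (RC R H)).X k}
    (ht : t ∈ tensorUpset R x y k) : tensorContraction x y t ∈ tensorUpset R x y (k + 1) := by
  rintro ⟨⟨_ | i, j⟩, h⟩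
  · obtain rfl : j = k + 1 := by simpa using h
    exact map_upsetTensor_le (f := TensorProduct.map (toVertex x) (prepend R y k))
      (P := upsetTensor R x y 0 (k + 1))
      (fun a _ b hb => tmul_mem_upsetTensor (toVertex_mem_upset x a) (prepend_mem_upset hb))
      (ht ⟨(0, k), by omega⟩)
  · exact map_upsetTensor_le (f := (prepend R x i).rTensor ((RC R H).X j))
      (P := upsetTensor R x y (i + 1) j)
      (fun a ha b hb => tmul_mem_upsetTensor (prepend_mem_upset ha) hb)
      (ht ⟨(i, j), by dsimp only at h; omega⟩)

/-- A cycle of positive degree in `tensorUpset R x y` is the boundary of its contraction. -/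
theorem bd_tensorContraction {x : G.V} {y : H.V} {k : ℕ}
    {t : (tensor (RC R G) (RC R H)).X (k + 1)} (ht : t ∈ tensorUpset R x y (k + 1))
    (hd : (tensor (RC R G) (RC R H)).bd k t = 0) :
    (tensor (RC R G) (RC R H)).bd (k + 1) (tensorContraction x y t) = t := by
  refine tensor_ext fun ⟨⟨i, j⟩, h⟩ => ?_
  dsimp only at h
  rw [coord_bd]
  rcases i with _ | i
  · obtain rfl : j = k + 1 := by omega
    have h0 := congrArg (fun s => TensorProduct.map (toVertex x) (prepend R y k)
      (coord ⟨(0, k), by omega⟩ s)) hd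
    dsimp only at h0
    rw [coord_bd, map_zero, map_zero, pow_zero, one_smul, map_add] at h0
    have h1 : TensorProduct.map (toVertex x) (prepend R y k)
        (((RC R G).bd 0).rTensor _ (coord ⟨(1, k), by omega⟩ t)) = 0 := by
      rw [LinearMap.rTensor, TensorProduct.map_map, show toVertex x ∘ₗ (RC R G).bd 0 = 0 from
        LinearMap.ext (toVertex_bd x), TensorProduct.map_zero_left, LinearMap.zero_apply]
    rw [h1, zero_add] at h0
    rw [coord_tensorContraction_succ x y t 0 (k + 1) (by omega),
      coord_tensorContraction_zero x y t (k + 1) (by omega), pow_zero, one_smul]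
    refine Eq.trans ?_ (sub_zero _)
    rw [← h0]
    refine eqOn_upsetTensor (x := x) (y := y)
      (f := ((RC R G).bd 0).rTensor _ ∘ₗ (prepend R x 0).rTensor _ +
        ((RC R H).bd (k + 1)).lTensor _ ∘ₗ TensorProduct.map (toVertex x) (prepend R y (k + 1)))
      (g := LinearMap.id - TensorProduct.map (toVertex x) (prepend R y k) ∘ₗ
        ((RC R H).bd k).lTensor _) (fun a ha b hb => ?_) (ht ⟨(0, k + 1), h⟩)
    simp only [LinearMap.add_apply, LinearMap.comp_apply, LinearMap.rTensor_tmul, map_tmul,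
      LinearMap.lTensor_tmul, LinearMap.sub_apply, LinearMap.id_apply]
    rw [bd_prepend_zero ha, bd_prepend_succ hb, toVertex, LinearMap.smulRight_apply, sub_tmul,
      tmul_sub]
    abel
  · have h0 := congrArg (fun s => (prepend R x i).rTensor _
      (coord ⟨(i, j), by omega⟩ s)) hd
    dsimp only at h0
    rw [coord_bd, map_zero, map_zero, map_add, map_smul] at h0
    rw [coord_tensorContraction_succ x y t (i + 1) j (by omega),
      coord_tensorContraction_succ x y t i (j + 1) (by omega), pow_succ, mul_neg_one, neg_smul,
      ← sub_eq_add_neg]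
    have h1 : ((RC R H).bd j).lTensor _ ((prepend R x i).rTensor _
        (coord ⟨(i, j + 1), by omega⟩ t)) = (prepend R x i).rTensor _
          (((RC R H).bd j).lTensor _ (coord ⟨(i, j + 1), by omega⟩ t)) := by
      rw [LinearMap.lTensor, LinearMap.rTensor, LinearMap.rTensor, LinearMap.lTensor,
        TensorProduct.map_map, TensorProduct.map_map]
      rfl
    rw [h1, sub_eq_of_eq_add]
    refine Eq.trans ?_ (congrArg (coord ⟨(i + 1, j), h⟩ t + ·) (neg_eq_of_add_eq_zero_right h0))
    rw [← sub_eq_add_neg]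
    exact eqOn_upsetTensor (x := x) (y := y)
      (f := ((RC R G).bd (i + 1)).rTensor _ ∘ₗ (prepend R x (i + 1)).rTensor _)
      (g := LinearMap.id - (prepend R x i).rTensor _ ∘ₗ ((RC R G).bd i).rTensor _)
      (fun a ha b hb => by
        simp only [LinearMap.comp_apply, LinearMap.rTensor_tmul, LinearMap.sub_apply,
          LinearMap.id_apply]
        rw [bd_prepend_succ ha, sub_tmul]) (ht ⟨(i + 1, j), h⟩)

/-- In degree `0` an element of `tensorUpset R x y` is the boundary of its contraction plus its
projection onto the vertex `(x, y)`. -/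
theorem bd_tensorContraction_zero {x : G.V} {y : H.V}
    {t : (tensor (RC R G) (RC R H)).X 0} (ht : t ∈ tensorUpset R x y 0) :
    (tensor (RC R G) (RC R H)).bd 0 (tensorContraction x y t) +
      incl ⟨(0, 0), rfl⟩ (TensorProduct.map (toVertex x) (toVertex y)
        (coord ⟨(0, 0), rfl⟩ t)) = t := by
  refine tensor_ext fun ⟨⟨i, j⟩, h⟩ => ?_
  obtain ⟨rfl, rfl⟩ : i = 0 ∧ j = 0 := by dsimp only at h; omega
  rw [map_add, coord_incl_same, coord_bd, coord_tensorContraction_succ x y t 0 0 rfl,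
    coord_tensorContraction_zero x y t 0 rfl, pow_zero, one_smul]
  refine eqOn_upsetTensor (x := x) (y := y)
      (f := ((RC R G).bd 0).rTensor _ ∘ₗ (prepend R x 0).rTensor _ +
        ((RC R H).bd 0).lTensor _ ∘ₗ TensorProduct.map (toVertex x) (prepend R y 0) +
        TensorProduct.map (toVertex x) (toVertex y))
      (g := LinearMap.id) (fun a ha b hb => ?_) (ht ⟨(0, 0), h⟩)
  simp only [LinearMap.add_apply, LinearMap.comp_apply, LinearMap.rTensor_tmul, map_tmul,
      LinearMap.lTensor_tmul, LinearMap.id_apply]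
  rw [bd_prepend_zero ha, bd_prepend_zero hb, toVertex, toVertex, LinearMap.smulRight_apply,
    LinearMap.smulRight_apply, sub_tmul, tmul_sub]
  abel

variable (R G H) in
/-- The basis of the tensor product of two reachability complexes given by pairs of generators. -/
def tensorBasis (k : ℕ) : Module.Basis (Σ p : TensorIndex k, G.Gen p.1.1 × H.Gen p.1.2) R
    ((tensor (RC R G) (RC R H)).X k) :=
  (Pi.basis fun p : TensorIndex k => (genBasis R G p.1.1).tensorProduct (genBasis R H p.1.2) :
    Module.Basis _ R (TensorX (RC R G) (RC R H) k))

theorem tensorBasis_apply {k : ℕ} (p : TensorIndex k) (v : G.Gen p.1.1) (w : H.Gen p.1.2) :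
    tensorBasis R G H k ⟨p, (v, w)⟩ = incl p (gen R v.1 ⊗ₜ gen R w.1) := by
  refine (Pi.basis_apply (fun p : TensorIndex k =>
    (genBasis R G p.1.1).tensorProduct (genBasis R H p.1.2)) ⟨p, (v, w)⟩).trans ?_
  rw [Module.Basis.tensorProduct_apply, genBasis_apply, genBasis_apply]
  rfl

theorem incl_mem_tensorUpset {x : G.V} {y : H.V} {k : ℕ} (p : TensorIndex k)
    {t : (RC R G).X p.1.1 ⊗[R] (RC R H).X p.1.2} (ht : t ∈ upsetTensor R x y p.1.1 p.1.2) :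
    incl p t ∈ tensorUpset R x y k := by
  intro q
  by_cases h : q = p
  · subst h
    rwa [coord_incl_same]
  · rw [coord_incl_ne h]
    exact zero_mem _

theorem upset_le_span (x : G.V) (k : ℕ) :
    upset R x k ≤ Submodule.span R (genBasis R G k '' {v | G.Reachable x (v.1 0)}) := by
  refine fun c hc => map_upset_le (f := LinearMap.id) (fun v hv h => ?_) hc
  by_cases hr : IsRegular v
  · exact Submodule.subset_span ⟨⟨v, hr, hv⟩, h, genBasis_apply _⟩
  · rw [gen_of_not_isRegular hr, map_zero]
    exact zero_mem _

theorem tensorUpset_le_span (x : G.V) (y : H.V) (k : ℕ) :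
    tensorUpset R x y k ≤ Submodule.span R (tensorBasis R G H k ''
      {i | G.Reachable x (i.2.1.1 0) ∧ H.Reachable y (i.2.2.1 0)}) := by
  intro t ht
  rw [← sum_incl_coord t]
  refine Submodule.sum_mem _ fun p _ => map_upsetTensor_le (f := incl p) (x := x) (y := y)
    (fun a ha b hb => ?_) (ht p)
  have h₁ := (upset_le_span x p.1.1).trans ((Submodule.span_le
    (p := (Submodule.span R (tensorBasis R G H k ''
      {i | G.Reachable x (i.2.1.1 0) ∧ H.Reachable y (i.2.2.1 0)})).comap
        (incl p ∘ₗ (TensorProduct.mk R _ _).flip b))).2 ?_) ha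
  · exact h₁
  rintro _ ⟨v, hv, rfl⟩
  have h₂ := (upset_le_span y p.1.2).trans ((Submodule.span_le
    (p := (Submodule.span R (tensorBasis R G H k ''
      {i | G.Reachable x (i.2.1.1 0) ∧ H.Reachable y (i.2.2.1 0)})).comap
        (incl p ∘ₗ TensorProduct.mk R _ _ (genBasis R G p.1.1 v)))).2 ?_) hb
  · exact h₂
  rintro _ ⟨w, hw, rfl⟩
  refine Submodule.subset_span ⟨⟨p, (v, w)⟩, ⟨hv, hw⟩, ?_⟩
  rw [tensorBasis_apply, genBasis_apply, genBasis_apply]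
  rfl

variable (R) in
/-- The carriers of the basis elements of the mapping cone of the Alexander–Whitney map. -/
def coneCarrier (σ : G.V × H.V) :
    ∀ k, Submodule R (ConeX (RC R (strong G H)) (tensor (RC R G) (RC R H)) k)
  | 0 => tensorUpset R σ.1 σ.2 0
  | k + 1 => (upset R (G := strong G H) σ k).prod (tensorUpset R σ.1 σ.2 (k + 1))

theorem coneCarrier_le {σ τ : G.V × H.V} (h : (strong G H).Reachable σ τ) (k : ℕ) :
    coneCarrier R τ k ≤ coneCarrier R σ k := by
  have h' := strong_reachable_iff.1 h
  cases k with
  | zero => exact tensorUpset_le h'.1 h'.2 0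
  | succ k => exact Submodule.prod_mono (upset_le h k) (tensorUpset_le h'.1 h'.2 (k + 1))

variable (G H) in
/-- The index set of the basis of the mapping cone. -/
def ConeIndex : ℕ → Type u
  | 0 => Σ p : TensorIndex 0, G.Gen p.1.1 × H.Gen p.1.2
  | k + 1 => (strong G H).Gen k ⊕ (Σ p : TensorIndex (k + 1), G.Gen p.1.1 × H.Gen p.1.2)

variable (R G H) in
/-- The basis of the mapping cone. -/
def coneBasis : ∀ k, Module.Basis (ConeIndex G H k) R
    (ConeX (RC R (strong G H)) (tensor (RC R G) (RC R H)) k)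
  | 0 => tensorBasis R G H 0
  | k + 1 => (genBasis R (strong G H) k).prod (tensorBasis R G H (k + 1))

/-- The pair of initial vertices of a basis element of the mapping cone. -/
def initial : ∀ k, ConeIndex G H k → G.V × H.V
  | 0, ⟨_, (v, w)⟩ => (v.1 0, w.1 0)
  | _ + 1, .inl v => v.1 0
  | _ + 1, .inr ⟨_, (v, w)⟩ => (v.1 0, w.1 0)

theorem tensorBasis_mem {k : ℕ} (p : TensorIndex k) (v : G.Gen p.1.1) (w : H.Gen p.1.2) :
    tensorBasis R G H k ⟨p, (v, w)⟩ ∈ tensorUpset R (v.1 0) (w.1 0) k := by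
  rw [tensorBasis_apply]
  exact incl_mem_tensorUpset p (tmul_mem_upsetTensor (gen_mem_upset v.2.2 (Reachable.refl _))
    (gen_mem_upset w.2.2 (Reachable.refl _)))

theorem coneCarrier_le_span (σ : G.V × H.V) (k : ℕ) :
    coneCarrier R σ k ≤ Submodule.span R (coneBasis R G H k ''
      {i | ∀ l, coneCarrier R (initial k i) l ≤ coneCarrier R σ l}) := by
  have h : ∀ {k} {i}, (strong G H).Reachable σ (initial k i) →
      ∀ l, coneCarrier R (initial k i) l ≤ coneCarrier R σ l := fun h => coneCarrier_le h
  obtain ⟨x, y⟩ := σ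
  cases k with
  | zero =>
    refine (tensorUpset_le_span x y 0).trans (Submodule.span_mono ?_)
    rintro _ ⟨i, hi, rfl⟩
    exact ⟨i, h (k := 0) (strong_reachable_iff.2 hi), rfl⟩
  | succ k =>
    rintro ⟨c, t⟩ ⟨hc, ht⟩
    have h₁ := Submodule.mem_map_of_mem
      (f := LinearMap.inl R _ ((tensor (RC R G) (RC R H)).X (k + 1)))
      (upset_le_span (G := strong G H) (x, y) k hc)
    have h₂ := Submodule.mem_map_of_mem
      (f := LinearMap.inr R ((RC R (strong G H)).X k) _) (tensorUpset_le_span x y (k + 1) ht)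
    rw [Submodule.map_span] at h₁ h₂
    have h₃ : ((c, t) : (RC R (strong G H)).X k × (tensor (RC R G) (RC R H)).X (k + 1)) =
        LinearMap.inl R _ _ c + LinearMap.inr R _ _ t := by simp
    refine h₃ ▸ add_mem (Submodule.span_mono ?_ h₁) (Submodule.span_mono ?_ h₂)
    · rintro _ ⟨_, ⟨v, hv, rfl⟩, rfl⟩
      exact ⟨.inl v, h (k := k + 1) hv, Module.Basis.prod_apply _ _ _⟩
    · rintro _ ⟨_, ⟨i, hi, rfl⟩, rfl⟩
      exact ⟨.inr i, h (k := k + 1) (strong_reachable_iff.2 hi), Module.Basis.prod_apply _ _ _⟩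

theorem coneBasis_mem (k : ℕ) (i : ConeIndex G H k) :
    coneBasis R G H k i ∈ coneCarrier R (initial k i) k := by
  cases k with
  | zero => exact tensorBasis_mem i.1 i.2.1 i.2.2
  | succ k =>
    rcases i with v | ⟨p, v, w⟩
    · constructor
      · refine Eq.symm (Module.Basis.prod_apply_inl_fst (genBasis R (strong G H) k)
          (tensorBasis R G H (k + 1)) v) ▸ ?_
        rw [genBasis_apply]
        exact gen_mem_upset v.2.2 (Reachable.refl _)
      · exact Eq.symm (Module.Basis.prod_apply_inl_snd (genBasis R (strong G H) k)
          (tensorBasis R G H (k + 1)) v) ▸ zero_mem _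
    · constructor
      · exact Eq.symm (Module.Basis.prod_apply_inr_fst (genBasis R (strong G H) k)
          (tensorBasis R G H (k + 1)) ⟨p, v, w⟩) ▸ zero_mem _
      · exact Eq.symm (Module.Basis.prod_apply_inr_snd (genBasis R (strong G H) k)
          (tensorBasis R G H (k + 1)) ⟨p, v, w⟩) ▸ tensorBasis_mem p v w

variable (R G H) in
/-- The augmentation of the tensor product, the product of the two augmentations. -/
def tensorAugmentation : (tensor (RC R G) (RC R H)).X 0 →ₗ[R] R :=
  LinearMap.mul' R R ∘ₗ TensorProduct.map (augmentation R G) (augmentation R H) ∘ₗ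
    coord ⟨(0, 0), rfl⟩

theorem tensorAugmentation_bd (t : (tensor (RC R G) (RC R H)).X 1) :
    tensorAugmentation R G H ((tensor (RC R G) (RC R H)).bd 0 t) = 0 := by
  refine (congrArg (fun s => LinearMap.mul' R R (TensorProduct.map (augmentation R G)
    (augmentation R H) s)) (coord_bd t 0 0 rfl)).trans ?_
  rw [map_add, map_smul,
    LinearMap.rTensor, LinearMap.lTensor, TensorProduct.map_map, TensorProduct.map_map,
    show augmentation R G ∘ₗ (RC R G).bd 0 = 0 from LinearMap.ext augmentation_bd,
    show augmentation R H ∘ₗ (RC R H).bd 0 = 0 from LinearMap.ext augmentation_bd,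
    TensorProduct.map_zero_left, TensorProduct.map_zero_right, LinearMap.zero_apply,
    LinearMap.zero_apply, smul_zero, add_zero, map_zero]

theorem tensorAugmentation_aw (c : (RC R (strong G H)).X 0) :
    tensorAugmentation R G H (((aw R G H).f 0).hom c) = augmentation R (strong G H) c := by
  refine LinearMap.congr_fun (f := tensorAugmentation R G H ∘ₗ ((aw R G H).f 0).hom)
    (g := augmentation R (strong G H)) (RC_hom_ext fun v _ hv => ?_) c
  rw [augmentation_gen, tensorAugmentation, LinearMap.comp_apply, LinearMap.comp_apply,
    LinearMap.comp_apply, coord_aw hv, awTerm, map_tmul, augmentation_gen, augmentation_gen,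
    LinearMap.mul'_apply, one_mul]

/-- The projection onto the vertex `(x, y)` has values in the image of the Alexander–Whitney map.
-/
theorem map_toVertex (x : G.V) (y : H.V) (t : (tensor (RC R G) (RC R H)).X 0) :
    incl ⟨(0, 0), rfl⟩ (TensorProduct.map (toVertex x) (toVertex y) (coord ⟨(0, 0), rfl⟩ t)) =
      tensorAugmentation R G H t • ((aw R G H).f 0).hom (gen R fun _ => (x, y)) := by
  refine tensor_ext fun ⟨⟨i, j⟩, h⟩ => ?_
  obtain ⟨rfl, rfl⟩ : i = 0 ∧ j = 0 := by dsimp only at h; omega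
  refine (coord_incl_same _ _).trans (Eq.trans ?_ ((map_smul _ _ _).trans
    (congrArg (tensorAugmentation R G H t • ·)
    (coord_aw (R := R) (G := G) (H := H) (v := fun _ => (x, y)) (fun l => l.elim0)
      ⟨(0, 0), rfl⟩))).symm)
  refine LinearMap.congr_fun (f := TensorProduct.map (toVertex x) (toVertex y))
    (g := (LinearMap.mul' R R ∘ₗ TensorProduct.map (augmentation R G)
      (augmentation R H)).smulRight (gen R (fun _ => x) ⊗ₜ gen R fun _ => y))
    (TensorProduct.ext' fun a b => ?_) _
  rw [map_tmul, toVertex, toVertex, LinearMap.smulRight_apply, LinearMap.smulRight_apply,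
    LinearMap.smulRight_apply, smul_tmul_smul]
  rfl

/-- Exactness of a carrier: first fill the component in the product graph by prepending `(x, y)`,
then the remaining cycle of the tensor product by `tensorContraction`. -/
theorem exists_cone_preimage {x : G.V} {y : H.V} {k : ℕ} {c : (RC R (strong G H)).X k}
    (hc : c ∈ upset R (G := strong G H) (x, y) k)
    (hc' : (RC R (strong G H)).bd k (prepend R (G := strong G H) (x, y) k c) = c)
    {t : (tensor (RC R G) (RC R H)).X (k + 1)} (ht : t ∈ tensorUpset R x y (k + 1))
    (h : ((aw R G H).f k).hom c + (tensor (RC R G) (RC R H)).bd k t = 0) :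
    ∃ z ∈ coneCarrier R (x, y) (k + 2), coneD (aw R G H) (k + 1) z =
      ((c, t) : (RC R (strong G H)).X k × (tensor (RC R G) (RC R H)).X (k + 1)) := by
  set c' := prepend R (G := strong G H) (x, y) k c
  have hcm : c' ∈ upset R (G := strong G H) (x, y) (k + 1) := prepend_mem_upset hc
  set s := t + ((aw R G H).f (k + 1)).hom c'
  have hs : s ∈ tensorUpset R x y (k + 1) := add_mem ht (aw_mem_tensorUpset hcm)
  have hsd : (tensor (RC R G) (RC R H)).bd k s = 0 := by
    rw [map_add, ← map_bd, hc', add_comm, h]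
  refine ⟨((-c', tensorContraction x y s) :
    (RC R (strong G H)).X (k + 1) × (tensor (RC R G) (RC R H)).X (k + 2)),
    ⟨neg_mem hcm, tensorContraction_mem hs⟩, ?_⟩
  rw [coneD_succ, map_neg, hc', neg_neg, bd_tensorContraction hs hsd, map_neg,
    neg_add_eq_sub, add_sub_cancel_right]

/-- The mapping cone of the Alexander–Whitney map is acyclic. The carrier of a basis element
consists of the chains on the vertices reachable from its pair of initial vertices. -/
theorem cone_aw_acyclic : (∀ z, ∃ y, coneD (aw R G H) 0 y = z) ∧
    ∀ k z, coneD (aw R G H) k z = 0 → ∃ y, coneD (aw R G H) (k + 1) y = z := by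
  refine exists_preimage_of_acyclic_carriers _ (coneD (aw R G H)) (coneD_coneD _)
    (coneBasis R G H) initial (coneCarrier R) coneBasis_mem coneCarrier_le_span ?_ ?_ ?_
  · rintro ⟨x, y⟩ (_ | k) ⟨c, t⟩ ⟨hc, ht⟩
    · exact add_mem (aw_mem_tensorUpset hc) (bd_mem_tensorUpset ht)
    · exact ⟨neg_mem (bd_mem_upset hc), add_mem (aw_mem_tensorUpset hc) (bd_mem_tensorUpset ht)⟩
  · rintro ⟨x, y⟩ z hz
    have hv : IsChain (G := strong G H) (fun _ : Fin 1 => (x, y)) := fun l => l.elim0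
    refine ⟨((tensorAugmentation R G H z • gen R fun _ => (x, y), tensorContraction x y z) :
      (RC R (strong G H)).X 0 × (tensor (RC R G) (RC R H)).X 1),
      ⟨Submodule.smul_mem _ _ (gen_mem_upset hv (Reachable.refl _)), tensorContraction_mem hz⟩, ?_⟩
    refine Eq.trans ?_ (bd_tensorContraction_zero hz)
    rw [coneD_zero, map_smul, add_comm]
    exact congrArg _ (map_toVertex x y z).symm
  · rintro ⟨x, y⟩ (_ | k) ⟨c, t⟩ ⟨hc, ht⟩ hd
    · have h : ((aw R G H).f 0).hom c + (tensor (RC R G) (RC R H)).bd 0 t = 0 := hd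
      refine exists_cone_preimage hc ?_ ht h
      have h' := congrArg (tensorAugmentation R G H) h
      rw [map_add, tensorAugmentation_bd, add_zero, tensorAugmentation_aw, map_zero] at h'
      rw [bd_prepend_zero hc, h', zero_smul, sub_zero]
    · have h₁ : -(RC R (strong G H)).bd k c = 0 := congrArg Prod.fst hd
      have h₂ : ((aw R G H).f (k + 1)).hom c + (tensor (RC R G) (RC R H)).bd (k + 1) t = 0 :=
        congrArg Prod.snd hd
      refine exists_cone_preimage hc ?_ ht h₂
      rw [bd_prepend_succ hc, neg_eq_zero.1 h₁, map_zero, sub_zero]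

variable (R G H) in
/-- The Eilenberg–Zilber theorem for the reachability complex. -/
theorem quasiIso_aw (k : ℕ) : QuasiIsoAt (aw R G H) k :=
  quasiIsoAt_of_cone _ cone_aw_acyclic.1 cone_aw_acyclic.2 k

end DirGraph

namespace ChainComplex

open TensorProduct DirGraph

variable {R : Type u} [CommRing R] [IsDomain R] [IsPrincipalIdealRing R]
variable {K L K' L' : ChainComplex (ModuleCat.{u} R) ℕ} [∀ i, Module.Free R (K.X i)]
  [∀ i, Module.Free R (L.X i)]

/-! ### The Künneth sequence of two complexes -/

variable (L) in
/-- The cycles are a direct summand, so tensoring their inclusion with any module keeps it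
injective. -/
theorem lTensor_cyc_subtype_injective (M : Type*) [AddCommGroup M] [Module R M] (j : ℕ) :
    Function.Injective ((L.cyc j).subtype.lTensor M) := by
  have := Submodule.free_of_isPrincipalIdealRing (LinearMap.range (L.d j (j - 1)).hom)
  obtain ⟨r, hr⟩ : ∃ r : L.X j →ₗ[R] L.cyc j, ∀ x : L.cyc j, r x.1 = x :=
    exists_ker_retraction (L.d j (j - 1)).hom
  refine Function.LeftInverse.injective (g := r.lTensor M) fun x => ?_
  rw [← LinearMap.comp_apply, ← LinearMap.lTensor_comp,
    show r ∘ₗ (L.cyc j).subtype = LinearMap.id from LinearMap.ext hr, LinearMap.lTensor_id,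
    LinearMap.id_apply]

/-- The values of `torMap` lie in the kernel of `H_i ⊗ B_j → H_i ⊗ Z_j`, which is `Tor₁(H_i, H_j)`.
-/
theorem lTensor_torMap {k : ℕ} (p : TorIndex k) (h : (tensor K L).homology k) :
    (L.bdrToCyc p.1.2).lTensor _ (torMap p h) = 0 := by
  obtain ⟨⟨i, j⟩, rfl⟩ := p
  obtain ⟨z, rfl⟩ := cls_surjective _ _ h
  apply lTensor_cyc_subtype_injective L
  rw [map_zero, torMap_cls, LinearMap.lTensor, LinearMap.lTensor, TensorProduct.map_map,
    TensorProduct.map_map]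
  change TensorProduct.map (K.extCls i) (L.bd j) (coord ⟨(i, j + 1), _⟩ z.1) = 0
  have h' := congrArg ((K.extCls i).rTensor (L.X j)) (coord_cyc_left (i := i) (j := j) rfl z.2)
  rw [map_smul, LinearMap.rTensor, LinearMap.rTensor, LinearMap.lTensor, TensorProduct.map_map,
    TensorProduct.map_map, extCls_comp_bd, TensorProduct.map_zero_left, LinearMap.zero_apply] at h'
  have h'' := congrArg (fun t => -(-1 : R) ^ i • t) h'
  dsimp only at h''
  rw [smul_smul, neg_mul_neg, ← mul_pow, neg_mul_neg, one_mul, one_pow, one_smul, smul_zero] at h''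
  exact h''.symm

/-- The map from the homology of the tensor product to the torsion term. -/
def torLift {k : ℕ} (p : TorIndex k) : (tensor K L).homology k →ₗ[R]
    ((Tor (ModuleCat.{u} R) 1).obj (K.homology p.1.1)).obj (L.homology p.1.2) :=
  (LinearEquiv.ofInjective (torι L (K.homology p.1.1) p.1.2).hom
    (torι_injective _ _)).symm.toLinearMap ∘ₗ
    (torMap p).codRestrict (LinearMap.range (torι L (K.homology p.1.1) p.1.2).hom)
      fun h => (mem_range_torι _ _ _).2 (lTensor_torMap p h)

theorem torι_torLift {k : ℕ} (p : TorIndex k) (h : (tensor K L).homology k) :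
    (torι L (K.homology p.1.1) p.1.2).hom (torLift p h) = torMap p h := by
  have := LinearEquiv.apply_symm_apply
    (LinearEquiv.ofInjective (torι L (K.homology p.1.1) p.1.2).hom (torι_injective _ _))
    ((torMap p).codRestrict (LinearMap.range (torι L (K.homology p.1.1) p.1.2).hom)
      (fun h => (mem_range_torι _ _ _).2 (lTensor_torMap p h)) h)
  exact congrArg Subtype.val this

theorem torLift_naturality [∀ i, Module.Free R (K'.X i)] [∀ i, Module.Free R (L'.X i)]
    (f : K ⟶ K') (g : L ⟶ L') {k : ℕ} (p : TorIndex k) (h : (tensor K L).homology k) :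
    torLift p ((HomologicalComplex.homologyMap (tensorMap f g) k).hom h) =
      (((Tor (ModuleCat.{u} R) 1).map (HomologicalComplex.homologyMap f p.1.1)).app
        (L.homology p.1.2) ≫ ((Tor (ModuleCat.{u} R) 1).obj (K'.homology p.1.1)).map
          (HomologicalComplex.homologyMap g p.1.2)).hom (torLift p h) := by
  apply torι_injective (K'.homology p.1.1) p.1.2
  rw [torι_torLift, torMap_naturality, ← torι_torLift]
  exact (congrArg (fun φ => φ.hom (torLift p h))
    (torι_naturality (HomologicalComplex.homologyMap f p.1.1) g p.1.2)).symm

end ChainComplex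

namespace DirGraph

open ChainComplex TensorProduct

/-! ### Biproducts of functors to modules, elementwise -/

section Biproduct

variable {R : Type u} [CommRing R] {J : Type} [Fintype J]
  (F : J → DirGraph.{u} × DirGraph.{u} ⥤ ModuleCat.{u} R)

theorem sum_biproduct_ι_π (P : DirGraph.{u} × DirGraph.{u}) (x : (⨁ F).obj P) :
    ∑ p, ((biproduct.ι F p).app P).hom (((biproduct.π F p).app P).hom x) = x := by
  classical
  have h := congrArg (fun φ => ModuleCat.Hom.hom (NatTrans.app φ P) x) (biproduct.total (f := F))
  rw [NatTrans.app_sum, ModuleCat.hom_sum, LinearMap.sum_apply] at h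
  exact h

theorem biproduct_π_ι_same (P : DirGraph.{u} × DirGraph.{u}) (p : J) (x : (F p).obj P) :
    ((biproduct.π F p).app P).hom (((biproduct.ι F p).app P).hom x) = x :=
  congrArg (fun φ => ModuleCat.Hom.hom (NatTrans.app φ P) x) (biproduct.ι_π_self F p)

theorem biproduct_π_ι_ne (P : DirGraph.{u} × DirGraph.{u}) {p q : J} (h : p ≠ q)
    (x : (F p).obj P) : ((biproduct.π F q).app P).hom (((biproduct.ι F p).app P).hom x) = 0 :=
  congrArg (fun φ => ModuleCat.Hom.hom (NatTrans.app φ P) x) (biproduct.ι_π_ne F h)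

theorem biproduct_obj_ext {P : DirGraph.{u} × DirGraph.{u}} {x y : (⨁ F).obj P}
    (h : ∀ p, ((biproduct.π F p).app P).hom x = ((biproduct.π F p).app P).hom y) : x = y := by
  rw [← sum_biproduct_ι_π F P x, ← sum_biproduct_ι_π F P y]
  exact Finset.sum_congr rfl fun p _ => by rw [h]

end Biproduct

variable (R : Type u) [CommRing R]

/-! ### The Künneth sequence of two directed graphs -/

/-- The isomorphism on homology induced by the Alexander–Whitney map. -/
def awHomology (G H : DirGraph.{u}) (k : ℕ) :
    (RC R (strong G H)).homology k ≃ₗ[R] (tensor (RC R G) (RC R H)).homology k :=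
  have : QuasiIsoAt (aw R G H) k := quasiIso_aw R G H k
  (asIso (HomologicalComplex.homologyMap (aw R G H) k)).toLinearEquiv

theorem awHomology_naturality {G H G' H' : DirGraph.{u}} (f : G ⟶ G') (g : H ⟶ H') (k : ℕ)
    (x : (RC R (strong G H)).homology k) :
    awHomology R G' H' k ((HomologicalComplex.homologyMap ((reachabilityComplex R).map
      (strongProduct.map (X := (G, H)) (Y := (G', H')) (f, g))) k).hom x) =
    (HomologicalComplex.homologyMap (tensorMap ((reachabilityComplex R).map f)
      ((reachabilityComplex R).map g)) k).hom (awHomology R G H k x) := by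
  have h := congrArg (fun φ => ModuleCat.Hom.hom (HomologicalComplex.homologyMap φ k) x)
    (aw_naturality (R := R) f g)
  dsimp only at h
  rw [HomologicalComplex.homologyMap_comp, HomologicalComplex.homologyMap_comp] at h
  exact h

/-- The summands of `tensorTerm`. -/
abbrev tensorSummand (k : ℕ) (p : TensorIndex k) :
    DirGraph.{u} × DirGraph.{u} ⥤ ModuleCat.{u} R :=
  (reachabilityHomology R p.1.1).prod (reachabilityHomology R p.1.2) ⋙
    MonoidalCategory.tensor (ModuleCat.{u} R)

/-- The summands of `torTerm`. -/
abbrev torSummand (k : ℕ) (p : TorIndex k) : DirGraph.{u} × DirGraph.{u} ⥤ ModuleCat.{u} R :=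
  (reachabilityHomology R p.1.1).prod (reachabilityHomology R p.1.2) ⋙
    Functor.uncurry.obj (Tor (ModuleCat.{u} R) 1)

variable {R} in
/-- The inclusion of a summand of `tensorTerm`. -/
def tensorι {k : ℕ} (P : DirGraph.{u} × DirGraph.{u}) (p : TensorIndex k) :
    (RC R P.1).homology p.1.1 ⊗[R] (RC R P.2).homology p.1.2 →ₗ[R] (tensorTerm R k).obj P :=
  ((biproduct.ι (tensorSummand R k) p).app P).hom

variable {R} in
/-- The projection onto a summand of `tensorTerm`. -/
def tensorπ {k : ℕ} (P : DirGraph.{u} × DirGraph.{u}) (p : TensorIndex k) :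
    (tensorTerm R k).obj P →ₗ[R] (RC R P.1).homology p.1.1 ⊗[R] (RC R P.2).homology p.1.2 :=
  ((biproduct.π (tensorSummand R k) p).app P).hom

variable {R} in
/-- The projection onto a summand of `torTerm`. -/
def torπ {k : ℕ} (P : DirGraph.{u} × DirGraph.{u}) (p : TorIndex k) :
    (torTerm R k).obj P →ₗ[R]
      ((Tor (ModuleCat.{u} R) 1).obj ((RC R P.1).homology p.1.1)).obj ((RC R P.2).homology p.1.2) :=
  ((biproduct.π (torSummand R k) p).app P).hom

theorem tensorι_tensorπ {k : ℕ} (P : DirGraph.{u} × DirGraph.{u}) (x : (tensorTerm R k).obj P) :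
    ∑ p, tensorι P p (tensorπ P p x) = x :=
  sum_biproduct_ι_π (tensorSummand R k) P x

theorem tensorπ_sum_tensorι {k : ℕ} (P : DirGraph.{u} × DirGraph.{u})
    (x : ∀ p : TensorIndex k, (RC R P.1).homology p.1.1 ⊗[R] (RC R P.2).homology p.1.2)
    (q : TensorIndex k) : tensorπ P q (∑ p, tensorι P p (x p)) = x q := by
  rw [map_sum, Finset.sum_eq_single q]
  · exact biproduct_π_ι_same (tensorSummand R k) P q _
  · exact fun p _ hp => biproduct_π_ι_ne (tensorSummand R k) P hp _
  · exact fun h => absurd (Finset.mem_univ q) h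

theorem torTerm_ext {k : ℕ} {P : DirGraph.{u} × DirGraph.{u}} {x y : (torTerm R k).obj P}
    (h : ∀ p, torπ P p x = torπ P p y) : x = y := biproduct_obj_ext (torSummand R k) h

/-- The component at `(i, j)` of the first map of the Künneth sequence of the strong product: the
cross product followed by the inverse of the Alexander–Whitney isomorphism. -/
def kunnethαComponent {k : ℕ} (p : TensorIndex k) :
    tensorSummand R k p ⟶ strongProduct ⋙ reachabilityHomology R k where
  app P := ModuleCat.ofHom ((awHomology R P.1 P.2 k).symm.toLinearMap ∘ₗ
    cross (K := RC R P.1) (L := RC R P.2) p)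
  naturality P Q f := by
    refine ModuleCat.hom_ext (LinearMap.ext fun t => ?_)
    apply (awHomology R Q.1 Q.2 k).injective
    refine ((awHomology R Q.1 Q.2 k).apply_symm_apply _).trans ?_
    refine Eq.trans ?_ (awHomology_naturality R f.1 f.2 k _).symm
    refine Eq.trans ?_ (congrArg _ ((awHomology R P.1 P.2 k).apply_symm_apply _).symm)
    exact (cross_naturality _ _ p t).symm

/-- The first map of the Künneth sequence of the strong product. -/
def kunnethα (k : ℕ) : tensorTerm R k ⟶ strongProduct ⋙ reachabilityHomology R k :=
  biproduct.desc (kunnethαComponent R)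

variable {R} in
/-- The first map of the Künneth sequence at a pair of directed graphs. -/
def kunnethαApp {k : ℕ} (P : DirGraph.{u} × DirGraph.{u}) :
    (tensorTerm R k).obj P →ₗ[R] (RC R (strong P.1 P.2)).homology k :=
  ((kunnethα R k).app P).hom

theorem awHomology_kunnethα_tensorι {k : ℕ} (P : DirGraph.{u} × DirGraph.{u}) (p : TensorIndex k)
    (x : (RC R P.1).homology p.1.1 ⊗[R] (RC R P.2).homology p.1.2) :
    awHomology R P.1 P.2 k (kunnethαApp P (tensorι P p x)) = cross p x := by
  have h := congrArg (fun φ => NatTrans.app φ P) (biproduct.ι_desc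
    (kunnethαComponent R (k := k)) p)
  refine Eq.trans ?_ ((awHomology R P.1 P.2 k).apply_symm_apply _)
  exact congrArg (awHomology R P.1 P.2 k) (LinearMap.congr_fun (congrArg ModuleCat.Hom.hom h) x)

theorem awHomology_kunnethα {k : ℕ} (P : DirGraph.{u} × DirGraph.{u}) (x : (tensorTerm R k).obj P) :
    awHomology R P.1 P.2 k (kunnethαApp P x) = ∑ p, cross p (tensorπ P p x) := by
  conv_lhs => rw [← tensorι_tensorπ R P x]
  rw [map_sum, map_sum]
  exact Finset.sum_congr rfl fun p _ => awHomology_kunnethα_tensorι R P p _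

variable [IsDomain R] [IsPrincipalIdealRing R]

/-- The component at `(i, j)` of the second map of the Künneth sequence of the strong product. -/
def kunnethβComponent {k : ℕ} (p : TorIndex k) :
    strongProduct ⋙ reachabilityHomology R k ⟶ torSummand R k p where
  app P := ModuleCat.ofHom (torLift (K := RC R P.1) (L := RC R P.2) p ∘ₗ
    (awHomology R P.1 P.2 k).toLinearMap)
  naturality P Q f := by
    refine ModuleCat.hom_ext (LinearMap.ext fun t => ?_)
    refine (congrArg (torLift p) (awHomology_naturality R f.1 f.2 k t)).trans ?_
    exact torLift_naturality ((reachabilityComplex R).map f.1)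
      ((reachabilityComplex R).map f.2) p (awHomology R P.1 P.2 k t)

/-- The second map of the Künneth sequence of the strong product. -/
def kunnethβ (k : ℕ) : strongProduct ⋙ reachabilityHomology R k ⟶ torTerm R k :=
  biproduct.lift (kunnethβComponent R)

variable {R} in
/-- The second map of the Künneth sequence at a pair of directed graphs. -/
def kunnethβApp {k : ℕ} (P : DirGraph.{u} × DirGraph.{u}) :
    (RC R (strong P.1 P.2)).homology k →ₗ[R] (torTerm R k).obj P :=
  ((kunnethβ R k).app P).hom

theorem torπ_kunnethβ {k : ℕ} (P : DirGraph.{u} × DirGraph.{u})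
    (x : (RC R (strong P.1 P.2)).homology k) (p : TorIndex k) :
    torπ P p (kunnethβApp P x) = torLift p (awHomology R P.1 P.2 k x) := by
  have h := congrArg (fun φ => NatTrans.app φ P) (biproduct.lift_π
    (kunnethβComponent R (k := k)) p)
  exact LinearMap.congr_fun (congrArg ModuleCat.Hom.hom h) x

theorem kunneth_comp (k : ℕ) : kunnethα R k ≫ kunnethβ R k = 0 := by
  refine NatTrans.ext (funext fun P => ModuleCat.hom_ext (LinearMap.ext fun x => ?_))
  refine torTerm_ext R (x := kunnethβApp P (kunnethαApp P x)) (y := 0) fun p => ?_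
  rw [torπ_kunnethβ, map_zero]
  apply torι_injective
  rw [torι_torLift, awHomology_kunnethα, map_sum, map_zero]
  exact Finset.sum_eq_zero fun q _ => torMap_cross p q _

theorem exists_kunnethα_eq {k : ℕ} {P : DirGraph.{u} × DirGraph.{u}}
    {y : (RC R (strong P.1 P.2)).homology k} (hy : kunnethβApp P y = 0) :
    ∃ x, kunnethαApp P x = y := by
  obtain ⟨x, hx⟩ := exists_cross_of_torMap_eq_zero (awHomology R P.1 P.2 k y) fun p => by
    rw [← torι_torLift, ← torπ_kunnethβ, hy, map_zero, map_zero]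
  refine ⟨∑ q, tensorι P q (x q), (awHomology R P.1 P.2 k).injective ?_⟩
  rw [awHomology_kunnethα, ← hx]
  exact Finset.sum_congr rfl fun q _ => congrArg (cross q) (tensorπ_sum_tensorι R P x q)

theorem kunnethβ_surjective (k : ℕ) (P : DirGraph.{u} × DirGraph.{u}) :
    Function.Surjective (kunnethβApp (R := R) (k := k) P) := by
  intro w
  obtain ⟨h, hh⟩ := exists_torMap_eq (K := RC R P.1) (L := RC R P.2)
    (fun p : TorIndex k => (torι _ _ p.1.2).hom (torπ P p w))
    (fun p => (mem_range_torι _ _ _).1 ⟨_, rfl⟩)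
  refine ⟨(awHomology R P.1 P.2 k).symm h, torTerm_ext R fun p => ?_⟩
  rw [torπ_kunnethβ]
  apply torι_injective
  rw [torι_torLift, LinearEquiv.apply_symm_apply, hh]

/-- A left inverse of the first map of the Künneth sequence, at one pair of directed graphs. It is
not natural. -/
def kunnethRetraction (k : ℕ) (P : DirGraph.{u} × DirGraph.{u}) :
    (RC R (strong P.1 P.2)).homology k →ₗ[R] (tensorTerm R k).obj P :=
  ∑ q, tensorι P q ∘ₗ crossRetraction q ∘ₗ (awHomology R P.1 P.2 k).toLinearMap

theorem kunnethRetraction_kunnethα {k : ℕ} (P : DirGraph.{u} × DirGraph.{u})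
    (x : (tensorTerm R k).obj P) : kunnethRetraction R k P (kunnethαApp P x) = x := by
  refine Eq.trans ?_ (tensorι_tensorπ R P x)
  rw [kunnethRetraction, LinearMap.sum_apply]
  refine Finset.sum_congr rfl fun q _ => congrArg (tensorι P q) ?_
  refine (congrArg (crossRetraction q) (awHomology_kunnethα R P x)).trans ?_
  rw [map_sum, Finset.sum_eq_single q]
  · exact crossRetraction_cross_same q _
  · exact fun p _ hp => crossRetraction_cross_ne hp.symm _
  · exact fun h => absurd (Finset.mem_univ q) h

/-- The Künneth sequence of the strong product. -/
def kunneth (k : ℕ) : ShortComplex (DirGraph.{u} × DirGraph.{u} ⥤ ModuleCat.{u} R) :=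
  ShortComplex.mk (kunnethα R k) (kunnethβ R k) (kunneth_comp R k)

theorem kunneth_exact (k : ℕ) (P : DirGraph.{u} × DirGraph.{u}) :
    ((kunneth R k).map ((evaluation _ _).obj P)).ShortExact where
  exact := (ShortComplex.moduleCat_exact_iff _).2 fun _ hy => exists_kunnethα_eq R hy
  mono_f := (ModuleCat.mono_iff_injective _).2
    (Function.LeftInverse.injective (kunnethRetraction_kunnethα R P))
  epi_g := (ModuleCat.epi_iff_surjective _).2 (kunnethβ_surjective R k P)

theorem kunneth_splitting (k : ℕ) (P : DirGraph.{u} × DirGraph.{u}) :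
    Nonempty ((kunneth R k).map ((evaluation _ _).obj P)).Splitting := by
  have := (kunneth_exact R k P).epi_g
  exact ⟨ShortComplex.Splitting.ofExactOfRetraction _ (kunneth_exact R k P).exact
    (ModuleCat.ofHom (kunnethRetraction R k P))
    (ModuleCat.hom_ext (LinearMap.ext (kunnethRetraction_kunnethα R P))) this⟩

/-- A natural splitting identifies `RH_k(G ⊠ H)` with a functor of the homology of `G` and of `H`.
So pairs of maps with the same effect on the homology of both factors have the same effect on the
homology of the product. -/
theorem functor_map_eq_of_splitting {k : ℕ} (s : (kunneth R k).Splitting)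
    {P Q : DirGraph.{u} × DirGraph.{u}} {f g : P ⟶ Q}
    (h₁ : ∀ i, (reachabilityHomology R i).map f.1 = (reachabilityHomology R i).map g.1)
    (h₂ : ∀ i, (reachabilityHomology R i).map f.2 = (reachabilityHomology R i).map g.2) :
    (reachabilityHomology R k).map (strongProduct.map f) =
      (reachabilityHomology R k).map (strongProduct.map g) := by
  have hprod : ∀ i j, ((reachabilityHomology R i).prod (reachabilityHomology R j)).map f =
      ((reachabilityHomology R i).prod (reachabilityHomology R j)).map g :=
    fun i j => Prod.ext (h₁ i) (h₂ j)
  have ht : (tensorTerm R k).map f = (tensorTerm R k).map g := by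
    refine ModuleCat.hom_ext (LinearMap.ext fun x => biproduct_obj_ext (tensorSummand R k)
      fun p => ?_)
    have hf := congrArg (fun φ => φ.hom x) ((biproduct.π (tensorSummand R k) p).naturality f)
    have hg := congrArg (fun φ => φ.hom x) ((biproduct.π (tensorSummand R k) p).naturality g)
    refine hf.trans (Eq.trans ?_ hg.symm)
    exact congrArg (fun φ => ((biproduct.π (tensorSummand R k) p).app P ≫
      (MonoidalCategory.tensor (ModuleCat.{u} R)).map φ).hom x) (hprod _ _)
  have ht' : (torTerm R k).map f = (torTerm R k).map g := by
    refine ModuleCat.hom_ext (LinearMap.ext fun x => biproduct_obj_ext (torSummand R k)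
      fun p => ?_)
    have hf := congrArg (fun φ => φ.hom x) ((biproduct.π (torSummand R k) p).naturality f)
    have hg := congrArg (fun φ => φ.hom x) ((biproduct.π (torSummand R k) p).naturality g)
    refine hf.trans (Eq.trans ?_ hg.symm)
    exact congrArg (fun φ => ((biproduct.π (torSummand R k) p).app P ≫
      (Functor.uncurry.obj (Tor (ModuleCat.{u} R) 1)).map φ).hom x) (hprod _ _)
  let r : strongProduct ⋙ reachabilityHomology R k ⟶ tensorTerm R k := s.r
  let q : torTerm R k ⟶ strongProduct ⋙ reachabilityHomology R k := s.s
  have hid : r ≫ kunnethα R k + kunnethβ R k ≫ q = 𝟙 _ := s.id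
  have key : ∀ φ : P ⟶ Q, (strongProduct ⋙ reachabilityHomology R k).map φ =
      r.app P ≫ (tensorTerm R k).map φ ≫ (kunnethα R k).app Q +
        (kunnethβ R k).app P ≫ (torTerm R k).map φ ≫ q.app Q := fun φ => by
    have h := congrArg (fun ψ => (strongProduct ⋙ reachabilityHomology R k).map φ ≫
      NatTrans.app ψ Q) hid
    rw [NatTrans.app_add, Preadditive.comp_add, NatTrans.comp_app, NatTrans.comp_app,
      NatTrans.id_app, Category.comp_id, NatTrans.naturality_assoc, NatTrans.naturality_assoc] at h
    exact h.symm
  change (strongProduct ⋙ reachabilityHomology R k).map f =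
    (strongProduct ⋙ reachabilityHomology R k).map g
  rw [key f, key g, ht, ht']

/-! ### The box product -/

/-- The box product and the strong product have the same generators. -/
def boxGenEquiv (G H : DirGraph.{u}) (k : ℕ) :
    (boxProduct.obj (G, H)).Gen k ≃ (strong G H).Gen k :=
  Equiv.subtypeEquivRight fun _ => and_congr Iff.rfl (forall_congr' fun _ => box_reachable_iff)

instance isIso_map_boxToStrong (P : DirGraph.{u} × DirGraph.{u}) :
    IsIso ((reachabilityComplex R).map (boxToStrong.app P)) := by
  have : ∀ k, IsIso (((reachabilityComplex R).map (boxToStrong.app P)).f k) := fun k => by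
    rw [ConcreteCategory.isIso_iff_bijective]
    have h : (((reachabilityComplex R).map (boxToStrong.app P)).f k).hom =
        ((genBasis R (boxProduct.obj P) k).equiv (genBasis R (strongProduct.obj P) k)
          (boxGenEquiv P.1 P.2 k)).toLinearMap := by
      refine (genBasis R (boxProduct.obj P) k).ext fun v => ?_
      refine Eq.trans ?_ (Module.Basis.equiv_apply _ v _ _).symm
      rw [genBasis_apply, genBasis_apply]
      exact map_gen (boxToStrong.app P) v.2.2
    exact congrArg (fun f => Function.Bijective f) (congrArg DFunLike.coe h) ▸
      LinearEquiv.bijective _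
  exact HomologicalComplex.Hom.isIso_of_components _

/-- The box product and the strong product have the same reachability homology. -/
def boxHomologyIso (k : ℕ) :
    boxProduct ⋙ reachabilityHomology R k ≅ strongProduct ⋙ reachabilityHomology R k :=
  have : ∀ P, IsIso ((Functor.whiskerRight boxToStrong (reachabilityComplex R)).app P) :=
    isIso_map_boxToStrong R
  have := NatIso.isIso_of_isIso_app (Functor.whiskerRight boxToStrong (reachabilityComplex R))
  Functor.isoWhiskerRight (asIso (Functor.whiskerRight boxToStrong (reachabilityComplex R)))
    (HomologicalComplex.homologyFunctor _ _ k)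

/-- The Künneth theorem for a functor isomorphic to the homology of the strong product. -/
theorem exists_kunneth_of_iso {k : ℕ} {F : DirGraph.{u} × DirGraph.{u} ⥤ ModuleCat.{u} R}
    (e : F ≅ strongProduct ⋙ reachabilityHomology R k)
    (hk : 3 ≤ k → (∃ n : ℤ, (n : R) ≠ 0 ∧ ¬ IsUnit (n : R)) → IsEmpty (kunneth R k).Splitting) :
    ∃ (α : tensorTerm R k ⟶ F) (β : F ⟶ torTerm R k) (w : α ≫ β = 0),
      (∀ G H : DirGraph.{u},
        ((ShortComplex.mk α β w).map ((evaluation _ _).obj (G, H))).ShortExact ∧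
        Nonempty ((ShortComplex.mk α β w).map ((evaluation _ _).obj (G, H))).Splitting) ∧
      (3 ≤ k → (∃ n : ℤ, (n : R) ≠ 0 ∧ ¬ IsUnit (n : R)) →
        IsEmpty (ShortComplex.mk α β w).Splitting) := by
  have w : (kunnethα R k ≫ e.inv) ≫ e.hom ≫ kunnethβ R k = 0 := by
    rw [Category.assoc, e.inv_hom_id_assoc, kunneth_comp]
  let i : ShortComplex.mk _ _ w ≅ kunneth R k :=
    ShortComplex.isoMk (Iso.refl _) e (Iso.refl _) (by simp [kunneth]) (by simp [kunneth])
  refine ⟨kunnethα R k ≫ e.inv, e.hom ≫ kunnethβ R k, w, fun G H => ⟨?_, ?_⟩, fun h₃ hn => ?_⟩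
  · exact (ShortComplex.shortExact_iff_of_iso (((evaluation _ _).obj (G, H)).mapShortComplex.mapIso
      i)).2 (kunneth_exact R k (G, H))
  · obtain ⟨s⟩ := kunneth_splitting R k (G, H)
    exact ⟨s.ofIso (((evaluation _ _).obj (G, H)).mapShortComplex.mapIso i).symm⟩
  · exact ⟨fun s => (hk h₃ hn).false (s.ofIso i)⟩

end DirGraph

namespace DirGraph

open ChainComplex

/-! ### Reachability complexes in low degrees -/

section LowDegrees

variable {R : Type u} [CommRing R] {G H : DirGraph.{u}}

/-- In a transitive graph, such as a poset, reachability is adjacency or equality. -/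
theorem reachable_iff_of_transitive
    (h : ∀ u v w, G.graph.Adj u v → G.graph.Adj v w → G.graph.Adj u w) (u v : G.V) :
    G.Reachable u v ↔ u = v ∨ G.graph.Adj u v := by
  constructor
  · intro huv
    induction (reachable_iff G u v).1 huv with
    | refl => exact Or.inl rfl
    | tail _ hbc ih =>
      rcases ih ((reachable_iff G _ _).2 ‹_›) with rfl | h'
      · exact Or.inr hbc
      · exact Or.inr (h _ _ _ h' hbc)
  · rintro (rfl | h')
    · exact Reachable.refl _
    · exact Reachable.of_adj h'

theorem isChain_pair {u v : G.V} (h : G.Reachable u v) : IsChain (k := 1) ![u, v] := by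
  intro j
  fin_cases j
  exact h

theorem isChain_triple {u v w : G.V} (h : G.Reachable u v) (h' : G.Reachable v w) :
    IsChain (k := 2) ![u, v, w] := by
  intro j
  fin_cases j
  exacts [h, h']

theorem bd_pair {u v : G.V} (h : G.Reachable u v) :
    (RC R G).bd 0 (gen R (k := 1) ![u, v]) = gen R (k := 0) ![v] - gen R (k := 0) ![u] := by
  rw [bd_gen (isChain_pair h), Fin.sum_univ_two, Fin.val_zero, Fin.val_one, pow_zero, pow_one,
    one_smul, neg_one_smul, sub_eq_add_neg]
  congr 3
  all_goals
    funext i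
    fin_cases i
    rfl

theorem bd_triple {u v w : G.V} (h : G.Reachable u v) (h' : G.Reachable v w) :
    (RC R G).bd 1 (gen R (k := 2) ![u, v, w]) =
      gen R (k := 1) ![v, w] - gen R (k := 1) ![u, w] + gen R (k := 1) ![u, v] := by
  rw [bd_gen (isChain_triple h h'), Fin.sum_univ_three, Fin.val_zero, Fin.val_one, Fin.val_two,
    pow_zero, pow_one, one_smul, neg_one_smul, neg_one_sq, one_smul, sub_eq_add_neg]
  congr 3 <;> (try congr 1) <;> · funext i; fin_cases i <;> rfl

theorem map_pair (f : G ⟶ H) {u v : G.V} (h : G.Reachable u v) :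
    (((reachabilityComplex R).map f).f 1).hom (gen R (k := 1) ![u, v]) =
      gen R (k := 1) ![f.toFun u, f.toFun v] := by
  rw [map_gen f (isChain_pair h)]
  congr 1
  funext i
  fin_cases i <;> rfl

theorem map_triple (f : G ⟶ H) {u v w : G.V} (h : G.Reachable u v) (h' : G.Reachable v w) :
    (((reachabilityComplex R).map f).f 2).hom (gen R (k := 2) ![u, v, w]) =
      gen R (k := 2) ![f.toFun u, f.toFun v, f.toFun w] := by
  rw [map_gen f (isChain_triple h h')]
  congr 1
  funext i
  fin_cases i <;> rfl

section

variable {N : Type*} [AddCommGroup N] [Module R N]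

theorem RC_hom_ext_zero {f g : (RC R G).X 0 →ₗ[R] N}
    (h : ∀ u, f (gen R (k := 0) ![u]) = g (gen R (k := 0) ![u])) : f = g :=
  RC_hom_ext fun v _ _ => by
    rw [show v = ![v 0] from funext fun i => by fin_cases i; rfl]
    exact h _

theorem RC_hom_ext_one {f g : (RC R G).X 1 →ₗ[R] N}
    (h : ∀ u v, u ≠ v → G.Reachable u v →
      f (gen R (k := 1) ![u, v]) = g (gen R (k := 1) ![u, v])) : f = g :=
  RC_hom_ext fun v hr hv => by
    rw [show v = ![v 0, v 1] from funext fun i => by fin_cases i <;> rfl]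
    exact h _ _ (hr 0) (hv 0)

theorem RC_hom_ext_two {f g : (RC R G).X 2 →ₗ[R] N}
    (h : ∀ u v w, u ≠ v → G.Reachable u v → v ≠ w → G.Reachable v w →
      f (gen R (k := 2) ![u, v, w]) = g (gen R (k := 2) ![u, v, w])) : f = g :=
  RC_hom_ext fun v hr hv => by
    rw [show v = ![v 0, v 1, v 2] from funext fun i => by fin_cases i <;> rfl]
    exact h _ _ _ (hr 0) (hv 0) (hr 1) (hv 1)

/-- The linear map on chains of degree `1` given by a function of two vertices. -/
def cochainOne (F : G.V → G.V → N) : (RC R G).X 1 →ₗ[R] N := cochain fun v => F (v 0) (v 1)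

theorem cochainOne_pair {F : G.V → G.V → N} (hF : ∀ v, F v v = 0) {u v : G.V}
    (h : G.Reachable u v) : cochainOne F (gen R (k := 1) ![u, v]) = F u v := by
  refine cochain_gen (fun w hw => ?_) (isChain_pair h)
  by_contra h0
  refine hw fun j => ?_
  fin_cases j
  intro h1
  exact h0 ((congrArg (F (w 0)) h1.symm).trans (hF _))

end

theorem eq_zero_of_repr {k : ℕ} {z : (RC R G).X k}
    (h : ∀ v : G.Gen k, (genBasis R G k).repr z v = 0) : z = 0 :=
  (genBasis R G k).repr.map_eq_zero_iff.1 (Finsupp.ext h)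

open Classical in
/-- The coefficient of a chain of degree `2` at a triple of vertices. -/
def coeffTwo (u v w : G.V) : (RC R G).X 2 →ₗ[R] R :=
  cochain fun t => if IsRegular t ∧ t 0 = u ∧ t 1 = v ∧ t 2 = w then 1 else 0

open Classical in
theorem coeffTwo_triple (u v w : G.V) {u' v' w' : G.V} (h : G.Reachable u' v') (h₁ : u' ≠ v')
    (h' : G.Reachable v' w') (h₁' : v' ≠ w') :
    coeffTwo (R := R) u v w (gen R (k := 2) ![u', v', w']) =
      if u' = u ∧ v' = v ∧ w' = w then 1 else 0 := by
  refine (cochain_gen (fun t ht => if_neg fun h => ht h.1) (isChain_triple h h')).trans ?_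
  have : IsRegular (k := 2) ![u', v', w'] := fun j => by
    fin_cases j
    exacts [h₁, h₁']
  simp [this]

theorem eq_zero_of_coeffTwo {z : (RC R G).X 2} (h : ∀ u v w, u ≠ v → G.Reachable u v → v ≠ w →
    G.Reachable v w → coeffTwo u v w z = 0) : z = 0 := by
  classical
  refine eq_zero_of_repr fun ⟨t, hr, hc⟩ => ?_
  refine Eq.trans ?_ (h (t 0) (t 1) (t 2) (hr 0) (hc 0) (hr 1) (hc 1))
  refine LinearMap.congr_fun (f := (genBasis R G 2).coord ⟨t, hr, hc⟩)
    ((genBasis R G 2).ext fun s => ?_) z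
  rw [Module.Basis.coord_apply, Module.Basis.repr_self, genBasis_apply, coeffTwo,
    cochain_gen (fun t ht => if_neg fun h => ht h.1) s.2.2, Finsupp.single_apply]
  refine if_congr ⟨?_, fun h' => Subtype.ext (funext fun i => ?_)⟩ rfl rfl
  · rintro rfl
    exact ⟨hr, rfl, rfl, rfl⟩
  · fin_cases i
    exacts [h'.2.1, h'.2.2.1, h'.2.2.2]

/-- Being a boundary means vanishing modulo boundaries. In this form it can be deduced from an
equality of linear maps, which is checked on generators. -/
theorem exists_bd_eq {k : ℕ} {z : (RC R G).X k}
    (h : ((LinearMap.range ((RC R G).bd k)).mkQ) z = 0) : ∃ w, (RC R G).bd k w = z :=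
  (Submodule.Quotient.mk_eq_zero _).1 h

end LowDegrees

/-! ### A poset model of the two-sphere -/

/-- The vertices of the poset model of the two-sphere: three levels with two elements each. -/
inductive SphereVertex : Type u
  | p (s : Bool)
  | q (s : Bool)
  | r (s : Bool)

/-- The order of the poset model of the two-sphere: the levels are ordered. -/
inductive SphereAdj : SphereVertex.{u} → SphereVertex.{u} → Prop
  | pq (s t : Bool) : SphereAdj (.p s) (.q t)
  | pr (s t : Bool) : SphereAdj (.p s) (.r t)
  | qr (s t : Bool) : SphereAdj (.q s) (.r t)

/-- The poset model of the two-sphere, the join of three pairs of points. -/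
abbrev sphere : DirGraph.{u} where
  V := SphereVertex.{u}
  graph := { Adj := SphereAdj }

namespace Sphere

open SphereVertex

theorem reachable_iff' (u v : SphereVertex.{u}) :
    sphere.{u}.Reachable u v ↔ u = v ∨ SphereAdj u v :=
  reachable_iff_of_transitive (G := sphere.{u}) (by
    rintro _ _ _ (_ | _ | _) (_ | _ | _)
    exact .pr _ _) u v

theorem reachable_of {u v : SphereVertex.{u}} (h : SphereAdj u v) : sphere.{u}.Reachable u v :=
  Reachable.of_adj (G := sphere.{u}) h

theorem adj_of {u v : SphereVertex.{u}} (h : sphere.{u}.Reachable u v) (h' : u ≠ v) :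
    SphereAdj u v := ((reachable_iff' u v).1 h).resolve_left h'

variable {R : Type u} [CommRing R]

theorem hom_ext_one {N : Type*} [AddCommGroup N] [Module R N]
    {f g : (RC R sphere.{u}).X 1 →ₗ[R] N}
    (h : ∀ u v, SphereAdj u v → f (gen R (G := sphere.{u}) (k := 1) ![u, v]) =
      g (gen R (G := sphere.{u}) (k := 1) ![u, v])) : f = g :=
  RC_hom_ext_one fun u v h₁ h₂ => h u v (adj_of h₂ h₁)

theorem hom_ext_two {N : Type*} [AddCommGroup N] [Module R N]
    {f g : (RC R sphere.{u}).X 2 →ₗ[R] N}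
    (h : ∀ s t w, f (gen R (G := sphere.{u}) (k := 2) ![p s, q t, r w]) =
      g (gen R (G := sphere.{u}) (k := 2) ![p s, q t, r w])) : f = g :=
  RC_hom_ext_two fun u v w h₁ h₂ h₃ h₄ => by
    have h₅ := adj_of h₂ h₁
    have h₆ := adj_of h₄ h₃
    rcases h₅ with _ | _ | _ <;> rcases h₆ with _ | _ | _
    exact h _ _ _

/-- The poset has only three levels. -/
theorem eq_zero_of_three_le {k : ℕ} (hk : 3 ≤ k) (z : (RC R sphere.{u}).X k) : z = 0 := by
  refine eq_zero_of_repr fun ⟨v, hr, hc⟩ => ?_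
  have h : ∀ j, SphereAdj (v (Fin.castSucc j)) (v (Fin.succ j)) := fun j => adj_of (hc j) (hr j)
  have no_chain : ∀ a b c d, SphereAdj a b → SphereAdj b c → ¬ SphereAdj c d := by
    rintro _ _ _ _ (_ | _ | _) (_ | _ | _) (_ | _ | _)
  exact absurd (h ⟨2, by omega⟩) (no_chain _ _ _ _ (h ⟨0, by omega⟩) (h ⟨1, by omega⟩))

theorem exists_bd_zero (v : SphereVertex.{u}) :
    ∃ w, (RC R sphere.{u}).bd 0 w =
      gen R (G := sphere.{u}) (k := 0) ![v] - gen R (G := sphere.{u}) (k := 0) ![r true] := by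
  have h : ∀ s t, (RC R sphere.{u}).bd 0 (gen R (G := sphere.{u}) (k := 1) ![p s, r t]) = _ :=
    fun s t => bd_pair (reachable_of (.pr s t))
  rcases v with s | s | s
  · exact ⟨-gen R (G := sphere.{u}) (k := 1) ![p s, r true], by rw [map_neg, h, neg_sub]⟩
  · refine ⟨-gen R (G := sphere.{u}) (k := 1) ![q s, r true], ?_⟩
    rw [map_neg, bd_pair (reachable_of (.qr s true)), neg_sub]
  · refine ⟨gen R (G := sphere.{u}) (k := 1) ![p true, r s] -
      gen R (G := sphere.{u}) (k := 1) ![p true, r true], ?_⟩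
    rw [map_sub, h, h, sub_sub_sub_cancel_right]

/-- The first homology of the sphere vanishes. -/
theorem exists_bd_one {z : (RC R sphere.{u}).X 1} (hz : (RC R sphere.{u}).bd 0 z = 0) :
    ∃ w, (RC R sphere.{u}).bd 1 w = z := by
  apply exists_bd_eq
  set Q := (LinearMap.range ((RC R sphere.{u}).bd 1)).mkQ
  let φ : SphereVertex.{u} → SphereVertex.{u} → _ :=
    fun u v => Q (gen R (G := sphere.{u}) (k := 1) ![u, v])
  have hφ : ∀ s t w, φ (q t) (r w) - φ (p s) (r w) + φ (p s) (q t) = 0 := fun s t w => by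
    have : Q ((RC R sphere.{u}).bd 1 (gen R (G := sphere.{u}) (k := 2) ![p s, q t, r w])) = 0 :=
      (Submodule.Quotient.mk_eq_zero _).2 ⟨_, rfl⟩
    rwa [bd_triple (reachable_of (.pq s t)) (reachable_of (.qr t w)), map_add, map_sub] at this
  -- A potential of the cocycle `φ`.
  let P : SphereVertex.{u} → _
    | p s => -φ (p s) (r true)
    | q s => -φ (q s) (r true)
    | r true => 0
    | r false => φ (p true) (r false) - φ (p true) (r true)
  have hP : ∀ u v, SphereAdj u v → φ u v = P v - P u := by
    rintro _ _ (⟨s, t⟩ | ⟨s, _ | _⟩ | ⟨t, _ | _⟩)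
    · change φ (p s) (q t) = -φ (q t) (r true) - -φ (p s) (r true)
      linear_combination (norm := abel) hφ s t true
    · change φ (p s) (r false) = φ (p true) (r false) - φ (p true) (r true) - -φ (p s) (r true)
      linear_combination (norm := abel) hφ true true false - hφ true true true -
        (hφ s true false - hφ s true true)
    · change φ (p s) (r true) = 0 - -φ (p s) (r true)
      rw [zero_sub, neg_neg]
    · change φ (q t) (r false) = φ (p true) (r false) - φ (p true) (r true) - -φ (q t) (r true)
      linear_combination (norm := abel) hφ true t false - hφ true t true
    · change φ (q t) (r true) = 0 - -φ (q t) (r true)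
      rw [zero_sub, neg_neg]
  have : Q = cochain (fun v => P (v 0)) ∘ₗ (RC R sphere.{u}).bd 0 := by
    refine hom_ext_one fun u v h => ?_
    rw [LinearMap.comp_apply, bd_pair (reachable_of h), map_sub,
      cochain_gen (fun v h => absurd (fun j => j.elim0) h) fun j => j.elim0,
      cochain_gen (fun v h => absurd (fun j => j.elim0) h) fun j => j.elim0]
    exact hP u v h
  rw [this, LinearMap.comp_apply, hz, map_zero]

/-- A cycle of degree `2` of the sphere is determined by one coefficient. -/
theorem eq_zero_of_coeff {z : (RC R sphere.{u}).X 2} (hz : (RC R sphere.{u}).bd 1 z = 0)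
    (h : coeffTwo (G := sphere.{u}) (p false) (q true) (r false) z = 0) : z = 0 := by
  classical
  let F : Bool → Bool → Bool → R := fun s t w =>
    coeffTwo (G := sphere.{u}) (p s) (q t) (r w) z
  let E : sphere.{u}.V → sphere.{u}.V → (RC R sphere.{u}).X 1 →ₗ[R] R := fun u v =>
    cochainOne fun a b => if a ≠ b ∧ a = u ∧ b = v then 1 else 0
  have hE : ∀ u v a b, SphereAdj a b → E u v (gen R (G := sphere.{u}) (k := 1) ![a, b]) =
      if a ≠ b ∧ a = u ∧ b = v then 1 else 0 := fun u v a b h =>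
    cochainOne_pair (fun a => if_neg fun h => h.1 rfl) (reachable_of h)
  have eval : ∀ (φ : (RC R sphere.{u}).X 1 →ₗ[R] R) s t w,
      (φ ∘ₗ (RC R sphere.{u}).bd 1) (gen R (G := sphere.{u}) (k := 2) ![p s, q t, r w]) =
        φ (gen R (G := sphere.{u}) (k := 1) ![q t, r w]) -
        φ (gen R (G := sphere.{u}) (k := 1) ![p s, r w]) +
        φ (gen R (G := sphere.{u}) (k := 1) ![p s, q t]) := fun φ s t w => by
    rw [LinearMap.comp_apply, bd_triple (reachable_of (.pq s t)) (reachable_of (.qr t w)), map_add,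
      map_sub]
  have evalF : ∀ s t w s' t' w', coeffTwo (R := R) (G := sphere.{u}) (p s) (q t) (r w)
      (gen R (G := sphere.{u}) (k := 2) ![p s', q t', r w']) =
      if s' = s ∧ t' = t ∧ w' = w then 1 else 0 := fun s t w s' t' w' =>
    (coeffTwo_triple _ _ _ (reachable_of (.pq s' t')) (by rintro ⟨⟩) (reachable_of (.qr t' w'))
      (by rintro ⟨⟩)).trans (if_congr (by simp) rfl rfl)
  -- The coefficients of the boundary of a chain at the three kinds of edges.
  have h₁ : ∀ t w, F false t w + F true t w = 0 := fun t w => by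
    have := LinearMap.congr_fun (f := coeffTwo (G := sphere.{u}) (p false) (q t) (r w) +
      coeffTwo (G := sphere.{u}) (p true) (q t) (r w))
      (g := E (q t) (r w) ∘ₗ (RC R sphere.{u}).bd 1)
      (hom_ext_two fun s' t' w' => by
        rw [eval, LinearMap.add_apply, evalF, evalF, hE _ _ _ _ (.qr t' w'), hE _ _ _ _ (.pr s' w'),
          hE _ _ _ _ (.pq s' t')]
        cases s' <;> simp) z
    rwa [LinearMap.comp_apply, hz, map_zero] at this
  have h₂ : ∀ s w, F s false w + F s true w = 0 := fun s w => by
    have := LinearMap.congr_fun (f := coeffTwo (G := sphere.{u}) (p s) (q false) (r w) +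
      coeffTwo (G := sphere.{u}) (p s) (q true) (r w))
      (g := -(E (p s) (r w) ∘ₗ (RC R sphere.{u}).bd 1))
      (hom_ext_two fun s' t' w' => by
        rw [LinearMap.neg_apply, eval, LinearMap.add_apply, evalF, evalF,
          hE _ _ _ _ (.qr t' w'), hE _ _ _ _ (.pr s' w'), hE _ _ _ _ (.pq s' t')]
        cases t' <;> simp) z
    rwa [LinearMap.neg_apply, LinearMap.comp_apply, hz, map_zero, neg_zero] at this
  have h₃ : ∀ s t, F s t false + F s t true = 0 := fun s t => by
    have := LinearMap.congr_fun (f := coeffTwo (G := sphere.{u}) (p s) (q t) (r false) +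
      coeffTwo (G := sphere.{u}) (p s) (q t) (r true))
      (g := E (p s) (q t) ∘ₗ (RC R sphere.{u}).bd 1)
      (hom_ext_two fun s' t' w' => by
        rw [eval, LinearMap.add_apply, evalF, evalF, hE _ _ _ _ (.qr t' w'), hE _ _ _ _ (.pr s' w'),
          hE _ _ _ _ (.pq s' t')]
        cases w' <;> simp) z
    rwa [LinearMap.comp_apply, hz, map_zero] at this
  have g₁ : ∀ s, F s true false = 0 := fun s => by
    cases s
    · exact h
    · linear_combination h₁ true false - h
  have g₂ : ∀ s t, F s t false = 0 := fun s t => by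
    cases t
    · linear_combination h₂ s false - g₁ s
    · exact g₁ s
  have g₃ : ∀ s t w, F s t w = 0 := fun s t w => by
    cases w
    · exact g₂ s t
    · linear_combination h₃ s t - g₂ s t
  refine eq_zero_of_coeffTwo fun u v w h₁ h₂ h₃ h₄ => ?_
  rcases adj_of h₂ h₁ with _ | _ | _ <;> rcases adj_of h₄ h₃ with _ | _ | _
  exact g₃ _ _ _

end Sphere

end DirGraph

namespace DirGraph

open ChainComplex

/-! ### A poset model of a Moore space -/

/-- The vertices of the poset model of the Moore space. The elements `a i s`, `b i s` form a circle
with `4n` elements, the elements `p s`, `q s` a circle with four elements, and `c` is the apex of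
the cone on the first circle. -/
inductive MooreVertex (n : ℕ) : Type u
  | a (i : ZMod n) (s : Bool)
  | b (i : ZMod n) (s : Bool)
  | p (s : Bool)
  | q (s : Bool)
  | c

/-- The edge from the minimum `s` to the maximum `t` of a circle with four elements crosses from one
turn to the next if this is `1`. -/
def crossing {A : Type*} [Zero A] [One A] : Bool → Bool → A
  | false, true => 1
  | _, _ => 0

/-- The order of the poset model of the Moore space: the mapping cylinder of the `n`-fold covering
`a i s ↦ p s`, `b i s ↦ q s` of the small circle by the large circle, with a cone attached to the
large circle. -/
inductive MooreAdj (n : ℕ) : MooreVertex.{u} n → MooreVertex.{u} n → Prop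
  | ab (i j : ZMod n) (s t : Bool) (h : j = i + crossing s t) : MooreAdj n (.a j s) (.b i t)
  | ac (i : ZMod n) (s : Bool) : MooreAdj n (.a i s) .c
  | bc (i : ZMod n) (s : Bool) : MooreAdj n (.b i s) .c
  | ap (i : ZMod n) (s : Bool) : MooreAdj n (.a i s) (.p s)
  | aq (i : ZMod n) (s t : Bool) : MooreAdj n (.a i s) (.q t)
  | bq (i : ZMod n) (s : Bool) : MooreAdj n (.b i s) (.q s)
  | pq (s t : Bool) : MooreAdj n (.p s) (.q t)

/-- The poset model of the Moore space with first homology `R / n`. -/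
abbrev moore (n : ℕ) : DirGraph.{u} where
  V := MooreVertex.{u} n
  graph := { Adj := MooreAdj n }

namespace Moore

open MooreVertex

variable {n : ℕ}

theorem adj_trans (u v w : MooreVertex.{u} n) (h : MooreAdj n u v) (h' : MooreAdj n v w) :
    MooreAdj n u w := by
  rcases h with ⟨_, _, _, _, rfl⟩ | _ | _ | _ | _ | _ | _ <;>
    rcases h' with ⟨_, _, _, _, rfl⟩ | _ | _ | _ | _ | _ | _
  exacts [.ac _ _, .aq _ _ _, .aq _ _ _]

theorem reachable_of {u v : MooreVertex.{u} n} (h : MooreAdj n u v) :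
    (moore.{u} n).Reachable u v := Reachable.of_adj (G := moore.{u} n) h

theorem adj_of {u v : MooreVertex.{u} n} (h : (moore.{u} n).Reachable u v) (h' : u ≠ v) :
    MooreAdj n u v :=
  ((reachable_iff_of_transitive (G := moore.{u} n) adj_trans u v).1 h).resolve_left h'

variable {R : Type u} [CommRing R]

theorem hom_ext_two {N : Type*} [AddCommGroup N] [Module R N]
    {f g : (RC R (moore.{u} n)).X 2 →ₗ[R] N}
    (h₁ : ∀ i s t, f (gen R (G := moore.{u} n) (k := 2) ![a (i + crossing s t) s, b i t, c]) =
      g (gen R (G := moore.{u} n) (k := 2) ![a (i + crossing s t) s, b i t, c]))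
    (h₂ : ∀ i s t, f (gen R (G := moore.{u} n) (k := 2) ![a (i + crossing s t) s, b i t, q t]) =
      g (gen R (G := moore.{u} n) (k := 2) ![a (i + crossing s t) s, b i t, q t]))
    (h₃ : ∀ i s t, f (gen R (G := moore.{u} n) (k := 2) ![a i s, p s, q t]) =
      g (gen R (G := moore.{u} n) (k := 2) ![a i s, p s, q t])) : f = g :=
  RC_hom_ext_two fun u v w h₄ h₅ h₆ h₇ => by
    have h₈ := adj_of h₅ h₄
    have h₉ := adj_of h₇ h₆
    rcases h₈ with ⟨_, _, _, _, rfl⟩ | _ | _ | _ | _ | _ | _ <;>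
      rcases h₉ with ⟨_, _, _, _, rfl⟩ | _ | _ | _ | _ | _ | _
    exacts [h₁ _ _ _, h₂ _ _ _, h₃ _ _ _]

open Classical in
/-- The map to the sphere that sends the large circle to the equator, the cone on it to one
hemisphere, and the mapping cylinder to the other one, with the small circle going to the pole. On
the large circle it has degree one: only one edge is mapped to the edge from `p false` to
`q true`. -/
def toSphere (n : ℕ) : moore.{u} n ⟶ sphere.{u} where
  toFun
    | a i s => .p (if i = 0 ∧ s = false then false else true)
    | b i s => .q (if i = -1 ∧ s = true then true else false)
    | c => .r false
    | p _ => .r true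
    | q _ => .r true
  map_edge := by
    rintro _ _ (⟨_, _, _, _, rfl⟩ | _ | _ | _ | _ | _ | _)
    exacts [Or.inr (.pq _ _), Or.inr (.pr _ _), Or.inr (.qr _ _), Or.inr (.pr _ _),
      Or.inr (.pr _ _), Or.inr (.qr _ _), Or.inl rfl]

/-- The constant map to the sphere. -/
def constSphere (n : ℕ) : moore.{u} n ⟶ sphere.{u} where
  toFun _ := .r true
  map_edge _ _ _ := Or.inl rfl

/-- A cochain that winds once around the small circle. Each crossing on the large circle contributes
`1`, which on the cone is balanced by the values `0, …, n - 1` of the representatives of `i`, except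
for a jump of `n` at one edge. So its coboundary is `n` times the pullback of the fundamental
cochain of the sphere. -/
def windingFun (R : Type u) [CommRing R] : MooreVertex.{u} n → MooreVertex.{u} n → R
  | a i _, c => (i.cast : R)
  | b i _, c => (i.cast : R)
  | a _ s, b _ t => crossing s t
  | a _ s, q t => crossing s t
  | p s, q t => crossing s t
  | _, _ => 0

variable (n R) in
/-- The linear map given by `windingFun`. -/
def winding : (RC R (moore.{u} n)).X 1 →ₗ[R] R := cochainOne (G := moore.{u} n) (windingFun R)

theorem winding_pair {u v : MooreVertex.{u} n} (h : MooreAdj n u v) :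
    winding n R (gen R (G := moore.{u} n) (k := 1) ![u, v]) = windingFun R u v :=
  cochainOne_pair (G := moore.{u} n) (F := windingFun R)
    (by rintro (_ | _ | _ | _ | _) <;> rfl) (reachable_of h)

variable (R) in
/-- The fundamental cochain of the sphere. -/
def fundamental : (RC R sphere.{u}).X 2 →ₗ[R] R :=
  coeffTwo (G := sphere.{u}) (.p false) (.q true) (.r false)

theorem fundamental_triple (s t w : Bool) :
    fundamental R (gen R (G := sphere.{u}) (k := 2) ![.p s, .q t, .r w]) =
      if s = false ∧ t = true ∧ w = false then 1 else 0 := by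
  classical
  exact (coeffTwo_triple _ _ _ (Sphere.reachable_of (.pq s t)) (by rintro ⟨⟩)
    (Sphere.reachable_of (.qr t w)) (by rintro ⟨⟩)).trans (if_congr (by simp) rfl rfl)

/-- The coboundary of the winding cochain is `n` times the pullback of the fundamental cochain. -/
theorem winding_bd [NeZero n] (x : (RC R (moore.{u} n)).X 2) :
    winding n R ((RC R (moore.{u} n)).bd 1 x) =
      (n : R) * fundamental R ((((reachabilityComplex R).map (toSphere.{u} n)).f 2).hom x) := by
  classical
  refine LinearMap.congr_fun (f := winding n R ∘ₗ (RC R (moore.{u} n)).bd 1)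
    (g := (n : R) • (fundamental R ∘ₗ (((reachabilityComplex R).map (toSphere.{u} n)).f 2).hom))
    (hom_ext_two (fun i s t => ?_) (fun i s t => ?_) (fun i s t => ?_)) x
  · rw [LinearMap.comp_apply, bd_triple (reachable_of (.ab i _ s t rfl)) (reachable_of (.bc i t)),
      map_add, map_sub, winding_pair (.ab i _ s t rfl), winding_pair (.bc i t),
      winding_pair (.ac _ s), LinearMap.smul_apply, LinearMap.comp_apply,
      map_triple _ (reachable_of (.ab i _ s t rfl)) (reachable_of (.bc i t))]
    refine Eq.trans ?_ (congrArg _ (fundamental_triple _ _ _)).symm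
    have hi := ZMod.cast_sub_one (R := R) (i + 1)
    rw [add_sub_cancel_right] at hi
    cases s <;> cases t <;> simp only [windingFun, crossing, add_zero, sub_self]
    · simp
    · simp only [hi, eq_neg_iff_add_eq_zero]
      by_cases h : i + 1 = 0 <;> simp [h]
    · simp
    · simp
  · rw [LinearMap.comp_apply, bd_triple (reachable_of (.ab i _ s t rfl)) (reachable_of (.bq i t)),
      map_add, map_sub, winding_pair (.ab i _ s t rfl), winding_pair (.bq i t),
      winding_pair (.aq _ s t), LinearMap.smul_apply, LinearMap.comp_apply,
      map_triple _ (reachable_of (.ab i _ s t rfl)) (reachable_of (.bq i t))]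
    refine Eq.trans ?_ (congrArg _ (fundamental_triple _ _ _)).symm
    simp [windingFun]
  · rw [LinearMap.comp_apply, bd_triple (reachable_of (.ap i s)) (reachable_of (.pq s t)),
      map_add, map_sub, winding_pair (.ap i s), winding_pair (.pq s t),
      winding_pair (.aq _ s t), LinearMap.smul_apply, LinearMap.comp_apply,
      map_triple _ (reachable_of (.ap i s)) (reachable_of (.pq s t))]
    have : gen R (G := sphere.{u}) (k := 2) ![(toSphere n).toFun (a i s), (toSphere n).toFun (p s),
        (toSphere n).toFun (q t)] = 0 := gen_of_eq (j := 1) rfl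
    refine Eq.trans ?_ (congrArg (fun y => (n : R) • fundamental R y) this).symm
    simp [windingFun]

/-- The sign of an edge of the small circle in its fundamental cycle. -/
def sign {A : Type*} [One A] [Neg A] : Bool → Bool → A
  | false, true => 1
  | true, false => 1
  | _, _ => -1

variable (n R) in
/-- The fundamental cycle of the small circle. -/
def circleChain : (RC R (moore.{u} n)).X 1 :=
  ∑ s, ∑ t, sign (A := R) s t • gen R (G := moore.{u} n) (k := 1) ![p s, q t]

theorem bd_circleChain : (RC R (moore.{u} n)).bd 0 (circleChain n R) = 0 := by
  have h : ∀ s t, (RC R (moore.{u} n)).bd 0 (gen R (G := moore.{u} n) (k := 1) ![p s, q t]) = _ :=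
    fun s t => bd_pair (reachable_of (.pq s t))
  simp only [circleChain, Fintype.sum_bool, map_add, map_smul, h, sign]
  module

theorem winding_circleChain : winding n R (circleChain n R) = 1 := by
  have h : ∀ s t, winding n R (gen R (G := moore.{u} n) (k := 1) ![p s, q t]) = crossing s t :=
    fun s t => winding_pair (.pq s t)
  simp only [circleChain, Fintype.sum_bool, map_add, map_smul, h, sign, crossing]
  simp

variable (n R) in
/-- A chain whose boundary is `n` times the fundamental cycle of the small circle: the cone on the
large circle and the mapping cylinder. -/
def fillingChain [NeZero n] : (RC R (moore.{u} n)).X 2 :=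
  ∑ s, ∑ t, sign (A := R) s t • ∑ i : ZMod n,
    (gen R (G := moore.{u} n) (k := 2) ![a (i + crossing s t) s, b i t, c] -
      gen R (G := moore.{u} n) (k := 2) ![a (i + crossing s t) s, b i t, q t] +
      gen R (G := moore.{u} n) (k := 2) ![a (i + crossing s t) s, p s, q t])

theorem bd_fillingChain [NeZero n] :
    (RC R (moore.{u} n)).bd 1 (fillingChain n R) = (n : R) • circleChain n R := by
  have h : ∀ s t (i : ZMod n), (RC R (moore.{u} n)).bd 1
      (gen R (G := moore.{u} n) (k := 2) ![a (i + crossing s t) s, b i t, c] -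
        gen R (G := moore.{u} n) (k := 2) ![a (i + crossing s t) s, b i t, q t] +
        gen R (G := moore.{u} n) (k := 2) ![a (i + crossing s t) s, p s, q t]) =
      (gen R (G := moore.{u} n) (k := 1) ![b i t, c] -
        gen R (G := moore.{u} n) (k := 1) ![b i t, q t]) +
      (gen R (G := moore.{u} n) (k := 1) ![a (i + crossing s t) s, p s] -
        gen R (G := moore.{u} n) (k := 1) ![a (i + crossing s t) s, c]) +
      gen R (G := moore.{u} n) (k := 1) ![p s, q t] := fun s t i => by
    rw [map_add, map_sub, bd_triple (reachable_of (.ab i _ s t rfl)) (reachable_of (.bc i t)),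
      bd_triple (reachable_of (.ab i _ s t rfl)) (reachable_of (.bq i t)),
      bd_triple (reachable_of (.ap _ s)) (reachable_of (.pq s t))]
    abel
  have h' : ∀ s t, (RC R (moore.{u} n)).bd 1 (∑ i : ZMod n,
      (gen R (G := moore.{u} n) (k := 2) ![a (i + crossing s t) s, b i t, c] -
        gen R (G := moore.{u} n) (k := 2) ![a (i + crossing s t) s, b i t, q t] +
        gen R (G := moore.{u} n) (k := 2) ![a (i + crossing s t) s, p s, q t])) =
      ∑ i, (gen R (G := moore.{u} n) (k := 1) ![b i t, c] -
        gen R (G := moore.{u} n) (k := 1) ![b i t, q t]) +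
      ∑ i, (gen R (G := moore.{u} n) (k := 1) ![a i s, p s] -
        gen R (G := moore.{u} n) (k := 1) ![a i s, c]) +
      (n : R) • gen R (G := moore.{u} n) (k := 1) ![p s, q t] := fun s t => by
    rw [map_sum, Finset.sum_congr rfl fun i _ => h s t i, Finset.sum_add_distrib,
      Finset.sum_add_distrib, Finset.sum_const, Finset.card_univ,
      ZMod.card, Nat.cast_smul_eq_nsmul]
    congr 2
    exact Equiv.sum_comp (Equiv.addRight (crossing s t : ZMod n)) fun i =>
      gen R (G := moore.{u} n) (k := 1) ![a i s, p s] -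
        gen R (G := moore.{u} n) (k := 1) ![a i s, c]
  simp only [fillingChain, circleChain, Fintype.sum_bool, map_add, map_smul, h', sign]
  module

end Moore

end DirGraph

namespace DirGraph

open ChainComplex TensorProduct

/-! ### Two maps with the same effect on homology -/

namespace Moore

open MooreVertex

variable {R : Type u} [CommRing R] {n : ℕ}

theorem map_constSphere_two (z : (RC R (moore.{u} n)).X 2) :
    (((reachabilityComplex R).map (constSphere.{u} n)).f 2).hom z = 0 := by
  refine LinearMap.congr_fun (f := (((reachabilityComplex R).map (constSphere.{u} n)).f 2).hom)
    (g := 0) (RC_hom_ext_two fun u v w h₁ h₂ h₃ h₄ => ?_) z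
  rw [map_triple _ h₂ h₄]
  exact gen_of_eq (j := 0) rfl

theorem map_toSphere_circleChain :
    (((reachabilityComplex R).map (toSphere.{u} n)).f 1).hom (circleChain n R) = 0 := by
  have h : ∀ s t, (((reachabilityComplex R).map (toSphere.{u} n)).f 1).hom
      (gen R (G := moore.{u} n) (k := 1) ![p s, q t]) = 0 := fun s t => by
    rw [map_pair _ (reachable_of (.pq s t))]
    exact gen_of_eq (j := 0) rfl
  simp only [circleChain, Fintype.sum_bool, map_add, map_smul, h, smul_zero, add_zero]

/-- The map to the sphere kills cycles of degree `2`: by `winding_bd`, `n` times the degree of the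
image is zero. -/
theorem map_toSphere_two [IsDomain R] [NeZero n] (hn : (n : R) ≠ 0)
    {z : (RC R (moore.{u} n)).X 2} (hz : (RC R (moore.{u} n)).bd 1 z = 0) :
    (((reachabilityComplex R).map (toSphere.{u} n)).f 2).hom z = 0 := by
  refine Sphere.eq_zero_of_coeff ((map_bd _ 1 z).symm.trans ((congrArg _ hz).trans (map_zero _))) ?_
  have h := winding_bd (R := R) z
  rw [hz, map_zero] at h
  exact (mul_eq_zero.1 h.symm).resolve_left hn

/-- The map to the sphere induces the same map as the constant map on homology in all degrees. -/
theorem map_toSphere_eq [IsDomain R] [NeZero n] (hn : (n : R) ≠ 0) (i : ℕ) :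
    (reachabilityHomology R i).map (toSphere.{u} n) =
      (reachabilityHomology R i).map (constSphere.{u} n) := by
  refine ModuleCat.hom_ext (homology_hom_ext fun z => ?_)
  refine (homologyMap_cls _ i z).trans (Eq.trans (cls_eq_cls.2 ?_) (homologyMap_cls _ i z).symm)
  obtain ⟨z, hz⟩ := z
  change ∃ w, _ = (((reachabilityComplex R).map (toSphere.{u} n)).f i).hom z -
    (((reachabilityComplex R).map (constSphere.{u} n)).f i).hom z
  match i with
  | 0 =>
    apply exists_bd_eq
    refine LinearMap.congr_fun (f := (LinearMap.range ((RC R sphere.{u}).bd 0)).mkQ ∘ₗ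
      ((((reachabilityComplex R).map (toSphere.{u} n)).f 0).hom -
        (((reachabilityComplex R).map (constSphere.{u} n)).f 0).hom)) (g := 0)
      (RC_hom_ext_zero fun v => ?_) z
    have h : ∀ f : moore.{u} n ⟶ sphere.{u},
        (((reachabilityComplex R).map f).f 0).hom (gen R (k := 0) ![v]) =
          gen R (k := 0) ![f.toFun v] := fun f => by
      rw [map_gen f (fun j => j.elim0)]
      congr 1
      funext i
      fin_cases i
      rfl
    rw [LinearMap.comp_apply, LinearMap.sub_apply, h, h]
    exact (Submodule.Quotient.mk_eq_zero _).2 (Sphere.exists_bd_zero _)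
  | 1 =>
    apply Sphere.exists_bd_one
    rw [map_sub, ← map_bd, ← map_bd, mem_cyc_succ.1 hz, map_zero, map_zero, sub_zero]
  | 2 => exact ⟨0, by rw [map_toSphere_two hn hz, map_constSphere_two, map_zero, sub_zero]⟩
  | i + 3 => exact ⟨0, (Sphere.eq_zero_of_three_le (by omega) _).trans
      (Sphere.eq_zero_of_three_le (by omega) _).symm⟩

/-! ### Two products of maps with different effects on homology -/

variable (R n) in
/-- The coefficients of the functionals that detect the torsion. -/
abbrev Coeff : Type u := R ⧸ Ideal.span {(n : R)}

theorem algebraMap_coeff (x : R) : algebraMap R (Coeff R n) ((n : R) * x) = 0 := by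
  rw [Ideal.Quotient.algebraMap_eq, Ideal.Quotient.eq_zero_iff_mem]
  exact Ideal.mem_span_singleton.2 (dvd_mul_right _ _)

variable (R n) in
/-- The functional on the first homology of the Moore space given by the winding number. -/
def windingClass [NeZero n] : (RC R (moore.{u} n)).homology 1 →ₗ[R] Coeff R n :=
  clsLift (Algebra.linearMap R (Coeff R n) ∘ₗ winding n R ∘ₗ Submodule.subtype _) fun w => by
    change algebraMap R _ (winding n R ((RC R (moore.{u} n)).bd 1 w)) = 0
    rw [winding_bd, algebraMap_coeff]

variable (R n) in
/-- The functional on the second homology of the sphere given by the fundamental cochain. -/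
def fundamentalClass : (RC R sphere.{u}).homology 2 →ₗ[R] Coeff R n :=
  clsLift (Algebra.linearMap R (Coeff R n) ∘ₗ fundamental R ∘ₗ Submodule.subtype _) fun w => by
    rw [Sphere.eq_zero_of_three_le le_rfl w]
    change algebraMap R _ (fundamental R ((RC R sphere.{u}).bd 2 0)) = 0
    rw [map_zero, map_zero, map_zero]

variable (R n) in
/-- The fundamental cycle of the small circle, as a cycle. -/
def circleCycle : (RC R (moore.{u} n)).cyc 1 :=
  ⟨circleChain n R, mem_cyc_succ.2 bd_circleChain⟩

theorem windingClass_circleCycle [NeZero n] :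
    windingClass R n ((RC R (moore.{u} n)).cls 1 (circleCycle R n)) = 1 := by
  rw [windingClass, clsLift_cls]
  change algebraMap R _ (winding n R (circleChain n R)) = 1
  rw [winding_circleChain, map_one]

end Moore

section Functional

variable {R : Type u} [CommRing R] [IsDomain R] [IsPrincipalIdealRing R] {A : Type u} [CommRing A]
  [Algebra R A] {K L : ChainComplex (ModuleCat.{u} R) ℕ} [∀ i, Module.Free R (K.X i)]
  [∀ i, Module.Free R (L.X i)]

/-- The product of two functionals on homology, as a functional on the homology of the tensor
product. -/
def crossFunctional {k : ℕ} (p : TensorIndex k) (φ : K.homology p.1.1 →ₗ[R] A)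
    (ψ : L.homology p.1.2 →ₗ[R] A) : (tensor K L).homology k →ₗ[R] A :=
  LinearMap.mul' R A ∘ₗ TensorProduct.map φ ψ ∘ₗ crossRetraction p

theorem crossFunctional_cross {k : ℕ} (p : TensorIndex k) (φ : K.homology p.1.1 →ₗ[R] A)
    (ψ : L.homology p.1.2 →ₗ[R] A) (x : K.homology p.1.1) (y : L.homology p.1.2) :
    crossFunctional p φ ψ (cross p (x ⊗ₜ y)) = φ x * ψ y := by
  rw [crossFunctional, LinearMap.comp_apply, LinearMap.comp_apply, crossRetraction_cross_same]
  rfl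

end Functional

/-- One half of the associativity of the strong product. -/
def strongAssoc (G H M : DirGraph.{u}) : strong (strong G H) M ⟶ strong G (strong H M) where
  toFun x := (x.1.1, x.1.2, x.2)
  map_edge := by
    rintro ⟨⟨a, b⟩, c⟩ ⟨⟨a', b'⟩, c'⟩ h
    refine Or.inr ?_
    rcases h with ⟨h, h'⟩ | ⟨h | h | h, h'⟩ | ⟨h | h | h, h'⟩
    · have h : (a, b) = (a', b') := h
      exact Or.inl ⟨(Prod.mk.inj h).1, Or.inl ⟨(Prod.mk.inj h).2, h'⟩⟩
    · exact Or.inl ⟨h.1, Or.inr (Or.inl ⟨h.2, h'⟩)⟩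
    · exact Or.inr (Or.inl ⟨h.1, Prod.ext h.2 h'⟩)
    · exact Or.inr (Or.inr ⟨h.1, Or.inr (Or.inl ⟨h.2, h'⟩)⟩)
    · exact Or.inl ⟨h.1, Or.inr (Or.inr ⟨h.2, h'⟩)⟩
    · exact Or.inr (Or.inr ⟨h.1, Or.inl ⟨h.2, h'⟩⟩)
    · exact Or.inr (Or.inr ⟨h.1, Or.inr (Or.inr ⟨h.2, h'⟩)⟩)

/-- The other half of the associativity of the strong product. -/
def strongAssocInv (G H M : DirGraph.{u}) : strong G (strong H M) ⟶ strong (strong G H) M where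
  toFun x := ((x.1, x.2.1), x.2.2)
  map_edge := by
    rintro ⟨a, b, c⟩ ⟨a', b', c'⟩ h
    refine Or.inr ?_
    rcases h with ⟨h, h' | h' | h'⟩ | ⟨h, h'⟩ | ⟨h, h' | h' | h'⟩
    · exact Or.inl ⟨Prod.ext h h'.1, h'.2⟩
    · exact Or.inr (Or.inl ⟨Or.inl ⟨h, h'.1⟩, h'.2⟩)
    · exact Or.inr (Or.inr ⟨Or.inl ⟨h, h'.1⟩, h'.2⟩)
    · have h' : (b, c) = (b', c') := h'
      exact Or.inr (Or.inl ⟨Or.inr (Or.inl ⟨h, (Prod.mk.inj h').1⟩), (Prod.mk.inj h').2⟩)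
    · exact Or.inr (Or.inr ⟨Or.inr (Or.inl ⟨h, h'.1⟩), h'.2⟩)
    · exact Or.inr (Or.inl ⟨Or.inr (Or.inr ⟨h, h'.1⟩), h'.2⟩)
    · exact Or.inr (Or.inr ⟨Or.inr (Or.inr ⟨h, h'.1⟩), h'.2⟩)

variable (R : Type u) [CommRing R] [IsDomain R] [IsPrincipalIdealRing R] (n : ℕ)

/-- The map on homology induced by a map times the identity. -/
abbrev mapTimes {G G' : DirGraph.{u}} (f : G ⟶ G') (H : DirGraph.{u}) (k : ℕ) :
    (RC R (strong G H)).homology k →ₗ[R] (RC R (strong G' H)).homology k :=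
  ((reachabilityHomology R k).map
    (strongProduct.map (X := (G, H)) (Y := (G', H)) (f, 𝟙 H))).hom

/-- There is a directed graph `H` such that the two maps from the Moore space to the sphere induce
different maps on the homology in degree `k` after taking the product with `H`, and the difference
is seen by a functional. -/
def Separated (k : ℕ) : Prop :=
  ∃ (H : DirGraph.{u}) (x : (RC R (strong (moore.{u} n) H)).homology k)
    (φ : (RC R (strong sphere.{u} H)).homology k →ₗ[R] Moore.Coeff R n),
    φ (mapTimes R (Moore.toSphere n) H k x) = 1 ∧ φ (mapTimes R (Moore.constSphere n) H k x) = 0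

/-- For `H` the Moore space itself, with `∂e₂ = n e₁`, the chain `e₂ ⊗ e₁ + e₁ ⊗ e₂` is a cycle
that represents a torsion class in degree `3`. The map to the sphere takes it to the fundamental
cycle times `e₁`, which is nonzero modulo `n`, whereas the constant map kills `e₂`. -/
theorem separated_three [NeZero n] (hn : (n : R) ≠ 0) : Separated R n 3 := by
  let M := moore.{u} n
  let p : TensorIndex 3 := ⟨(2, 1), rfl⟩
  let e₁ := Moore.circleChain n R
  let e₂ := Moore.fillingChain n R
  let z : (tensor (RC R M) (RC R M)).X 3 :=
    incl ⟨(2, 1), rfl⟩ (e₂ ⊗ₜ e₁) + incl ⟨(1, 2), rfl⟩ (e₁ ⊗ₜ e₂)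
  have he₁ : e₁ ∈ (RC R M).cyc 1 := (Moore.circleCycle R n).2
  have hz : z ∈ (tensor (RC R M) (RC R M)).cyc 3 := by
    rw [mem_cyc_succ, map_add, bd_incl_left (i := 1) (j := 1) rfl e₂ he₁,
      bd_incl_right (i := 1) (j := 1) rfl he₁ e₂, Moore.bd_fillingChain, ← smul_tmul', tmul_smul,
      pow_one, neg_one_smul, add_neg_cancel]
  let φ : (RC R (strong sphere.{u} M)).homology 3 →ₗ[R] Moore.Coeff R n :=
    crossFunctional p (Moore.fundamentalClass R n) (Moore.windingClass R n) ∘ₗ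
      (awHomology R _ _ _).toLinearMap
  have key : ∀ f : moore.{u} n ⟶ sphere.{u},
      (RC R sphere.{u}).bd 1 ((((reachabilityComplex R).map f).f 2).hom e₂) = 0 →
      φ (mapTimes R f M 3 ((awHomology R _ _ _).symm ((tensor (RC R M) (RC R M)).cls 3 ⟨z, hz⟩))) =
        algebraMap R _ (Moore.fundamental R ((((reachabilityComplex R).map f).f 2).hom e₂)) := by
    intro f hf
    have h₁ := awHomology_naturality R f (𝟙 M) 3
      ((awHomology R _ _ _).symm ((tensor (RC R M) (RC R M)).cls 3 ⟨z, hz⟩))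
    rw [LinearEquiv.apply_symm_apply, homologyMap_cls] at h₁
    refine (congrArg (crossFunctional p (Moore.fundamentalClass R n)
      (Moore.windingClass R n)) h₁).trans ?_
    rw [crossFunctional, LinearMap.comp_apply, LinearMap.comp_apply, crossRetraction_cls]
    have h₂ : coord p (((tensorMap ((reachabilityComplex R).map f)
        ((reachabilityComplex R).map (𝟙 M))).f 3).hom z) =
        (((reachabilityComplex R).map f).f 2).hom e₂ ⊗ₜ[R] e₁ := by
      rw [coord_tensorMap, map_add, coord_incl_same, coord_incl_ne (by simp [p]), add_zero,
        (reachabilityComplex R).map_id]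
      rfl
    refine (congrArg (fun t => LinearMap.mul' R _ (TensorProduct.map _ _
      (TensorProduct.map _ _ t))) h₂).trans ?_
    rw [map_tmul, map_tmul, LinearMap.mul'_apply]
    have h₃ : (RC R sphere.{u}).extCls 2 ((((reachabilityComplex R).map f).f 2).hom e₂) =
      (RC R sphere.{u}).cls 2 ⟨_, mem_cyc_succ.2 hf⟩ := extCls_coe ⟨_, mem_cyc_succ.2 hf⟩
    have h₄ : (RC R M).extCls 1 e₁ = (RC R M).cls 1 (Moore.circleCycle R n) :=
      extCls_coe (Moore.circleCycle R n)
    refine (congrArg₂ (fun a b => Moore.fundamentalClass R n a * Moore.windingClass R n b) h₃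
      h₄).trans ?_
    rw [Moore.windingClass_circleCycle, mul_one, Moore.fundamentalClass, clsLift_cls]
    rfl
  refine ⟨M, (awHomology R _ _ _).symm ((tensor (RC R M) (RC R M)).cls 3 ⟨z, hz⟩), φ,
    (key _ ?_).trans ?_, (key _ ?_).trans ?_⟩
  · rw [← map_bd, Moore.bd_fillingChain, map_smul, Moore.map_toSphere_circleChain, smul_zero]
  · have h := Moore.winding_bd (R := R) e₂
    rw [Moore.bd_fillingChain, map_smul, Moore.winding_circleChain, smul_eq_mul] at h
    rw [← mul_left_cancel₀ hn h, map_one]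
  · rw [Moore.map_constSphere_two, map_zero]
  · rw [Moore.map_constSphere_two, map_zero, map_zero]

/-- Multiplying by one more Moore space, and by the class of degree `1` of its circle, raises the
degree by one. -/
theorem Separated.succ [NeZero n] {k : ℕ} (h : Separated R n k) : Separated R n (k + 1) := by
  obtain ⟨H, x, φ, h₁, h₀⟩ := h
  let M := moore.{u} n
  let p : TensorIndex (k + 1) := ⟨(k, 1), rfl⟩
  let τ := (RC R M).cls 1 (Moore.circleCycle R n)
  let y : (RC R (strong (strong (moore.{u} n) H) M)).homology (k + 1) :=
    (awHomology R _ _ _).symm (cross p (x ⊗ₜ τ))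
  let ψ : (RC R (strong (strong sphere.{u} H) M)).homology (k + 1) →ₗ[R] Moore.Coeff R n :=
    crossFunctional p φ (Moore.windingClass R n) ∘ₗ (awHomology R _ _ _).toLinearMap
  have key : ∀ f : moore.{u} n ⟶ sphere.{u},
      ψ (((reachabilityHomology R (k + 1)).map (strongAssocInv sphere.{u} H M)).hom
        (mapTimes R f (strong H M) (k + 1) (((reachabilityHomology R (k + 1)).map
          (strongAssoc (moore.{u} n) H M)).hom y))) = φ (mapTimes R f H k x) := fun f => by
    have h₁ := awHomology_naturality R (strongProduct.map (X := (moore.{u} n, H))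
      (Y := (sphere.{u}, H)) (f, 𝟙 H)) (𝟙 M) (k + 1) y
    rw [LinearEquiv.apply_symm_apply, cross_naturality] at h₁
    have h₂ := congrArg (crossFunctional p φ (Moore.windingClass R n)) h₁
    have h₃ : (HomologicalComplex.homologyMap ((reachabilityComplex R).map (𝟙 M)) 1).hom τ = τ :=
      congrArg (fun g => ModuleCat.Hom.hom g τ) ((reachabilityHomology R 1).map_id M)
    refine Eq.trans ?_ (h₂.trans ((crossFunctional_cross p _ _ _ _).trans ?_))
    · refine congrArg ψ ?_
      have h₄ : strongAssoc (moore.{u} n) H M ≫ strongProduct.map (X := (moore.{u} n, strong H M))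
          (Y := (sphere.{u}, strong H M)) (f, 𝟙 (strong H M)) ≫ strongAssocInv sphere.{u} H M =
          strongProduct.map (X := (strong (moore.{u} n) H, M)) (Y := (strong sphere.{u} H, M))
            (strongProduct.map (X := (moore.{u} n, H)) (Y := (sphere.{u}, H)) (f, 𝟙 H), 𝟙 M) := rfl
      have h₅ := congrArg (fun g => ModuleCat.Hom.hom ((reachabilityHomology R (k + 1)).map g) y) h₄
      rw [Functor.map_comp, Functor.map_comp] at h₅
      exact h₅
    · rw [h₃, Moore.windingClass_circleCycle, mul_one]
      rfl
  exact ⟨strong H M, ((reachabilityHomology R (k + 1)).map (strongAssoc (moore.{u} n) H M)).hom y,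
    ψ ∘ₗ ((reachabilityHomology R (k + 1)).map (strongAssocInv sphere.{u} H M)).hom,
    (key _).trans h₁, (key _).trans h₀⟩

theorem separated_of_three_le [NeZero n] (hn : (n : R) ≠ 0) {k : ℕ} (hk : 3 ≤ k) :
    Separated R n k := by
  induction k, hk using Nat.le_induction with
  | base => exact separated_three R n hn
  | succ k _ ih => exact ih.succ

/-- For `k ≥ 3` the Künneth sequence has no natural splitting as soon as some integer is neither
zero nor a unit in `R`. -/
theorem isEmpty_kunneth_splitting (k : ℕ) (hk : 3 ≤ k)
    (hm : ∃ m : ℤ, (m : R) ≠ 0 ∧ ¬ IsUnit (m : R)) : IsEmpty (kunneth R k).Splitting := by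
  obtain ⟨n, hn, hu⟩ : ∃ n : ℕ, (n : R) ≠ 0 ∧ ¬ IsUnit (n : R) := by
    obtain ⟨m, hm, hu⟩ := hm
    refine ⟨m.natAbs, ?_⟩
    rcases Int.natAbs_eq m with h | h
    · rw [h, Int.cast_natCast] at hm hu
      exact ⟨hm, hu⟩
    · rw [h, Int.cast_neg, Int.cast_natCast] at hm hu
      exact ⟨neg_ne_zero.1 hm, fun h => hu h.neg⟩
  have : NeZero n := ⟨by rintro rfl; exact hn Nat.cast_zero⟩
  refine ⟨fun s => ?_⟩
  obtain ⟨H, x, φ, h₁, h₀⟩ := separated_of_three_le R n hn hk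
  have h := functor_map_eq_of_splitting R s (P := (moore.{u} n, H)) (Q := (sphere.{u}, H))
    (f := (Moore.toSphere n, 𝟙 H)) (g := (Moore.constSphere n, 𝟙 H))
    (Moore.map_toSphere_eq hn) (fun _ => rfl)
  have h' : (1 : Moore.Coeff R n) = 0 :=
    h₁.symm.trans ((congrArg (fun f => φ (ModuleCat.Hom.hom f x)) h).trans h₀)
  rw [← map_one (Ideal.Quotient.mk _), Ideal.Quotient.eq_zero_iff_mem,
    Ideal.mem_span_singleton] at h'
  exact hu (isUnit_of_dvd_one h')

end DirGraph

end

theorem mainTheorem2 (R : Type u) [CommRing R] [IsDomain R] [IsPrincipalIdealRing R] (k : ℕ) :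
    (∃ (α : DirGraph.tensorTerm R k ⟶
          DirGraph.strongProduct ⋙ DirGraph.reachabilityHomology R k)
        (β : DirGraph.strongProduct ⋙ DirGraph.reachabilityHomology R k ⟶
          DirGraph.torTerm R k)
        (w : α ≫ β = 0),
      (∀ G H : DirGraph.{u},
        ((ShortComplex.mk α β w).map ((evaluation _ _).obj (G, H))).ShortExact ∧
        Nonempty ((ShortComplex.mk α β w).map ((evaluation _ _).obj (G, H))).Splitting) ∧
      (3 ≤ k → (∃ n : ℤ, (n : R) ≠ 0 ∧ ¬ IsUnit (n : R)) →
        IsEmpty (ShortComplex.mk α β w).Splitting)) ∧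
    (∃ (α : DirGraph.tensorTerm R k ⟶
          DirGraph.boxProduct ⋙ DirGraph.reachabilityHomology R k)
        (β : DirGraph.boxProduct ⋙ DirGraph.reachabilityHomology R k ⟶
          DirGraph.torTerm R k)
        (w : α ≫ β = 0),
      (∀ G H : DirGraph.{u},
        ((ShortComplex.mk α β w).map ((evaluation _ _).obj (G, H))).ShortExact ∧
        Nonempty ((ShortComplex.mk α β w).map ((evaluation _ _).obj (G, H))).Splitting) ∧
      (3 ≤ k → (∃ n : ℤ, (n : R) ≠ 0 ∧ ¬ IsUnit (n : R)) →
        IsEmpty (ShortComplex.mk α β w).Splitting)) := by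
  exact ⟨DirGraph.exists_kunneth_of_iso R (Iso.refl _) (DirGraph.isEmpty_kunneth_splitting R k),
    DirGraph.exists_kunneth_of_iso R (DirGraph.boxHomologyIso R k)
      (DirGraph.isEmpty_kunneth_splitting R k)⟩
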